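/- Let $n\ge 1$, let $M$ be a smooth Hausdorff manifold of dimension $2n+1$ with a contact distribution $\Delta$ and a smooth scalar product $g$ on $\Delta$. Let $H(p,q)=\frac12\sup_{v\in\Delta_q\setminus\{0\}}\langle p,v\rangle^2/g_q(v,v)$ be the sub-Riemannian Hamiltonian and, for $q_0\in M$, let $\mathcal E_{q_0}(t,p)$ be the projection to $M$ of the integral curve of the Hamiltonian vector field $\vec H$ on $T^*M$ starting at $(q_0,p)$, at time $t$. The first conjugate time $t_c(p)$ is the smallest $t>0$ such that $\mathcal E_{q_0}(t,\cdot)$ is critical at $p$. Let $(x_1,\dots,x_{2n},z)$ be coordinates centred at $q_0$ and $(X_1,\dots,X_{2n})$ an orthonormal frame of $(\Delta,g)$ in Agrachev--Gauthier normal form at $q_0$: writing $(Y)_j$ for the coordinates of a vector field $Y$ (with $(Y)_{2n+1}$ the $z$-component), one has $(X_i)_j=(X_j)_i$ and $\sum_j (X_j)_i x_j=x_i$ for $1\le i,j\le 2n$, $\sum_j (X_j)_{2n+1}x_j=0$, and to first order at $q_0$ $(X_{2i-1})_{2n+1}\approx \frac{b_i}{2}x_{2i}$, $(X_{2i})_{2n+1}\approx-\frac{b_i}{2}x_{2i-1}$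 for $1\le i\le n$, where $b_1,\dots,b_n>0$ are the nilpotent invariants at $q_0$. Assume they are distinct, indexed so that $b_1>b_2>\dots>b_n>0$. Use on $T^*_{q_0}M$ the coordinates $(h,h_0)=(h_1,\dots,h_{2n},h_0)$ dual to $X_1(q_0),\dots,X_{2n}(q_0),\partial_z$, and put $F(\tau,h,\eta)=\mathcal E_{q_0}(\eta\tau;(h,\eta^{-1}))$ and $\tau_c(h,\eta)=\eta^{-1}t_c(h,\eta^{-1})$. Then there are real numbers $\kappa^{ij}_k$ ($1\le i\le j\le 2n$, $1\le k\le 2n$), $\alpha$, $\beta$ such that, as $\eta\to0^+$ with $h$ fixed, the coefficient of $\eta^2$ in the expansion, with remainder $O(\eta^3)$, of the coordinate $F_k(2\pi/b_1,h,\eta)$ is $\sum_{i\le j}\kappa^{ij}_kh_ih_j$; such that $\kappa^{11}_1=3\alpha$, $\kappa^{22}_1=\alpha$, $\kappa^{12}_2=2\alpha$, $\kappa^{11}_2=\beta$, $\kappa^{22}_2=3\beta$, $\kappa^{12}_1=2\beta$; and such that the following holds with $$\gamma_{ij}=\sum_{k=3}^{2n}\kappa^{jk}_ih_k\quad (i,j\in\{1,2\}),$$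 $$\delta_1=\alpha(h_1^2+h_2^2)^2+(h_1^2+h_2^2)\sum_{3\le i\le j\le 2n}\kappa^{ij}_1h_ih_j,\qquad \delta_2=\beta(h_1^2+h_2^2)^2+(h_1^2+h_2^2)\sum_{3\le i\le j\le 2n}\kappa^{ij}_2h_ih_j .$$ For all $R>0$ and $\varepsilon\in(0,1)$, as $\eta\to0^+$, uniformly with respect to the covectors $p_0=(h,\eta^{-1})$ with $0<H(p_0,q_0)<R$ and $h_1^2+h_2^2\ge\varepsilon H(p_0,q_0)$, the first conjugate time exists, the first conjugate point lies in the coordinate domain, and its first two coordinates are $$F(\tau_c(h,\eta),h,\eta)_1=\frac{\eta^2}{h_1^2+h_2^2}\Big((\gamma_{11}-\gamma_{22})h_1^3+\gamma_{12}h_2^3+(\gamma_{21}+2\gamma_{12})h_1^2h_2+\delta_1\Big)+O(\eta^3),$$ $$F(\tau_c(h,\eta),h,\eta)_2=\frac{\eta^2}{h_1^2+h_2^2}\Big(\gamma_{12}h_1^3-(\gamma_{11}-\gamma_{22})h_2^3+(\gamma_{12}+2\gamma_{21})h_1h_2^2+\delta_2\Big)+O(\eta^3).$$ -/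

import Mathlib

open scoped Manifold ContDiff Topology

noncomputable section

/-- The model space `ℝ^(2n+1)` with coordinates `(x₁, …, x_{2n}, z)`: the coordinate `x_{k+1}` has
index `k.castSucc` for `k : Fin (2n)`, and `z` has index `Fin.last (2n)`. -/
abbrev Model (n : ℕ) : Type := EuclideanSpace ℝ (Fin (2 * n + 1))

/-- Index of the coordinate `x_{2i-1}` of the `i`-th pair (`i = 1, …, n`, here `i : Fin n`). -/
def oddIdx {n : ℕ} (i : Fin n) : Fin (2 * n) := ⟨2 * i.val, by omega⟩

/-- Index of the coordinate `x_{2i}` of the `i`-th pair. -/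
def evenIdx {n : ℕ} (i : Fin n) : Fin (2 * n) := ⟨2 * i.val + 1, by omega⟩

section Charts

variable {n : ℕ} {M : Type*} [TopologicalSpace M] [ChartedSpace (Model n) M]

/-- The tangent vector of `M` at `φ⁻¹(y)` whose coordinates in the chart `φ` are `v`. -/
def chartVec (φ : OpenPartialHomeomorph M (Model n)) (y v : Model n) :
    TangentSpace (𝓡 (2 * n + 1)) (φ.symm y) :=
  mfderiv 𝓘(ℝ, Model n) (𝓡 (2 * n + 1)) φ.symm y ((NormedSpace.fromTangentSpace (𝕜 := ℝ) y).symm v)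

/-- The covector of `M` at `q` whose coordinates in the chart `φ` are `ξ`, that is `ξ ∘ dφ_q`. -/
def chartCovec (φ : OpenPartialHomeomorph M (Model n)) (q : M) (ξ : Model n →L[ℝ] ℝ) :
    TangentSpace (𝓡 (2 * n + 1)) q →L[ℝ] ℝ :=
  (ξ ∘L (NormedSpace.fromTangentSpace (𝕜 := ℝ) (φ q)).toContinuousLinearMap) ∘L
    mfderiv (𝓡 (2 * n + 1)) 𝓘(ℝ, Model n) φ q

variable (n M) in
/-- The cotangent bundle `T*M`, as a set of pairs `(q, p)`, `p ∈ T*_q M`. -/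
abbrev CotBundle : Type _ := Σ q : M, (TangentSpace (𝓡 (2 * n + 1)) q →L[ℝ] ℝ)

/-- The vector fields `X 1, …, X 2n`, given in coordinates on the domain of the chart `φ`, are
smooth and are at each point a `g`-orthonormal basis of `Δ`. -/
def IsOrthonormalFrame (Δ : ∀ q : M, Submodule ℝ (TangentSpace (𝓡 (2 * n + 1)) q))
    (g : ∀ q : M, LinearMap.BilinForm ℝ (Δ q))
    (φ : OpenPartialHomeomorph M (Model n)) (X : Fin (2 * n) → Model n → Model n) : Prop :=
  (∀ i, ContDiffOn ℝ ∞ (X i) φ.target) ∧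
  ∀ y ∈ φ.target,
    Submodule.span ℝ (Set.range fun i => chartVec φ y (X i y)) = Δ (φ.symm y) ∧
    ∃ hmem : ∀ i, chartVec φ y (X i y) ∈ Δ (φ.symm y),
      ∀ i j, g (φ.symm y) ⟨_, hmem i⟩ ⟨_, hmem j⟩ = if i = j then 1 else 0

/-- In the chart `φ`, the distribution `Δ` is the kernel of a smooth `1`-form `θ` such that
`θ ∧ (dθ)^n` vanishes nowhere, i.e. such that `dθ` is nondegenerate on `ker θ`. -/
def IsContactIn (Δ : ∀ q : M, Submodule ℝ (TangentSpace (𝓡 (2 * n + 1)) q))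
    (φ : OpenPartialHomeomorph M (Model n)) : Prop :=
  ∃ θ : Model n → (Model n →L[ℝ] ℝ), ContDiffOn ℝ ∞ θ φ.target ∧
    ∀ y ∈ φ.target,
      (∀ v, θ y v = 0 ↔ chartVec φ y v ∈ Δ (φ.symm y)) ∧
      ∀ u, θ y u = 0 →
        (∀ v, θ y v = 0 → fderiv ℝ θ y u v - fderiv ℝ θ y v u = 0) → u = 0

end Charts

/-- A contact sub-Riemannian structure `(Δ, g)` on a smooth manifold `M` of dimension `2n+1`:
a contact distribution `Δ` with a smooth scalar product `g` on it. Smoothness of `Δ` and `g` is the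
existence of smooth local orthonormal frames. -/
structure ContactSubRiemannian (n : ℕ) (M : Type*) [TopologicalSpace M]
    [ChartedSpace (Model n) M] where
  /-- the distribution -/
  Δ : ∀ q : M, Submodule ℝ (TangentSpace (𝓡 (2 * n + 1)) q)
  /-- the scalar product -/
  g : ∀ q : M, LinearMap.BilinForm ℝ (Δ q)
  symm : ∀ q (u v : Δ q), g q u v = g q v u
  pos : ∀ q (v : Δ q), v ≠ 0 → 0 < g q v v
  smooth : ∀ q : M, ∃ φ ∈ IsManifold.maximalAtlas (𝓡 (2 * n + 1)) ∞ M, q ∈ φ.source ∧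
    ∃ X, IsOrthonormalFrame Δ g φ X
  contact : ∀ q : M, ∃ φ ∈ IsManifold.maximalAtlas (𝓡 (2 * n + 1)) ∞ M, q ∈ φ.source ∧
    IsContactIn Δ φ

namespace ContactSubRiemannian

variable {n : ℕ} {M : Type*} [TopologicalSpace M] [ChartedSpace (Model n) M]
  (S : ContactSubRiemannian n M)

/-- The sub-Riemannian Hamiltonian `H(p, q) = ½ sup_{v ∈ Δ_q ∖ {0}} ⟨p, v⟩² / g_q(v, v)`. -/
def ham (q : M) (p : TangentSpace (𝓡 (2 * n + 1)) q →L[ℝ] ℝ) : ℝ :=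
  1 / 2 * ⨆ v : {v : S.Δ q // v ≠ 0}, p (v.1 : TangentSpace (𝓡 (2 * n + 1)) q) ^ 2 / S.g q v.1 v.1

/-- The Hamiltonian in the canonical coordinates `(y, ξ)` of `T*M` induced by the chart `φ`. -/
def hamChart (φ : OpenPartialHomeomorph M (Model n)) (y : Model n) (ξ : Model n →L[ℝ] ℝ) : ℝ :=
  S.ham (φ.symm y) (chartCovec φ (φ.symm y) ξ)

/-- `lam : [0, t] → T*M` is a normal extremal, i.e. an integral curve of the Hamiltonian vector
field: at each time, Hamilton's equations `y' = ∂H/∂ξ`, `ξ' = -∂H/∂y` hold in the canonical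
coordinates `(y, ξ)` induced by any chart `φ` of `M` around the base point. -/
def IsExtremal (t : ℝ) (lam : ℝ → CotBundle n M) : Prop :=
  ∀ s ∈ Set.Icc 0 t, ∀ φ ∈ IsManifold.maximalAtlas (𝓡 (2 * n + 1)) ∞ M, (lam s).1 ∈ φ.source →
    ∃ (y : ℝ → Model n) (ξ : ℝ → (Model n →L[ℝ] ℝ)) (y' : Model n) (ξ' : Model n →L[ℝ] ℝ),
      (∀ᶠ r in 𝓝[Set.Icc 0 t] s,
        (lam r).1 ∈ φ.source ∧ y r = φ (lam r).1 ∧ (lam r).2 = chartCovec φ (lam r).1 (ξ r)) ∧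
      HasDerivWithinAt y y' (Set.Icc 0 t) s ∧
      HasDerivWithinAt ξ ξ' (Set.Icc 0 t) s ∧
      (∀ ζ : Model n →L[ℝ] ℝ, ζ y' = fderiv ℝ (fun ξ₁ => S.hamChart φ (y s) ξ₁) (ξ s) ζ) ∧
      (∀ v : Model n, ξ' v = -fderiv ℝ (fun y₁ => S.hamChart φ y₁ (ξ s)) (y s) v)

/-- The covectors `p ∈ T*_q M` such that the extremal with initial point `(q, p)` exists on
`[0, t]`. -/
def expDomain (q : M) (t : ℝ) : Set (TangentSpace (𝓡 (2 * n + 1)) q →L[ℝ] ℝ) :=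
  {p | ∃ lam : ℝ → CotBundle n M, S.IsExtremal t lam ∧ lam 0 = ⟨q, p⟩}

open Classical in
/-- The sub-Riemannian exponential `𝓔_q(t, p)`: the projection to `M` of the extremal with initial
point `(q, p)` at time `t` (and `q` outside of the domain). -/
def srExp (q : M) (t : ℝ) (p : TangentSpace (𝓡 (2 * n + 1)) q →L[ℝ] ℝ) : M :=
  if h : ∃ lam : ℝ → CotBundle n M, S.IsExtremal t lam ∧ lam 0 = ⟨q, p⟩ then (h.choose t).1 else q

/-- `t` is a conjugate time for `p ∈ T*_q M`: `t > 0` and the map `𝓔_q(t, ·)` is critical at `p`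
(the cotangent space `T*_q M` is identified with the dual of the model space). -/
def IsConjugateTime (q : M) (p : TangentSpace (𝓡 (2 * n + 1)) q →L[ℝ] ℝ) (t : ℝ) : Prop :=
  0 < t ∧ p ∈ S.expDomain q t ∧
    ¬ Function.Surjective (mfderiv 𝓘(ℝ, Model n →L[ℝ] ℝ) (𝓡 (2 * n + 1))
      (fun p₁ : Model n →L[ℝ] ℝ => S.srExp q t p₁) p)

/-- `t` is the first conjugate time `t_c(p)`: the minimum of the conjugate times for `p`. -/
def IsFirstConjugateTime (q : M) (p : TangentSpace (𝓡 (2 * n + 1)) q →L[ℝ] ℝ) (t : ℝ) : Prop :=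
  IsLeast {t₁ | S.IsConjugateTime q p t₁} t

/-- The coordinates `φ = (x₁, …, x_{2n}, z)` and the orthonormal frame `X₁, …, X_{2n}` of `(Δ, g)`
(written in these coordinates) are in Agrachev–Gauthier normal form at `q₀`, with nilpotent
invariants `b₁, …, b_n > 0`:
* the horizontal components satisfy `(X_i)_j = (X_j)_i` and `∑_j (X_j)_i x_j = x_i`;
* the vertical components satisfy `∑_j (X_j)_z x_j = 0`;
* to first order at `q₀`, the vertical components are those of the nilpotent frame, that is
  `(X_{2i-1})_z ≈ b_i x_{2i} / 2` and `(X_{2i})_z ≈ - b_i x_{2i-1} / 2`.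
Equivalently, `dω` at `q₀` has matrix `diag((0, b_i; -b_i, 0))` in the frame, for the contact form
with `ω(∂_z) = 1`. The usual normalizations (`∂_z` is the Reeb field along the `z`-axis and
`b₁ ⋯ b_n = 1/n!`) are not imposed: any scaling of `z` is allowed. -/
structure IsNormalForm (q₀ : M) (φ : OpenPartialHomeomorph M (Model n))
    (X : Fin (2 * n) → Model n → Model n) (b : Fin n → ℝ) : Prop where
  chart_mem : φ ∈ IsManifold.maximalAtlas (𝓡 (2 * n + 1)) ∞ M
  mem_source : q₀ ∈ φ.source
  map_zero : φ q₀ = 0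
  frame : IsOrthonormalFrame S.Δ S.g φ X
  hor_symm : ∀ y ∈ φ.target, ∀ i j : Fin (2 * n), X i y j.castSucc = X j y i.castSucc
  hor_radial : ∀ y ∈ φ.target, ∀ i : Fin (2 * n), ∑ j : Fin (2 * n), X j y i.castSucc * y j.castSucc = y i.castSucc
  vert_radial : ∀ y ∈ φ.target, ∑ j : Fin (2 * n), X j y (Fin.last (2 * n)) * y j.castSucc = 0
  b_pos : ∀ i, 0 < b i
  vert_odd : ∀ i v, fderiv ℝ (fun y => X (oddIdx i) y (Fin.last (2 * n))) 0 v
    = b i / 2 * v (evenIdx i).castSucc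
  vert_even : ∀ i v, fderiv ℝ (fun y => X (evenIdx i) y (Fin.last (2 * n))) 0 v
    = -(b i / 2) * v (oddIdx i).castSucc

/-- The covector `(h₁, …, h_{2n}, h₀) ∈ T*_{q₀} M`, in the coordinates dual to the basis
`X_i(q₀) = ∂_{x_i}`, `X_0 = ∂_z` of `T_{q₀} M`. -/
def covec (q₀ : M) (φ : OpenPartialHomeomorph M (Model n)) (h : Fin (2 * n) → ℝ) (h₀ : ℝ) :
    TangentSpace (𝓡 (2 * n + 1)) q₀ →L[ℝ] ℝ :=
  chartCovec φ q₀ (∑ i : Fin (2 * n), h i • EuclideanSpace.proj (Fin.castSucc i)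
    + h₀ • EuclideanSpace.proj (Fin.last (2 * n)))

/-- The map `F(τ, h, η) = 𝓔_{q₀}(η τ; (h, η⁻¹))`. -/
def rescaledExp (q₀ : M) (φ : OpenPartialHomeomorph M (Model n)) (τ : ℝ) (h : Fin (2 * n) → ℝ)
    (η : ℝ) : M :=
  S.srExp q₀ (η * τ) (covec q₀ φ h η⁻¹)

/-- `κ` is the family of invariants `κ i j k = κ^{ij}_k` (`i ≤ j`): the coefficients of the
quadratic forms `F^{(2)}_k(2π/b₁, h) = ∑_{i ≤ j} κ^{ij}_k h_i h_j`, where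
`F_k = η F^{(1)}_k + η² F^{(2)}_k + O(η³)` as `η → 0⁺`. -/
def IsKappa [NeZero n] (q₀ : M) (φ : OpenPartialHomeomorph M (Model n)) (b : Fin n → ℝ)
    (κ : Fin (2 * n) → Fin (2 * n) → Fin (2 * n) → ℝ) : Prop :=
  ∀ (h : Fin (2 * n) → ℝ) (k : Fin (2 * n)), ∃ F₁ : ℝ,
    (fun η : ℝ => φ (S.rescaledExp q₀ φ (2 * Real.pi / b 0) h η) k.castSucc
      - (η * F₁ + η ^ 2 * ∑ i, ∑ j, if i ≤ j then κ i j k * h i * h j else 0))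
    =O[𝓝[>] 0] fun η => η ^ 3

end ContactSubRiemannian

/-- `γ_{ij} = ∑_{k = 3}^{2n} κ^{jk}_i h_k`. -/
def gammaCoef {n : ℕ} (κ : Fin (2 * n) → Fin (2 * n) → Fin (2 * n) → ℝ) (h : Fin (2 * n) → ℝ)
    (i j : Fin (2 * n)) : ℝ :=
  ∑ k, if 2 ≤ k.val then κ j k i * h k else 0

/-- `δ_m = a (h₁² + h₂²)² + (h₁² + h₂²) ∑_{3 ≤ i ≤ j ≤ 2n} κ^{ij}_m h_i h_j`. -/
def deltaCoef {n : ℕ} [NeZero n] (κ : Fin (2 * n) → Fin (2 * n) → Fin (2 * n) → ℝ) (a : ℝ)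
    (h : Fin (2 * n) → ℝ) (m : Fin (2 * n)) : ℝ :=
  a * (h (oddIdx 0) ^ 2 + h (evenIdx 0) ^ 2) ^ 2
    + (h (oddIdx 0) ^ 2 + h (evenIdx 0) ^ 2) *
      ∑ i, ∑ j, if 2 ≤ i.val ∧ i ≤ j then κ i j m * h i * h j else 0

end

/-! In dilated coordinates (x, z) ↦ (μx, μ²z) the structure becomes a smooth family of frames in μ,
nilpotent at μ = 0. Let G(c, μ) be the time-one endpoint, for the frame of parameter μ, of the
extremal from the origin with covector c. If h = λu, then F(w, h, η) is the dilate by μ = ληw of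
G((u, w), μ), so conjugate times ηw correspond to singular points of G(·, μ) (`exists_rescaledExp`).
Everything below concerns G, which is smooth across μ = 0 because flows depend smoothly on
parameters.

At μ = 0 the extremals are explicit: the i-th pair of velocities rotates with angular speed w b_i.
The derivative of G(·, 0) is injective for 0 ≤ w < w₁ = 2π/b₁, which rests on 2(1 - cos θ) - θ sin θ
> 0 on (0, 2π) (`injective_of_lt`). At w₁ the first pair closes up. Rotating that pair is then a
kernel direction, and the range is annihilated by the scalar product with the rotated vector. Since
b₁ is strictly the largest invariant and (u₁, u₂) ≠ 0, bordering by these two vectors gives an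
invertible map (`bordered_injective`). The scalar unknown of the bordered system replaces the
determinant: it is smooth in the parameters, vanishes exactly at singular points, and its
w-derivative at w₁ is nonzero (`fderiv_conj_ez`). Hence for small η there is a first singular
parameter w = w₁ + s, and, taking λ = 1, s = -ηT + O(η²) with an explicit T (`timeCoef`).

In normal form the perturbation of order μ is vertical and quadratic in x, so it acts on the
projected motion as an additional magnetic force. The first variation of the k-th coordinate of the
endpoint is then a quadratic form B_k(u, u) given by an integral (`exists_exponential`, `varForm`),
and κ collects the coefficients of w₁² B_k. For k = 1, 2 and w = w₁ + s, the k-th coordinate of the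
conjugate point is ηs u_k + η² w₁² B_k(u, u) + O(η³), that is, η²(w₁² B_k(u, u) - u_k T) + O(η³)
(`exists_first_singular`).

The stated polynomials follow from linear relations among the B_k over a full period. The factors 3
come from ∫τ² = 3∫σ² and ∫στ = 0, where σ = sin(2πs)/2π and τ = (1 - cos(2πs))/2π
(`varForm_odd_diag`, `varForm_even_diag`). The remaining relations, among them γ₁₂ = γ₂₁, come from
closedness of the perturbing two-form (`varForm_exchange`).

Uniformity comes from compactness: normalizing h to the unit sphere turns h₁² + h₂² ≥ εH into u₁² +
u₂² ≥ ε/2. To return to the manifold, the Hamiltonian of an orthonormal frame is ½ Σ P(X_i)²,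
Hamilton's equations are invariant under changes of charts, and an extremal is determined by its
initial covector (`IsFrameSolution.srExp_eq`). -/

/-! ### Smoothness of composition operators on spaces of continuous functions. -/

section Superposition

variable {K : Type*} [TopologicalSpace K] [CompactSpace K]

/-- The superposition operator `u ↦ f ∘ u` on continuous functions. -/
def superpos {E F : Type*} [TopologicalSpace E] [TopologicalSpace F] (f : C(E, F)) (u : C(K, E)) :
    C(K, F) := f.comp u

variable {E F : Type*} [NormedAddCommGroup E] [NormedSpace ℝ E] [NormedAddCommGroup F]
  [NormedSpace ℝ F]

/-- Pointwise application of a continuous family of operators. -/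
noncomputable def pointwiseApply : C(K, E →L[ℝ] F) →L[ℝ] C(K, E) →L[ℝ] C(K, F) :=
  LinearMap.mkContinuous₂
    (LinearMap.mk₂ ℝ (fun (A : C(K, E →L[ℝ] F)) (u : C(K, E)) => (⟨fun t => A t (u t), by fun_prop⟩ : C(K, F)))
      (fun _ _ _ => by ext; simp) (fun _ _ _ => by ext; simp)
      (fun _ _ _ => by ext; simp) (fun _ _ _ => by ext; simp)) 1
    (fun A u => by
      refine (ContinuousMap.norm_le _ (by positivity)).2 fun t => ?_
      simp only [LinearMap.mk₂_apply, ContinuousMap.coe_mk, one_mul]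
      exact (A t).le_of_opNorm_le_of_le (A.norm_coe_le_norm t) (u.norm_coe_le_norm t))

/-- Mean value inequality on each segment from `u t` to `u t + v t`. The control of `f'` there is
uniform in `t` because postcomposition with `f'` is continuous for the compact-open topology, so `E`
need not be locally compact. -/
theorem hasFDerivAt_superpos (f : C(E, F)) (f' : C(E, E →L[ℝ] F))
    (hf : ∀ x, HasFDerivAt f (f' x) x) (u : C(K, E)) :
    HasFDerivAt (superpos f) (pointwiseApply (superpos f' u)) u := by
  rw [hasFDerivAt_iff_isLittleO_nhds_zero, Asymptotics.isLittleO_iff]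
  intro c hc
  have hcont : Continuous (fun v : C(K, E) => superpos f' v) := f'.continuous_postcomp
  have h1 : ∀ᶠ v in 𝓝 u, dist (superpos f' v) (superpos f' u) < c :=
    (hcont.tendsto u).eventually (p := fun w => dist w (superpos f' u) < c)
      (Metric.ball_mem_nhds (superpos f' u) hc)
  obtain ⟨δ, hδ, h2⟩ := Metric.eventually_nhds_iff.1 h1
  filter_upwards [Metric.ball_mem_nhds (0 : C(K, E)) hδ] with v hv
  refine (ContinuousMap.norm_le _ (by positivity)).2 fun t => ?_
  have key : ∀ x ∈ segment ℝ (u t) (u t + v t), ‖f' x - f' (u t)‖ ≤ c := by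
    rintro x ⟨a, b, ha, hb, hab, rfl⟩
    -- A point of the segment is a value of `u + b • v` with `b ≤ 1`, a function still within `δ` of
    -- `u`.
    have h3 : dist (superpos f' (u + b • v)) (superpos f' u) < c := by
      apply h2
      rw [dist_eq_norm, add_sub_cancel_left, norm_smul, Real.norm_of_nonneg hb]
      have : ‖v‖ < δ := by simpa using hv
      nlinarith [norm_nonneg v]
    have h4 := (ContinuousMap.dist_apply_le_dist (f := superpos f' (u + b • v))
      (g := superpos f' u) t).trans h3.le
    rw [dist_eq_norm] at h4
    have h5 : a • u t + b • (u t + v t) = u t + b • v t := by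
      rw [smul_add, ← add_assoc, ← add_smul, hab, one_smul]
    rw [h5]; exact h4
  have := (convex_segment (u t) (u t + v t)).norm_image_sub_le_of_norm_hasFDerivWithin_le'
    (f := f) (f' := f') (φ := f' (u t)) (C := c) (fun x _ => (hf x).hasFDerivWithinAt) key
    (left_mem_segment _ _ _) (right_mem_segment _ _ _)
  rw [add_sub_cancel_left] at this
  exact this.trans (mul_le_mul_of_nonneg_left (v.norm_coe_le_norm t) hc.le)

-- The derivative at `u` is pointwise application of `f' ∘ u`, so the induction replaces `F` by `E
-- →L[ℝ] F`. Keeping both spaces in one universe makes this replacement legitimate in the induction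
-- hypothesis.
universe u in
theorem contDiff_superpos_nat {E : Type u} [NormedAddCommGroup E] [NormedSpace ℝ E] (n : ℕ) :
    ∀ {F : Type u} [NormedAddCommGroup F] [NormedSpace ℝ F] (f : C(E, F)), ContDiff ℝ n f →
      ContDiff ℝ n (superpos (K := K) f) := by
  induction n with
  | zero =>
    intro F _ _ f _
    exact contDiff_zero.2 f.continuous_postcomp
  | succ n ih =>
    intro F _ _ f hf
    rw [show ((n + 1 : ℕ) : ℕ∞ω) = (n : ℕ∞ω) + 1 by norm_cast] at hf
    obtain ⟨hd, -, hf'⟩ := contDiff_succ_iff_fderiv.1 hf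
    let f' : C(E, E →L[ℝ] F) := ⟨fderiv ℝ f, hf'.continuous⟩
    rw [show ((n + 1 : ℕ) : ℕ∞ω) = (n : ℕ∞ω) + 1 by norm_cast, contDiff_succ_iff_hasFDerivAt]
    have h1 : ContDiff ℝ n (pointwiseApply (K := K) (E := E) (F := F)) :=
      ContinuousLinearMap.contDiff _
    exact ⟨fun u => pointwiseApply (superpos f' u), h1.comp (ih f' hf'),
      hasFDerivAt_superpos f f' fun x => (hd x).hasFDerivAt⟩

universe u in
theorem contDiff_superpos {E F : Type u} [NormedAddCommGroup E] [NormedSpace ℝ E]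
    [NormedAddCommGroup F] [NormedSpace ℝ F] (f : C(E, F)) (hf : ContDiff ℝ ∞ f) :
    ContDiff ℝ ∞ (superpos (K := K) f) :=
  contDiff_infty.2 fun n => contDiff_superpos_nat n f (contDiff_infty.1 hf n)

end Superposition

/-! ### Integration as a bounded operator. -/

section Primitive

variable {E : Type*} [NormedAddCommGroup E] [NormedSpace ℝ E]

open MeasureTheory Set unitInterval

/-- The extension of a function on `[0, 1]` by constants. -/
noncomputable def iccExt (u : C(I, E)) (s : ℝ) : E := u (projIcc 0 1 zero_le_one s)

omit [NormedSpace ℝ E] in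
theorem continuous_iccExt (u : C(I, E)) : Continuous (iccExt u) :=
  u.continuous.comp continuous_projIcc

/-- The primitive vanishing at `0`, as a bounded operator on continuous functions on `[0, 1]`. -/
noncomputable def primitiveCLM : C(I, E) →L[ℝ] C(I, E) :=
  LinearMap.mkContinuous
    { toFun := fun u => ⟨fun t => ∫ s in (0 : ℝ)..t, iccExt u s,
        (intervalIntegral.continuous_primitive
          (fun a b => (continuous_iccExt u).intervalIntegrable a b) 0).comp
          continuous_subtype_val⟩
      map_add' := fun u v => by
        ext t
        exact intervalIntegral.integral_add ((continuous_iccExt u).intervalIntegrable _ _)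
          ((continuous_iccExt v).intervalIntegrable _ _)
      map_smul' := fun c u => by
        ext t
        exact intervalIntegral.integral_smul c _ } 1
    (fun u => by
      refine (ContinuousMap.norm_le _ (by positivity)).2 fun t => ?_
      refine (intervalIntegral.norm_integral_le_of_norm_le_const
        (C := ‖u‖) fun s _ => u.norm_coe_le_norm _).trans ?_
      rw [sub_zero, abs_of_nonneg t.2.1, one_mul]
      exact mul_le_of_le_one_right (norm_nonneg _) t.2.2)

theorem norm_primitiveCLM_le : ‖(primitiveCLM : C(I, E) →L[ℝ] C(I, E))‖ ≤ 1 :=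
  LinearMap.mkContinuous_norm_le _ zero_le_one _

end Primitive

/-! ### Global solutions of bounded Lipschitz differential equations. -/

section GlobalSolution

open Set

variable {E : Type*} [NormedAddCommGroup E] [NormedSpace ℝ E] [CompleteSpace E]

/-- In time T a field bounded by L moves a point by at most LT, so Picard–Lindelöf on the ball of
radius LT reaches all of [-T, T]; uniqueness glues these solutions together. -/
theorem exists_hasDerivAt_of_lipschitz_of_bounded {f : E → E} {K L : NNReal}
    (hf : LipschitzWith K f) (hL : ∀ x, ‖f x‖ ≤ L) (y : E) :
    ∃ α : ℝ → E, α 0 = y ∧ ∀ s, HasDerivAt α (f (α s)) s := by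
  have h : ∀ T : ℝ, 0 < T → ∃ α : ℝ → E, α 0 = y ∧ ∀ s ∈ Ioo (-T) T, HasDerivAt α (f (α s)) s := by
    intro T hT
    obtain ⟨T', rfl⟩ : ∃ T' : NNReal, (T' : ℝ) = T := ⟨⟨T, hT.le⟩, rfl⟩
    have hpl : IsPicardLindelof (fun _ => f) (tmin := -T') (tmax := T') ⟨0, by constructor <;> linarith⟩ y
        (L * T') 0 L K :=
      { lipschitzOnWith := fun _ _ => hf.lipschitzOnWith
        continuousOn := fun _ _ => continuousOn_const
        norm_le := fun _ _ x _ => hL x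
        mul_max_le := by
          rw [NNReal.coe_mul]
          simp }
    obtain ⟨α, h0, hα⟩ := hpl.exists_eq_forall_mem_Icc_hasDerivWithinAt₀
    exact ⟨α, h0, fun s hs => (hα s (Ioo_subset_Icc_self hs)).hasDerivAt (Icc_mem_nhds hs.1 hs.2)⟩
  choose! α h0 hα using h
  have huniq : ∀ T, 0 < T → ∀ T', 0 < T' → T ≤ T' → EqOn (α T) (α T') (Ioo (-T) T) := by
    intro T hT T' hT' hle
    refine ODE_solution_unique_of_mem_Ioo (v := fun _ => f) (s := fun _ => univ) (K := K) (t₀ := 0)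
      (fun _ _ => hf.lipschitzOnWith) ⟨by linarith, hT⟩ (fun t ht => ⟨hα T hT t ht, trivial⟩)
      (fun t ht => ⟨hα T' hT' t ⟨by linarith [ht.1], by linarith [ht.2]⟩, trivial⟩) ?_
    rw [h0 T hT, h0 T' hT']
  -- The horizon varies with the time of evaluation; to differentiate at `s` it is replaced, near
  -- `s`, by the fixed horizon `|s| + 1 + 1`.
  refine ⟨fun s => α (|s| + 1) s, h0 _ (by positivity), fun s => ?_⟩
  have hs : s ∈ Ioo (-(|s| + 1)) (|s| + 1) := by
    constructor <;> [linarith [neg_abs_le s]; linarith [le_abs_self s]]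
  have hT : 0 < |s| + 2 := by positivity
  have hs' : s ∈ Ioo (-(|s| + 1 + 1)) (|s| + 1 + 1) := ⟨by linarith [hs.1], by linarith [hs.2]⟩
  beta_reduce
  rw [huniq (|s| + 1) (by positivity) (|s| + 1 + 1) (by positivity) (by linarith) hs]
  refine (hα (|s| + 1 + 1) (by positivity) s hs').congr_of_eventuallyEq ?_
  filter_upwards [Ioo_mem_nhds (sub_one_lt s) (lt_add_one s)] with r hr
  have hr' : |r| < |s| + 1 := by
    have := abs_sub_abs_le_abs_sub r s
    have : |r - s| < 1 := abs_lt.2 ⟨by linarith [hr.1], by linarith [hr.2]⟩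
    linarith
  exact huniq (|r| + 1) (by positivity) (|s| + 1 + 1) (by positivity) (by linarith)
    ⟨by linarith [neg_abs_le r], by linarith [le_abs_self r]⟩

end GlobalSolution

/-! ### Smooth dependence of flows on time and initial point. -/

section Flow

open Set unitInterval Function

universe u

variable {E : Type u} [NormedAddCommGroup E] [NormedSpace ℝ E]

/-- Constant functions on `[0, 1]`, as a bounded operator. -/
noncomputable def constPathCLM : E →L[ℝ] C(I, E) :=
  LinearMap.mkContinuous
    { toFun := ContinuousMap.const I
      map_add' := fun _ _ => rfl
      map_smul' := fun _ _ => rfl } 1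
    (fun y => by
      refine (ContinuousMap.norm_le _ (by positivity)).2 fun t => ?_
      rw [one_mul]
      rfl)

/-- The map whose zeros `((σ, y), u)` are the integral curves `u` of `σ f` starting at `y`. -/
noncomputable def flowEq (f : C(E, E)) (p : (ℝ × E) × C(I, E)) : C(I, E) :=
  p.2 - constPathCLM p.1.2 - p.1.1 • primitiveCLM (superpos f p.2)

theorem contDiff_flowEq (f : C(E, E)) (hf : ContDiff ℝ ∞ f) : ContDiff ℝ ∞ (flowEq f) := by
  have h1 : ContDiff ℝ ∞ (constPathCLM (E := E)) := ContinuousLinearMap.contDiff _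
  have h2 : ContDiff ℝ ∞ (primitiveCLM (E := E)) := ContinuousLinearMap.contDiff _
  exact (contDiff_snd.sub (h1.comp (contDiff_snd.comp contDiff_fst))).sub
    ((contDiff_fst.comp contDiff_fst).smul (h2.comp ((contDiff_superpos f hf).comp contDiff_snd)))

omit [NormedSpace ℝ E] in
theorem norm_superpos_sub_le (f : C(E, E)) {K : NNReal} (hK : LipschitzWith K f) (u v : C(I, E)) :
    ‖superpos f u - superpos f v‖ ≤ K * ‖u - v‖ := by
  refine (ContinuousMap.norm_le _ (by positivity)).2 fun t => ?_
  refine (hK.norm_sub_le (u t) (v t)).trans ?_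
  exact mul_le_mul_of_nonneg_left ((u - v).norm_coe_le_norm t) K.2

/-- The integral operator is Lipschitz with constant |σ| K < 1, so it has at most one fixed point.
-/
theorem eq_of_flowEq_eq_zero (f : C(E, E)) {K : NNReal} (hK : LipschitzWith K f) {p : ℝ × E}
    (hp : |p.1| * K < 1) {u v : C(I, E)} (hu : flowEq f (p, u) = 0) (hv : flowEq f (p, v) = 0) :
    u = v := by
  have h1 : u - v = p.1 • primitiveCLM (superpos f u - superpos f v) := by
    have : flowEq f (p, u) - flowEq f (p, v) = 0 := by rw [hu, hv, sub_zero]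
    simp only [flowEq] at this
    rw [map_sub, smul_sub, ← sub_eq_zero, ← this]
    abel
  have h2 : ‖u - v‖ ≤ |p.1| * (K * ‖u - v‖) := by
    conv_lhs => rw [h1, norm_smul, Real.norm_eq_abs]
    gcongr
    refine (ContinuousLinearMap.le_of_opNorm_le _ norm_primitiveCLM_le _).trans ?_
    rw [one_mul]
    exact norm_superpos_sub_le f hK u v
  have h3 : ‖u - v‖ = 0 := by
    by_contra h
    have := lt_of_le_of_ne (norm_nonneg (u - v)) (Ne.symm h)
    nlinarith
  exact sub_eq_zero.1 (norm_eq_zero.1 h3)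

/-- The partial derivative in the curve is 1 - A with ‖A‖ ≤ |σ| K < 1, invertible by the Neumann
series. -/
theorem isInvertible_fderiv_flowEq [CompleteSpace E] (f : C(E, E)) (hf : ContDiff ℝ ∞ f)
    {K : NNReal} (hK : LipschitzWith K f) {p : ℝ × E} (hp : |p.1| * K < 1) (u : C(I, E)) :
    (fderiv ℝ (flowEq f) (p, u) ∘L .inr ℝ (ℝ × E) C(I, E)).IsInvertible := by
  let f' : C(E, E →L[ℝ] E) := ⟨fderiv ℝ f, hf.continuous_fderiv (by simp)⟩
  let A : C(I, E) →L[ℝ] C(I, E) := p.1 • primitiveCLM ∘L pointwiseApply (superpos f' u)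
  have hd : ∀ x, HasFDerivAt f (f' x) x := fun x =>
    (hf.differentiable (by simp) x).hasFDerivAt
  have h1 : HasFDerivAt (fun v => flowEq f (p, v)) (1 - A) u := by
    have h2 := (primitiveCLM (E := E)).hasFDerivAt.comp u (hasFDerivAt_superpos f f' hd u)
    exact ((hasFDerivAt_id u).sub_const (constPathCLM p.2)).sub (h2.const_smul p.1)
  have h2 : HasFDerivAt (fun v => flowEq f (p, v))
      (fderiv ℝ (flowEq f) (p, u) ∘L .inr ℝ (ℝ × E) C(I, E)) u :=
    ((contDiff_flowEq f hf).differentiable (by simp) (p, u)).hasFDerivAt.comp u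
      (hasFDerivAt_prodMk_right p u)
  rw [h2.unique h1]
  have hA : ‖A‖ < 1 := by
    have h3 : ‖pointwiseApply (superpos (K := I) f' u)‖ ≤ K := by
      refine ContinuousLinearMap.opNorm_le_bound _ K.2 fun v => ?_
      refine (ContinuousMap.norm_le _ (by positivity)).2 fun t => ?_
      exact ContinuousLinearMap.le_of_opNorm_le_of_le _ (norm_fderiv_le_of_lipschitz ℝ hK)
        (v.norm_coe_le_norm t)
    calc ‖A‖ ≤ |p.1| * (1 * K) := by
          refine (ContinuousLinearMap.opNorm_smul_le _ _).trans ?_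
          rw [Real.norm_eq_abs]
          gcongr
          exact (ContinuousLinearMap.opNorm_comp_le _ _).trans
            (mul_le_mul norm_primitiveCLM_le h3 (norm_nonneg _) zero_le_one)
      _ < 1 := by rwa [one_mul]
  obtain ⟨w, hw⟩ := isUnit_one_sub_of_norm_lt_one (R := C(I, E) →L[ℝ] C(I, E)) hA
  exact ⟨ContinuousLinearEquiv.ofUnit w, by rw [← hw]; rfl⟩

/-- The implicit function theorem in C([0, 1], E) gives joint smoothness for short times, and the
group law carries it to all times. -/
theorem exists_contDiff_flow [CompleteSpace E] {f : E → E} (hf : ContDiff ℝ ∞ f)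
    (hc : HasCompactSupport f) :
    ∃ Φ : ℝ → E → E, (∀ y, Φ 0 y = y) ∧ (∀ s y, HasDerivAt (fun s => Φ s y) (f (Φ s y)) s) ∧
      ContDiff ℝ ∞ (uncurry Φ) := by
  obtain ⟨K, hK⟩ := hf.lipschitzWith_of_hasCompactSupport hc (by simp)
  obtain ⟨L, hL⟩ := hc.exists_bound_of_continuous hf.continuous
  have hL0 : 0 ≤ L := (norm_nonneg _).trans (hL 0)
  choose α hα0 hα using exists_hasDerivAt_of_lipschitz_of_bounded (L := ⟨L, hL0⟩) hK hL
  have huniq : ∀ {β γ : ℝ → E}, (∀ s, HasDerivAt β (f (β s)) s) → (∀ s, HasDerivAt γ (f (γ s)) s) →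
      β 0 = γ 0 → β = γ := fun hβ hγ h => ODE_solution_unique_univ (v := fun _ => f)
        (s := fun _ => univ) (K := K) (t₀ := 0) (fun _ => hK.lipschitzOnWith)
        (fun t => ⟨hβ t, trivial⟩) (fun t => ⟨hγ t, trivial⟩) h
  have hadd : ∀ s t y, α y (s + t) = α (α y t) s := by
    intro s t y
    refine congrFun (huniq (β := fun s => α y (s + t)) (γ := α (α y t)) (fun s => ?_)
      (fun s => hα _ s) (by simp [hα0])) s
    exact (hα y (s + t)).comp_add_const s t
  have hcont : ∀ y, Continuous (α y) := fun y =>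
    continuous_iff_continuousAt.2 fun s => (hα y s).continuousAt
  let fc : C(E, E) := ⟨f, hf.continuous⟩
  let U : ℝ × E → C(I, E) := fun p =>
    ⟨fun t => α p.2 (p.1 * t), (hcont p.2).comp (by fun_prop)⟩
  have hU : ∀ p, flowEq fc (p, U p) = 0 := by
    intro p
    ext t
    have h1 : ∫ s in (0 : ℝ)..t, p.1 • iccExt (superpos fc (U p)) s = α p.2 (p.1 * t) - α p.2 0 := by
      have h2 : ∀ s ∈ uIcc (0 : ℝ) t,
          HasDerivAt (fun s => α p.2 (p.1 * s)) (p.1 • iccExt (superpos fc (U p)) s) s := by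
        intro s hs
        rw [uIcc_of_le t.2.1] at hs
        have hs' : s ∈ Icc (0 : ℝ) 1 := ⟨hs.1, hs.2.trans t.2.2⟩
        have h3 : iccExt (superpos fc (U p)) s = f (α p.2 (p.1 * s)) := by
          simp only [iccExt, projIcc_of_mem zero_le_one hs']
          rfl
        rw [h3]
        have h4 := (hα p.2 (p.1 * s)).scomp s ((hasDerivAt_id s).const_mul p.1)
        simpa [comp_def] using h4
      rw [intervalIntegral.integral_eq_sub_of_hasDerivAt h2]
      · simp
      · exact ((continuous_iccExt _).const_smul p.1).intervalIntegrable _ _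
    rw [intervalIntegral.integral_smul] at h1
    have h5 : flowEq fc (p, U p) t
        = α p.2 (p.1 * t) - p.2 - p.1 • ∫ s in (0 : ℝ)..t, iccExt (superpos fc (U p)) s := rfl
    rw [h5, h1, hα0]
    simp
  have hshort : ∀ p : ℝ × E, |p.1| * K < 1 → ContDiffAt ℝ ∞ (fun p : ℝ × E => α p.2 p.1) p := by
    intro p hp
    have cd := (contDiff_flowEq fc hf).contDiffAt (x := (p, U p))
    have inv := isInvertible_fderiv_flowEq fc hf hK hp (U p)
    -- The implicit function produces some zero of `flowEq`; uniqueness of zeros for short times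
    -- identifies it with the orbit, which is then evaluated at its endpoint.
    have h1 : (fun q => (cd.implicitFunction (by simp) inv q) ⟨1, by simp⟩)
        =ᶠ[𝓝 p] fun p : ℝ × E => α p.2 p.1 := by
      have h2 : ∀ᶠ q : ℝ × E in 𝓝 p, |q.1| * K < 1 := by
        have : Continuous fun q : ℝ × E => |q.1| * K := by fun_prop
        exact this.continuousAt.eventually (gt_mem_nhds hp)
      filter_upwards [h2, cd.eventually_apply_implicitFunction (by simp) inv] with q hq hq'
      rw [hU p] at hq'
      rw [eq_of_flowEq_eq_zero fc hK hq hq' (hU q)]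
      simp [U]
    refine ContDiffAt.congr_of_eventuallyEq ?_ h1.symm
    exact (ContinuousMap.evalCLM ℝ (⟨1, by simp⟩ : I)).contDiff.contDiffAt.comp p
      (cd.contDiffAt_implicitFunction (by simp) inv)
  -- The flow at time k s is the k-fold composite of the flow at time s, so only s has to be short.
  have hiter : ∀ (k : ℕ) (p : ℝ × E), |p.1| * K < 1 →
      ContDiffAt ℝ ∞ (fun p : ℝ × E => α p.2 (k * p.1)) p := by
    intro k
    induction k with
    | zero => 
      intro p _
      simpa [hα0] using contDiffAt_snd
    | succ k ih =>
      intro p hp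
      have h1 := (hshort (p.1, α p.2 (k * p.1)) hp).comp p (contDiffAt_fst.prodMk (ih p hp))
      refine h1.congr_of_eventuallyEq (Filter.Eventually.of_forall fun q => ?_)
      simp only [comp_apply, ← hadd]
      congr 1
      push_cast
      ring
  refine ⟨fun s y => α y s, hα0, fun s y => hα y s, contDiff_iff_contDiffAt.2 fun p => ?_⟩
  obtain ⟨N, hN⟩ := exists_nat_gt (|p.1| * K)
  have hN0 : (0 : ℝ) < N := lt_of_le_of_lt (by positivity) hN
  have h1 := (hiter N (p.1 / N, p.2) (by
    rw [abs_div, abs_of_pos hN0, div_mul_eq_mul_div, div_lt_one hN0]; exact hN)).comp p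
    (f := fun q : ℝ × E => (q.1 / N, q.2)) (by fun_prop)
  refine h1.congr_of_eventuallyEq (Filter.Eventually.of_forall fun q => ?_)
  simp only [comp_apply, uncurry]
  rw [mul_div_cancel₀ _ hN0.ne']

end Flow

/-! ### Hadamard's lemma. -/

section Hadamard

open unitInterval

universe u

variable {E F : Type u} [NormedAddCommGroup E] [NormedSpace ℝ E] [NormedAddCommGroup F]
  [NormedSpace ℝ F] [CompleteSpace F]

/-- The rays `s ↦ s • y`, `s ∈ [0, 1]`, as a bounded operator. -/
noncomputable def rayCLM : E →L[ℝ] C(I, E) :=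
  LinearMap.mkContinuous
    { toFun := fun y => ⟨fun s => (s : ℝ) • y, by fun_prop⟩
      map_add' := fun _ _ => by ext; simp
      map_smul' := fun _ _ => by ext; exact smul_comm _ _ _ } 1
    (fun y => by
      refine (ContinuousMap.norm_le _ (by positivity)).2 fun s => ?_
      rw [one_mul]
      change ‖(s : ℝ) • y‖ ≤ ‖y‖
      rw [norm_smul, Real.norm_of_nonneg s.2.1]
      exact mul_le_of_le_one_left (norm_nonneg _) s.2.2)

omit [CompleteSpace F] in
theorem contDiff_primitiveCLM_one : ContDiff ℝ ∞ (fun u : C(I, F) => primitiveCLM u 1) := by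
  have h0 : ContDiff ℝ ∞ (primitiveCLM (E := F)) := ContinuousLinearMap.contDiff _
  exact (ContinuousMap.evalCLM ℝ (1 : I)).contDiff.comp h0

/-- Take A(y) = ∫₀¹ Dv(s y) ds. It is smooth as the composite of the linear map sending y to its
ray, a superposition operator, and integration. -/
theorem exists_contDiff_eq_add_apply {v : E → F} (hv : ContDiff ℝ ∞ v) :
    ∃ A : E → E →L[ℝ] F, ContDiff ℝ ∞ A ∧ A 0 = fderiv ℝ v 0 ∧ ∀ y, v y = v 0 + A y y := by
  have hv' : ContDiff ℝ ∞ (fderiv ℝ v) := hv.fderiv_right (by simp)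
  let f' : C(E, E →L[ℝ] F) := ⟨fderiv ℝ v, hv'.continuous⟩
  let T : C(I, E →L[ℝ] F) → E →L[ℝ] F := fun u => primitiveCLM u 1
  have hT : ∀ y, T (superpos f' (rayCLM y)) = ∫ s in (0 : ℝ)..1, fderiv ℝ v (s • y) := by
    intro y
    refine intervalIntegral.integral_congr fun s hs => ?_
    rw [Set.uIcc_of_le (by simp)] at hs
    have hs' : s ∈ Set.Icc (0 : ℝ) 1 := hs
    simp only [iccExt, Set.projIcc_of_mem zero_le_one hs']
    rfl
  refine ⟨fun y => T (superpos f' (rayCLM y)), ?_, ?_, fun y => ?_⟩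
  · have h1 : ContDiff ℝ ∞ T := contDiff_primitiveCLM_one
    have h2 : ContDiff ℝ ∞ (rayCLM (E := E)) := ContinuousLinearMap.contDiff _
    exact h1.comp ((contDiff_superpos f' hv').comp h2)
  · simpa using hT 0
  · have hc : Continuous fun s : ℝ => fderiv ℝ v (s • y) := hv'.continuous.comp (by fun_prop)
    have h1 : ∀ s ∈ Set.uIcc (0 : ℝ) 1,
        HasDerivAt (fun s : ℝ => v (s • y)) (fderiv ℝ v (s • y) y) s := by
      intro s _
      have h2 := (hv.differentiable (by simp) (s • y)).hasFDerivAt.comp_hasDerivAt s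
        ((hasDerivAt_id s).smul_const y)
      simpa [Function.comp_def] using h2
    have h3 := intervalIntegral.integral_eq_sub_of_hasDerivAt h1
      ((hc.clm_apply continuous_const).intervalIntegrable _ _)
    beta_reduce
    rw [hT, ContinuousLinearMap.intervalIntegral_apply (hc.intervalIntegrable _ _), h3]
    simp

end Hadamard

/-! ### Pairs of horizontal indices. -/

section Indices

variable {n : ℕ}

theorem oddIdx_injective : Function.Injective (oddIdx (n := n)) := by
  intro i j h
  simp only [oddIdx, Fin.mk.injEq] at h
  omega

theorem evenIdx_injective : Function.Injective (evenIdx (n := n)) := by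
  intro i j h
  simp only [evenIdx, Fin.mk.injEq] at h
  omega

@[simp] theorem oddIdx_inj {i j : Fin n} : oddIdx i = oddIdx j ↔ i = j := oddIdx_injective.eq_iff

@[simp] theorem evenIdx_inj {i j : Fin n} : evenIdx i = evenIdx j ↔ i = j :=
  evenIdx_injective.eq_iff

@[simp] theorem oddIdx_ne_evenIdx (i j : Fin n) : oddIdx i ≠ evenIdx j := by
  simp only [oddIdx, evenIdx, ne_eq, Fin.mk.injEq]
  omega

@[simp] theorem evenIdx_ne_oddIdx (i j : Fin n) : evenIdx i ≠ oddIdx j :=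
  (oddIdx_ne_evenIdx j i).symm

theorem idx_cases {p : Fin (2 * n) → Prop} (h1 : ∀ i, p (oddIdx i)) (h2 : ∀ i, p (evenIdx i))
    (k : Fin (2 * n)) : p k := by
  have hk := k.2
  rcases Nat.mod_two_eq_zero_or_one k.val with h | h
  · convert h1 ⟨k.val / 2, by omega⟩ using 1
    ext; simp only [oddIdx]; omega
  · convert h2 ⟨k.val / 2, by omega⟩ using 1
    ext; simp only [evenIdx]; omega

theorem sum_pairs {A : Type*} [AddCommMonoid A] (f : Fin (2 * n) → A) :
    ∑ k, f k = ∑ i, (f (oddIdx i) + f (evenIdx i)) := by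
  have hb : Function.Bijective (Sum.elim (oddIdx (n := n)) evenIdx) := by
    constructor
    · rintro (i | i) (j | j) h <;> simp_all
    · exact idx_cases (fun i => ⟨Sum.inl i, rfl⟩) fun i => ⟨Sum.inr i, rfl⟩
  rw [← (Equiv.ofBijective _ hb).sum_comp, Fintype.sum_sum_type, Finset.sum_add_distrib]
  rfl

end Indices

/-! ### Coordinates, dilations and the nilpotent vertical components. -/

section Coordinates

variable {n : ℕ}

/-- The coordinate `k` of the horizontal part. -/
noncomputable abbrev xc (k : Fin (2 * n)) : Model n →L[ℝ] ℝ := EuclideanSpace.proj k.castSucc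

/-- The vertical coordinate. -/
noncomputable abbrev zc : Model n →L[ℝ] ℝ := EuclideanSpace.proj (Fin.last (2 * n))

/-- The coordinate vector field `∂_{x_k}`. -/
noncomputable def ex (k : Fin (2 * n)) : Model n := EuclideanSpace.single k.castSucc 1

/-- The coordinate vector field `∂_z`. -/
noncomputable def ez : Model n := EuclideanSpace.single (Fin.last (2 * n)) 1

@[simp] theorem xc_ex (j k : Fin (2 * n)) : xc j (ex k) = if j = k then 1 else 0 := by
  simp [ex]

@[simp] theorem xc_ez (j : Fin (2 * n)) : xc j (ez (n := n)) = 0 := by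
  simp [ez, Fin.castSucc_ne_last]

@[simp] theorem zc_ex (k : Fin (2 * n)) : zc (ex k) = 0 := by
  simp [ex, (Fin.castSucc_ne_last k).symm]

@[simp] theorem zc_ez : zc (ez (n := n)) = 1 := by
  simp [ez]

theorem model_ext {u v : Model n} (h1 : ∀ k, xc k u = xc k v) (h2 : zc u = zc v) : u = v := by
  ext k
  refine Fin.lastCases h2 (fun k => h1 k) k

theorem model_eq_sum (v : Model n) : v = ∑ k, xc k v • ex k + zc v • ez := by
  refine model_ext (fun j => ?_) ?_
  · simp only [map_add, map_sum, map_smul, xc_ex, xc_ez, smul_eq_mul]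
    simp
  · simp only [map_add, map_sum, map_smul, zc_ex, zc_ez, smul_eq_mul]
    simp

/-- The map `(x, z) ↦ (x, μ z)`. -/
noncomputable def zScale (μ : ℝ) : Model n →L[ℝ] Model n :=
  .id ℝ _ + (μ - 1) • zc.smulRight ez

/-- The dilation `(x, z) ↦ (μ x, μ² z)`. -/
noncomputable def dil (μ : ℝ) : Model n →L[ℝ] Model n := μ • zScale μ

@[simp] theorem xc_zScale (μ : ℝ) (k : Fin (2 * n)) (v : Model n) : xc k (zScale μ v) = xc k v := by
  simp only [zScale, add_apply, ContinuousLinearMap.coe_id', id_eq,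
    smul_apply, ContinuousLinearMap.smulRight_apply, map_add, map_smul, xc_ez, smul_zero,
    add_zero]

@[simp] theorem zc_zScale (μ : ℝ) (v : Model n) : zc (zScale μ v) = μ * zc v := by
  simp only [zScale, add_apply, ContinuousLinearMap.coe_id', id_eq,
    smul_apply, ContinuousLinearMap.smulRight_apply, map_add, map_smul, zc_ez, smul_eq_mul]
  ring

@[simp] theorem xc_dil (μ : ℝ) (k : Fin (2 * n)) (v : Model n) : xc k (dil μ v) = μ * xc k v := by
  rw [dil, smul_apply, map_smul, xc_zScale, smul_eq_mul]

@[simp] theorem zc_dil (μ : ℝ) (v : Model n) : zc (dil μ v) = μ ^ 2 * zc v := by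
  rw [dil, smul_apply, map_smul, zc_zScale, smul_eq_mul]
  ring

theorem dil_apply (μ : ℝ) (v : Model n) : dil μ v = μ • zScale μ v := rfl

theorem dil_dil (μ ν : ℝ) (v : Model n) : dil μ (dil ν v) = dil (μ * ν) v := by
  refine model_ext (fun k => ?_) ?_
  · rw [xc_dil, xc_dil, xc_dil]; ring
  · rw [zc_dil, zc_dil, zc_dil]; ring

theorem dil_one (v : Model n) : dil 1 v = v := by
  refine model_ext (fun k => ?_) ?_
  · rw [xc_dil]; ring
  · rw [zc_dil]; ring

theorem contDiff_zScale : ContDiff ℝ ∞ (zScale (n := n)) := by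
  unfold zScale
  fun_prop

theorem contDiff_dil : ContDiff ℝ ∞ (dil (n := n)) := contDiff_id.smul contDiff_zScale

/-- The vertical components of the nilpotent frame with invariants `b`. -/
noncomputable def ell (b : Fin n → ℝ) (k : Fin (2 * n)) : Model n →L[ℝ] ℝ :=
  if k.val % 2 = 0 then (b ⟨k / 2, by omega⟩ / 2) • xc (evenIdx ⟨k / 2, by omega⟩)
  else -(b ⟨k / 2, by omega⟩ / 2) • xc (oddIdx ⟨k / 2, by omega⟩)

theorem ell_oddIdx (b : Fin n → ℝ) (i : Fin n) :
    ell b (oddIdx i) = (b i / 2) • xc (evenIdx i) := by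
  have h : (2 * i.val) / 2 = i.val := by omega
  simp [ell, oddIdx, h]

theorem ell_evenIdx (b : Fin n → ℝ) (i : Fin n) :
    ell b (evenIdx i) = -(b i / 2) • xc (oddIdx i) := by
  have h : (2 * i.val + 1) / 2 = i.val := by omega
  have h' : (2 * i.val + 1) % 2 = 1 := by omega
  simp [ell, evenIdx, h, h']

theorem ell_ez (b : Fin n → ℝ) (k : Fin (2 * n)) : ell b k ez = 0 := by
  revert k
  refine idx_cases (fun i => ?_) fun i => ?_
  · rw [ell_oddIdx, smul_apply, xc_ez, smul_zero]
  · rw [ell_evenIdx, smul_apply, xc_ez, smul_zero]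

theorem ell_zScale (b : Fin n → ℝ) (k : Fin (2 * n)) (μ : ℝ) (v : Model n) :
    ell b k (zScale μ v) = ell b k v := by
  revert k
  refine idx_cases (fun i => ?_) fun i => ?_
  · rw [ell_oddIdx, smul_apply, smul_apply, xc_zScale]
  · rw [ell_evenIdx, smul_apply, smul_apply, xc_zScale]

end Coordinates

/-! ### Frames seen through dilations. -/

/-- A smooth family of frames `∂_{x_i} + ℓ_i ∂_z + μ W_i(μ, ·)` depending on a parameter `μ`, a
perturbation of the nilpotent frame with invariants `b`, whose first-order term is vertical and
quadratic in the horizontal coordinates. -/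
structure RescaledFrame (n : ℕ) where
  /-- the nilpotent invariants -/
  b : Fin n → ℝ
  b_pos : ∀ i, 0 < b i
  /-- the perturbation -/
  W : Fin (2 * n) → ℝ × Model n → Model n
  smooth : ∀ i, ContDiff ℝ ∞ (W i)
  /-- the first-order perturbation of the vertical components -/
  q : Fin (2 * n) → Model n →L[ℝ] Model n →L[ℝ] ℝ
  W_zero : ∀ i Y, W i (0, Y) = q i (zScale 0 Y) (zScale 0 Y) • ez

namespace RescaledFrame

variable {n : ℕ} (Fr : RescaledFrame n)

/-- The vector fields of the frame. -/
noncomputable def field (i : Fin (2 * n)) (p : ℝ × Model n) : Model n :=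
  ex i + ell Fr.b i p.2 • ez + p.1 • Fr.W i p

theorem contDiff_field (i : Fin (2 * n)) : ContDiff ℝ ∞ (Fr.field i) := by
  have := Fr.smooth i
  unfold field
  fun_prop

/-- The derivative of the vector fields of the frame with respect to the point. -/
noncomputable def dfield (i : Fin (2 * n)) (p : ℝ × Model n) : Model n →L[ℝ] Model n :=
  fderiv ℝ (Fr.field i) p ∘L .inr ℝ ℝ (Model n)

theorem contDiff_dfield (i : Fin (2 * n)) : ContDiff ℝ ∞ (Fr.dfield i) :=
  ((Fr.contDiff_field i).fderiv_right (m := ∞) (by simp)).clm_comp contDiff_const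

theorem hasFDerivAt_field (i : Fin (2 * n)) (μ : ℝ) (Y : Model n) :
    HasFDerivAt (fun Y => Fr.field i (μ, Y)) (Fr.dfield i (μ, Y)) Y :=
  ((Fr.contDiff_field i).differentiable (by simp) (μ, Y)).hasFDerivAt.comp Y
    (hasFDerivAt_prodMk_right μ Y)

/-- The derivative of the perturbation with respect to the point. -/
noncomputable def dW (i : Fin (2 * n)) (p : ℝ × Model n) : Model n →L[ℝ] Model n :=
  fderiv ℝ (Fr.W i) p ∘L .inr ℝ ℝ (Model n)

theorem contDiff_dW (i : Fin (2 * n)) : ContDiff ℝ ∞ (Fr.dW i) :=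
  ((Fr.smooth i).fderiv_right (m := ∞) (by simp)).clm_comp contDiff_const

theorem hasFDerivAt_W (i : Fin (2 * n)) (μ : ℝ) (Y : Model n) :
    HasFDerivAt (fun Y => Fr.W i (μ, Y)) (Fr.dW i (μ, Y)) Y :=
  ((Fr.smooth i).differentiable (by simp) (μ, Y)).hasFDerivAt.comp Y
    (hasFDerivAt_prodMk_right μ Y)

theorem dfield_apply (i : Fin (2 * n)) (p : ℝ × Model n) (v : Model n) :
    Fr.dfield i p v = ell Fr.b i v • ez + p.1 • Fr.dW i p v := by
  have h1 : HasFDerivAt (fun Y => Fr.field i (p.1, Y))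
      ((ell Fr.b i).smulRight ez + p.1 • Fr.dW i p) p.2 := by
    have h2 := (((ell Fr.b i).hasFDerivAt (x := p.2)).smul_const (ez (n := n))).const_add (ex i)
    exact h2.add ((Fr.hasFDerivAt_W i p.1 p.2).const_smul p.1)
  rw [(Fr.hasFDerivAt_field i p.1 p.2).unique h1]
  rfl

/-- The cotangent phase space in coordinates. -/
abbrev Phase (n : ℕ) : Type := Model n × (Model n →L[ℝ] ℝ)

/-- The Hamiltonian vector field of `½ ∑ P(X_i)²`. -/
noncomputable def hamField (p : ℝ × Phase n) : Phase n :=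
  (∑ i, p.2.2 (Fr.field i (p.1, p.2.1)) • Fr.field i (p.1, p.2.1),
    -∑ i, p.2.2 (Fr.field i (p.1, p.2.1)) • (p.2.2 ∘L Fr.dfield i (p.1, p.2.1)))

theorem contDiff_hamField : ContDiff ℝ ∞ Fr.hamField := by
  have h1 := Fr.contDiff_field
  have h2 := Fr.contDiff_dfield
  have h3 : ∀ i, ContDiff ℝ ∞ fun p : ℝ × Phase n => Fr.field i (p.1, p.2.1) := fun i =>
    (h1 i).comp (by fun_prop)
  have h4 : ∀ i, ContDiff ℝ ∞ fun p : ℝ × Phase n => Fr.dfield i (p.1, p.2.1) := fun i =>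
    (h2 i).comp (by fun_prop)
  have h5 : ContDiff ℝ ∞ fun p : ℝ × Phase n => p.2.2 := by fun_prop
  have h6 : ∀ i, ContDiff ℝ ∞ fun p : ℝ × Phase n => p.2.2 (Fr.field i (p.1, p.2.1)) := fun i =>
    h5.clm_apply (h3 i)
  refine ContDiff.prodMk ?_ ?_
  · exact ContDiff.sum fun i _ => (h6 i).smul (h3 i)
  · exact (ContDiff.sum fun i _ => (h6 i).smul (h5.clm_comp (h4 i))).neg

end RescaledFrame

/-- Pulling `μ • X i` back through `dil μ` keeps horizontal components and divides vertical ones by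
μ. Hadamard's lemma, applied to `X i` and then to the vertical part of the quotient, extracts enough
factors of μ for the family to extend smoothly across μ = 0. The hypothesis `hh` removes the
horizontal part of `W` at μ = 0, leaving only a vertical quadratic term. -/
theorem exists_rescaledFrame {n : ℕ} (b : Fin n → ℝ) (hb : ∀ i, 0 < b i)
    (X : Fin (2 * n) → Model n → Model n) (hX : ∀ i, ContDiff ℝ ∞ (X i))
    (h0 : ∀ i, X i 0 = ex i) (hz : ∀ i v, zc (fderiv ℝ (X i) 0 v) = ell b i v)
    (hh : ∀ i j v, xc j (fderiv ℝ (X i) 0 (zScale 0 v)) = 0) :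
    ∃ Fr : RescaledFrame n, Fr.b = b ∧
      ∀ i μ Y, dil μ (Fr.field i (μ, Y)) = μ • X i (dil μ Y) := by
  choose A hA hA0 hXA using fun i => exists_contDiff_eq_add_apply (hX i)
  have hzA : ∀ i, ContDiff ℝ ∞ fun y => zc ∘L A i y := fun i => contDiff_const.clm_comp (hA i)
  choose B hB _ hAB using fun i => exists_contDiff_eq_add_apply (hzA i)
  have hd : ContDiff ℝ ∞ fun p : ℝ × Model n => dil p.1 p.2 :=
    (contDiff_dil.comp contDiff_fst).clm_apply contDiff_snd
  have hs : ContDiff ℝ ∞ fun p : ℝ × Model n => zScale p.1 p.2 :=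
    (contDiff_zScale.comp contDiff_fst).clm_apply contDiff_snd
  have hd0 : ∀ Y : Model n, dil 0 Y = 0 := fun Y => by rw [dil_apply, zero_smul]
  refine ⟨⟨b, hb, fun i p => zScale 0 (A i (dil p.1 p.2) (zScale p.1 p.2)) +
    (B i (dil p.1 p.2) (zScale p.1 p.2) (zScale p.1 p.2)) • ez, fun i => ?_,
    fun i => B i 0, fun i Y => ?_⟩, rfl, fun i μ Y => ?_⟩
  · have h1 := ((hA i).comp hd).clm_apply hs
    have h2 := (((hB i).comp hd).clm_apply hs).clm_apply hs
    exact ((zScale 0).contDiff.comp h1).add (h2.smul contDiff_const)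
  · have : zScale 0 (A i 0 (zScale 0 Y)) = 0 := by
      refine model_ext (fun j => ?_) ?_
      · rw [xc_zScale, hA0, hh, map_zero]
      · rw [zc_zScale, zero_mul, map_zero]
    simp only [hd0, this, zero_add]
  · have hAB' : ∀ y v, zc (A i y v) = ell b i v + B i y y v := by
      intro y v
      have := DFunLike.congr_fun (hAB i y) v
      simp only [ContinuousLinearMap.comp_apply, add_apply] at this
      rw [this, hA0, hz]
    rw [hXA i (dil μ Y), h0]
    refine model_ext (fun j => ?_) ?_
    · rw [xc_dil]
      simp only [RescaledFrame.field, map_add, map_smul, smul_eq_mul, xc_ez, xc_zScale,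
        dil_apply μ Y]
      ring
    · rw [zc_dil]
      simp only [RescaledFrame.field, map_add, map_smul, smul_eq_mul, zc_ez, zc_zScale, zc_ex, hAB']
      simp only [dil_apply μ Y, map_smul, smul_apply, smul_eq_mul, ell_zScale]
      ring

/-! ### Primitives of trigonometric functions, including frequency zero. -/

section TrigIntegrals

open Real

/-- The primitive `∫₀ˢ cos (θ r) dr`. -/
noncomputable def cosInt (θ s : ℝ) : ℝ := ∫ r in (0 : ℝ)..s, cos (θ * r)

/-- The primitive `∫₀ˢ sin (θ r) dr`. -/
noncomputable def sinInt (θ s : ℝ) : ℝ := ∫ r in (0 : ℝ)..s, sin (θ * r)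

/-- Half of the second primitive of `sin (θ s)`. -/
noncomputable def areaInt (θ s : ℝ) : ℝ := 1 / 2 * ∫ r in (0 : ℝ)..s, sinInt θ r

theorem continuous_cosInt : Continuous fun p : ℝ × ℝ => cosInt p.1 p.2 :=
  intervalIntegral.continuous_parametric_intervalIntegral_of_continuous
    (f := fun (p : ℝ × ℝ) r => cos (p.1 * r)) (by fun_prop) continuous_snd

theorem continuous_sinInt : Continuous fun p : ℝ × ℝ => sinInt p.1 p.2 :=
  intervalIntegral.continuous_parametric_intervalIntegral_of_continuous
    (f := fun (p : ℝ × ℝ) r => sin (p.1 * r)) (by fun_prop) continuous_snd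

theorem continuous_areaInt : Continuous fun p : ℝ × ℝ => areaInt p.1 p.2 :=
  continuous_const.mul (intervalIntegral.continuous_parametric_intervalIntegral_of_continuous
    (f := fun (p : ℝ × ℝ) r => sinInt p.1 r)
    (continuous_sinInt.comp (by fun_prop : Continuous fun q : (ℝ × ℝ) × ℝ => (q.1.1, q.2)))
    continuous_snd)

theorem hasDerivAt_cosInt (θ s : ℝ) : HasDerivAt (cosInt θ) (cos (θ * s)) s :=
  (Continuous.integral_hasStrictDerivAt (f := fun r => cos (θ * r)) (by fun_prop) 0 s).hasDerivAt

theorem hasDerivAt_sinInt (θ s : ℝ) : HasDerivAt (sinInt θ) (sin (θ * s)) s :=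
  (Continuous.integral_hasStrictDerivAt (f := fun r => sin (θ * r)) (by fun_prop) 0 s).hasDerivAt

theorem hasDerivAt_areaInt (θ s : ℝ) : HasDerivAt (areaInt θ) (1 / 2 * sinInt θ s) s := by
  have hc : Continuous (sinInt θ) :=
    continuous_iff_continuousAt.2 fun r => (hasDerivAt_sinInt θ r).continuousAt
  have h := (hc.integral_hasStrictDerivAt 0 s).hasDerivAt
  exact h.const_mul (1 / 2)

/-- The factor θ is kept on the left so that the identity also holds at θ = 0, where the quotient
degenerates; `mul_sinInt` and `mul_areaInt` have the same form. -/
theorem mul_cosInt (θ s : ℝ) : θ * cosInt θ s = sin (θ * s) := by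
  rw [cosInt, intervalIntegral.mul_integral_comp_mul_left, integral_cos]
  simp

theorem mul_sinInt (θ s : ℝ) : θ * sinInt θ s = 1 - cos (θ * s) := by
  rw [sinInt, intervalIntegral.mul_integral_comp_mul_left, integral_sin]
  simp

theorem sinInt_zero (s : ℝ) : sinInt 0 s = 0 := by simp [sinInt]

theorem cosInt_zero (s : ℝ) : cosInt 0 s = s := by simp [cosInt]

theorem mul_areaInt (θ s : ℝ) : 2 * θ ^ 2 * areaInt θ s = θ * s - sin (θ * s) := by
  have h : θ * (2 * areaInt θ s) = ∫ r in (0 : ℝ)..s, (1 - cos (θ * r)) := by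
    rw [areaInt, ← mul_assoc 2, show (2 : ℝ) * (1 / 2) = 1 by norm_num, one_mul,
      ← intervalIntegral.integral_const_mul]
    exact intervalIntegral.integral_congr fun r _ => mul_sinInt θ r
  rw [intervalIntegral.integral_sub (by simp) (Continuous.intervalIntegrable (by fun_prop) _ _)] at h
  have h2 := mul_cosInt θ s
  rw [cosInt] at h2
  simp only [intervalIntegral.integral_const, sub_zero, smul_eq_mul, mul_one] at h
  calc _ = θ * (θ * (2 * areaInt θ s)) := by ring
    _ = _ := by rw [h, mul_sub, h2]

theorem areaInt_zero (s : ℝ) : areaInt 0 s = 0 := by simp [areaInt, sinInt_zero]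

theorem sin_mul_cosInt_sub (θ s : ℝ) :
    sin (θ * s) * cosInt θ s - cos (θ * s) * sinInt θ s = sinInt θ s := by
  rcases eq_or_ne θ 0 with rfl | hθ
  · simp [sinInt_zero]
  · apply mul_left_cancel₀ hθ
    have h1 := mul_cosInt θ s
    have h2 := mul_sinInt θ s
    have h3 := sin_sq_add_cos_sq (θ * s)
    linear_combination sin (θ * s) * h1 - (cos (θ * s) + 1) * h2 + h3

end TrigIntegrals

/-! ### Geodesics of the nilpotent structure. -/

section Nilpotent

open Real

variable {n : ℕ}

/-- The invariant attached to the coordinate of index `k`. -/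
def bIdx (b : Fin n → ℝ) (k : Fin (2 * n)) : ℝ := b ⟨k / 2, by omega⟩

@[simp] theorem bIdx_oddIdx (b : Fin n → ℝ) (i : Fin n) : bIdx b (oddIdx i) = b i := by
  have h : (2 * i.val) / 2 = i.val := by omega
  simp [bIdx, oddIdx, h]

@[simp] theorem bIdx_evenIdx (b : Fin n → ℝ) (i : Fin n) : bIdx b (evenIdx i) = b i := by
  have h : (2 * i.val + 1) / 2 = i.val := by omega
  simp [bIdx, evenIdx, h]

/-- The rotation by a right angle in each pair of coordinates: its `2i-1`-th and `2i`-th components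
are `x_{2i}` and `-x_{2i-1}`. -/
noncomputable def rot (k : Fin (2 * n)) : Model n →L[ℝ] ℝ := ell (fun _ => 2) k

theorem rot_oddIdx (i : Fin n) (v : Model n) : rot (oddIdx i) v = xc (evenIdx i) v := by
  rw [rot, ell_oddIdx, smul_apply]; simp

theorem rot_evenIdx (i : Fin n) (v : Model n) : rot (evenIdx i) v = -xc (oddIdx i) v := by
  rw [rot, ell_evenIdx, smul_apply]; simp

theorem ell_eq (b : Fin n → ℝ) (k : Fin (2 * n)) (v : Model n) :
    ell b k v = bIdx b k / 2 * rot k v := by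
  revert k
  refine idx_cases (fun i => ?_) fun i => ?_
  · rw [ell_oddIdx, bIdx_oddIdx, rot_oddIdx]; rfl
  · rw [ell_evenIdx, bIdx_evenIdx, rot_evenIdx, smul_apply, smul_eq_mul]; ring

theorem rot_ez (k : Fin (2 * n)) : rot k ez = 0 := ell_ez _ k

/-- The horizontal vector with given components. -/
noncomputable def hvec (a : Fin (2 * n) → ℝ) : Model n := ∑ k, a k • ex k

@[simp] theorem xc_hvec (a : Fin (2 * n) → ℝ) (k : Fin (2 * n)) : xc k (hvec a) = a k := by
  rw [hvec, map_sum]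
  simp only [map_smul, xc_ex, smul_eq_mul]
  simp

@[simp] theorem zc_hvec (a : Fin (2 * n) → ℝ) : zc (hvec a) = 0 := by
  rw [hvec, map_sum]
  simp only [map_smul, zc_ex, smul_zero, Finset.sum_const_zero]

theorem sum_ell_mul (b : Fin n → ℝ) (u v : Model n) :
    ∑ k, ell b k u * xc k v = -∑ k, xc k u * ell b k v := by
  rw [sum_pairs, sum_pairs, ← Finset.sum_neg_distrib]
  refine Finset.sum_congr rfl fun i _ => ?_
  simp only [ell_eq, rot_oddIdx, rot_evenIdx, bIdx_oddIdx, bIdx_evenIdx]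
  ring

/-- The velocity components of the nilpotent geodesic with initial covector `c`. -/
noncomputable def nilU (b : Fin n → ℝ) (c : Model n) (s : ℝ) (k : Fin (2 * n)) : ℝ :=
  cos (zc c * bIdx b k * s) * xc k c + sin (zc c * bIdx b k * s) * rot k c

/-- The horizontal components of the nilpotent geodesic with initial covector `c`. -/
noncomputable def nilX (b : Fin n → ℝ) (c : Model n) (s : ℝ) (k : Fin (2 * n)) : ℝ :=
  cosInt (zc c * bIdx b k) s * xc k c + sinInt (zc c * bIdx b k) s * rot k c

/-- The nilpotent geodesic with initial covector `c`. -/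
noncomputable def nilY (b : Fin n → ℝ) (c : Model n) (s : ℝ) : Model n :=
  hvec (nilX b c s) + (∑ k, bIdx b k * areaInt (zc c * bIdx b k) s * xc k c ^ 2) • ez

/-- The covector along the nilpotent geodesic with initial covector `c`. -/
noncomputable def nilP (b : Fin n → ℝ) (c : Model n) (s : ℝ) : Model n →L[ℝ] ℝ :=
  ∑ k, (nilU b c s k - zc c * ell b k (hvec (nilX b c s))) • xc k + zc c • zc

/-- The covector with components `c`. -/
noncomputable def covOf : Model n →L[ℝ] Model n →L[ℝ] ℝ :=
  ∑ k, (xc k).smulRight (xc k) + zc.smulRight zc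

theorem covOf_apply (c v : Model n) : covOf c v = ∑ k, xc k c * xc k v + zc c * zc v := by
  simp [covOf, sum_apply]

theorem rot_hvec_nilX (b : Fin n → ℝ) (c : Model n) (s : ℝ) (k : Fin (2 * n)) :
    rot k (hvec (nilX b c s)) =
      cosInt (zc c * bIdx b k) s * rot k c - sinInt (zc c * bIdx b k) s * xc k c := by
  revert k
  refine idx_cases (fun i => ?_) fun i => ?_
  · rw [rot_oddIdx, xc_hvec, nilX, rot_evenIdx, rot_oddIdx, bIdx_evenIdx, bIdx_oddIdx]; ring
  · rw [rot_evenIdx, xc_hvec, nilX, rot_evenIdx, rot_oddIdx, bIdx_evenIdx, bIdx_oddIdx]; ring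

theorem rot_hvec_nilU (b : Fin n → ℝ) (c : Model n) (s : ℝ) (k : Fin (2 * n)) :
    rot k (hvec (nilU b c s)) =
      cos (zc c * bIdx b k * s) * rot k c - sin (zc c * bIdx b k * s) * xc k c := by
  revert k
  refine idx_cases (fun i => ?_) fun i => ?_
  · rw [rot_oddIdx, xc_hvec, nilU, rot_evenIdx, rot_oddIdx, bIdx_evenIdx, bIdx_oddIdx]; ring
  · rw [rot_evenIdx, xc_hvec, nilU, rot_evenIdx, rot_oddIdx, bIdx_evenIdx, bIdx_oddIdx]; ring

theorem hasDerivAt_nilX (b : Fin n → ℝ) (c : Model n) (s : ℝ) (k : Fin (2 * n)) :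
    HasDerivAt (fun s => nilX b c s k) (nilU b c s k) s :=
  ((hasDerivAt_cosInt _ s).mul_const _).add ((hasDerivAt_sinInt _ s).mul_const _)

theorem hasDerivAt_nilU (b : Fin n → ℝ) (c : Model n) (s : ℝ) (k : Fin (2 * n)) :
    HasDerivAt (fun s => nilU b c s k) (zc c * bIdx b k * rot k (hvec (nilU b c s))) s := by
  rw [rot_hvec_nilU]
  have h1 : HasDerivAt (fun s => zc c * bIdx b k * s) (zc c * bIdx b k) s := by
    simpa using (hasDerivAt_id s).const_mul (zc c * bIdx b k)
  refine ((h1.cos.mul_const (xc k c)).add (h1.sin.mul_const (rot k c))).congr_deriv ?_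
  ring

theorem hasDerivAt_hvec {a : ℝ → Fin (2 * n) → ℝ} {a' : Fin (2 * n) → ℝ} {s : ℝ}
    (h : ∀ k, HasDerivAt (fun s => a s k) (a' k) s) :
    HasDerivAt (fun s => hvec (a s)) (hvec a') s :=
  HasDerivAt.fun_sum fun k _ => (h k).smul_const (ex k)

/-- The vertical velocity is a weighted sum of areal velocities. Within each pair the cross terms
cancel, leaving a multiple of the squared norm of that pair of `c`. -/
theorem sum_nilU_mul_ell (b : Fin n → ℝ) (c : Model n) (s : ℝ) :
    ∑ k, nilU b c s k * ell b k (hvec (nilX b c s)) =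
      ∑ k, bIdx b k * (1 / 2 * sinInt (zc c * bIdx b k) s) * xc k c ^ 2 := by
  simp only [ell_eq, rot_hvec_nilX, nilU]
  rw [sum_pairs, sum_pairs]
  refine Finset.sum_congr rfl fun i _ => ?_
  simp only [rot_oddIdx, rot_evenIdx, bIdx_oddIdx, bIdx_evenIdx]
  have h := sin_mul_cosInt_sub (zc c * b i) s
  linear_combination (b i / 2 * (xc (oddIdx i) c ^ 2 + xc (evenIdx i) c ^ 2)) * h

theorem ell_nilY (b : Fin n → ℝ) (c : Model n) (s : ℝ) (k : Fin (2 * n)) :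
    ell b k (nilY b c s) = ell b k (hvec (nilX b c s)) := by
  rw [nilY, map_add, map_smul, ell_ez, smul_zero, add_zero]

theorem nilP_ez (b : Fin n → ℝ) (c : Model n) (s : ℝ) : nilP b c s ez = zc c := by
  simp only [nilP, add_apply, sum_apply, smul_apply, xc_ez, zc_ez, smul_eq_mul, mul_zero,
    Finset.sum_const_zero, zero_add, mul_one]

theorem nilP_ex (b : Fin n → ℝ) (c : Model n) (s : ℝ) (k : Fin (2 * n)) :
    nilP b c s (ex k) = nilU b c s k - zc c * ell b k (hvec (nilX b c s)) := by
  simp only [nilP, add_apply, sum_apply, smul_apply, xc_ex, zc_ex, smul_eq_mul, mul_zero, add_zero]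
  simp

theorem nilY_zero (b : Fin n → ℝ) (c : Model n) : nilY b c 0 = 0 := by
  have : nilX b c 0 = 0 := by ext k; simp [nilX, cosInt, sinInt]
  rw [nilY, this]
  simp [hvec, areaInt]

theorem nilP_zero (b : Fin n → ℝ) (c : Model n) : nilP b c 0 = covOf c := by
  have h1 : nilX b c 0 = 0 := by ext k; simp [nilX, cosInt, sinInt]
  have h2 : nilU b c 0 = fun k => xc k c := by ext k; simp [nilU]
  ext v
  rw [nilP, h1, h2, covOf_apply]
  simp [hvec, sum_apply]

namespace RescaledFrame

variable (Fr : RescaledFrame n)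

theorem nilP_field (c : Model n) (s : ℝ) (k : Fin (2 * n)) :
    nilP Fr.b c s (Fr.field k (0, nilY Fr.b c s)) = nilU Fr.b c s k := by
  rw [field, zero_smul, add_zero, map_add, map_smul, nilP_ex, nilP_ez, ell_nilY, smul_eq_mul]
  ring

/-- The momenta of the frame along this curve are the `nilU`, so the system decouples: the vertical
momentum is conserved and each pair of velocities rotates at constant speed. -/
theorem hasDerivAt_nil (c : Model n) (s : ℝ) :
    HasDerivAt (fun s => (nilY Fr.b c s, nilP Fr.b c s))
      (Fr.hamField (0, (nilY Fr.b c s, nilP Fr.b c s))) s := by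
  have hX := hasDerivAt_hvec (hasDerivAt_nilX Fr.b c s)
  refine HasDerivAt.prodMk ?_ ?_
  · have h1 : HasDerivAt (fun s => ∑ k, bIdx Fr.b k * areaInt (zc c * bIdx Fr.b k) s * xc k c ^ 2)
        (∑ k, bIdx Fr.b k * (1 / 2 * sinInt (zc c * bIdx Fr.b k) s) * xc k c ^ 2) s :=
      HasDerivAt.fun_sum fun k _ => ((hasDerivAt_areaInt _ s).const_mul _).mul_const _
    refine (hX.add (h1.smul_const ez)).congr_deriv ?_
    simp only [nilP_field]
    rw [← sum_nilU_mul_ell, hvec, Finset.sum_smul, ← Finset.sum_add_distrib]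
    refine Finset.sum_congr rfl fun k _ => ?_
    rw [field, zero_smul, add_zero, smul_add, smul_smul, ell_nilY]
  · have h1 : ∀ k, HasDerivAt
        (fun s => (nilU Fr.b c s k - zc c * ell Fr.b k (hvec (nilX Fr.b c s))) • (xc k : Model n →L[ℝ] ℝ))
        ((zc c * ell Fr.b k (hvec (nilU Fr.b c s))) • (xc k : Model n →L[ℝ] ℝ)) s := by
      intro k
      have h2 := ((ell Fr.b k).hasFDerivAt.comp_hasDerivAt s hX).const_mul (zc c)
      refine (((hasDerivAt_nilU Fr.b c s k).sub h2).smul_const (xc k)).congr_deriv ?_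
      congr 1
      rw [ell_eq]
      ring
    refine ((HasDerivAt.fun_sum fun k _ => h1 k).add_const (zc c • zc)).congr_deriv ?_
    simp only [nilP_field]
    ext v
    simp only [sum_apply, smul_apply, neg_apply, ContinuousLinearMap.comp_apply, dfield_apply,
      zero_smul, add_zero, map_smul, nilP_ez, smul_eq_mul]
    have h3 := sum_ell_mul Fr.b (hvec (nilU Fr.b c s)) v
    simp only [xc_hvec] at h3
    calc _ = zc c * ∑ k, ell Fr.b k (hvec (nilU Fr.b c s)) * xc k v := by
          rw [Finset.mul_sum]; simp only [mul_assoc]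
      _ = _ := by
          rw [h3, mul_neg, Finset.mul_sum]
          congr 1
          refine Finset.sum_congr rfl fun k _ => ?_
          ring

end RescaledFrame

end Nilpotent

section NilpotentContinuity

variable {n : ℕ}

theorem continuous_nilX (b : Fin n → ℝ) (k : Fin (2 * n)) :
    Continuous fun p : ℝ × Model n => nilX b p.2 p.1 k := by
  have h1 : Continuous fun p : ℝ × Model n => (zc p.2 * bIdx b k, p.1) := by fun_prop
  have h2 := continuous_cosInt.comp h1
  have h3 := continuous_sinInt.comp h1
  have h4 : Continuous fun p : ℝ × Model n => xc k p.2 := by fun_prop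
  have h5 : Continuous fun p : ℝ × Model n => rot k p.2 := by fun_prop
  exact (h2.mul h4).add (h3.mul h5)

theorem continuous_hvec : Continuous (hvec (n := n)) := by
  unfold hvec
  fun_prop

theorem continuous_nil (b : Fin n → ℝ) :
    Continuous fun p : ℝ × Model n => (nilY b p.2 p.1, nilP b p.2 p.1) := by
  have h1 : Continuous fun p : ℝ × Model n => hvec (nilX b p.2 p.1) :=
    continuous_hvec.comp (continuous_pi fun k => continuous_nilX b k)
  have h2 : ∀ k, Continuous fun p : ℝ × Model n => areaInt (zc p.2 * bIdx b k) p.1 := fun k => by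
    have h3 : Continuous fun p : ℝ × Model n => (zc p.2 * bIdx b k, p.1) := by fun_prop
    have h4 := continuous_areaInt.comp h3
    exact h4
  unfold nilY nilP nilU
  fun_prop

end NilpotentContinuity

/-! ### Smooth flow of the rescaled Hamiltonian fields. -/

namespace RescaledFrame

open Set Function

variable {n : ℕ} (Fr : RescaledFrame n)

/-- The parameter μ is adjoined to the phase space with zero velocity, and the field is cut off to
give a complete smooth flow. At μ = 0 the orbits are nilpotent geodesics, bounded by r. By
compactness the orbits for small μ stay below r + 1, where the cut-off equals 1, and so they solve
the original equations. -/
theorem exists_smooth_flow (R : ℝ) :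
    ∃ μ₀ > 0, ∃ ρ : ℝ, ∃ Γ : ℝ → Model n × ℝ → Phase n, ContDiff ℝ ∞ (uncurry Γ) ∧
      ∀ c ∈ Metric.closedBall (0 : Model n) R,
        (∀ s ∈ Icc (0 : ℝ) 1, Γ s (c, 0) = (nilY Fr.b c s, nilP Fr.b c s)) ∧
        ∀ μ : ℝ, |μ| < μ₀ → Γ 0 (c, μ) = (0, covOf c) ∧
          ∀ s ∈ Icc (0 : ℝ) 1, ‖Γ s (c, μ)‖ < ρ ∧
            HasDerivAt (fun s => Γ s (c, μ)) (Fr.hamField (μ, Γ s (c, μ))) s := by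
  obtain ⟨R₀, hR₀⟩ := ((isCompact_Icc (a := (0 : ℝ)) (b := 1)).prod
    (isCompact_closedBall (0 : Model n) R)).exists_bound_of_continuousOn
      (continuous_nil Fr.b).continuousOn
  have hnil : ∀ c ∈ Metric.closedBall (0 : Model n) R, ∀ s ∈ Icc (0 : ℝ) 1,
      ‖((0 : ℝ), nilY Fr.b c s, nilP Fr.b c s)‖ ≤ max R₀ 0 := by
    intro c hc s hs
    have := hR₀ (s, c) ⟨hs, hc⟩
    rw [Prod.norm_def, norm_zero]
    exact max_le (le_max_right _ _) (this.trans (le_max_left _ _))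
  set r := max R₀ 0
  have hr : 0 ≤ r := le_max_right _ _
  let χ : ContDiffBump (0 : ℝ × Phase n) := ⟨r + 2, r + 3, by linarith, by linarith⟩
  have hχ : ∀ p : ℝ × Phase n, ‖p‖ ≤ r + 2 → χ p = 1 := fun p hp =>
    χ.one_of_mem_closedBall (by simpa using hp)
  let f : ℝ × Phase n → ℝ × Phase n := fun p => χ p • ((0 : ℝ), Fr.hamField p)
  have hf : ContDiff ℝ ∞ f := χ.contDiff.smul (contDiff_const.prodMk Fr.contDiff_hamField)
  have hfc : HasCompactSupport f := χ.hasCompactSupport.smul_right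
  have hfχ : ∀ p : ℝ × Phase n, ‖p‖ ≤ r + 2 → f p = (0, Fr.hamField p) := fun p hp => by
    simp only [f, hχ p hp, one_smul]
  obtain ⟨Φ, hΦ0, hΦ, hΦs⟩ := exists_contDiff_flow hf hfc
  have hfst : ∀ s p, (Φ s p).1 = p.1 := by
    intro s p
    have h1 : ∀ s, HasDerivAt (fun s => (Φ s p).1) 0 s := fun s => by
      have := (ContinuousLinearMap.fst ℝ ℝ (Phase n)).hasFDerivAt.comp_hasDerivAt s (hΦ s p)
      simpa [f, comp_def] using this
    have h2 := is_const_of_deriv_eq_zero (fun s => (h1 s).differentiableAt)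
      (fun s => (h1 s).deriv) s 0
    simpa [hΦ0] using h2
  have hcov : ContDiff ℝ ∞ fun p : Model n × ℝ => (p.2, ((0 : Model n), covOf p.1)) :=
    contDiff_snd.prodMk (contDiff_const.prodMk (covOf.contDiff.comp contDiff_fst))
  have hΓ : ContDiff ℝ ∞ fun p : ℝ × (Model n × ℝ) => Φ p.1 (p.2.2, (0, covOf p.2.1)) :=
    hΦs.comp (contDiff_fst.prodMk (hcov.comp contDiff_snd))
  have hzero : ∀ c ∈ Metric.closedBall (0 : Model n) R, ∀ s ∈ Icc (0 : ℝ) 1,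
      Φ s (0, (0, covOf c)) = (0, nilY Fr.b c s, nilP Fr.b c s) := by
    intro c hc
    obtain ⟨K, hK⟩ := hf.lipschitzWith_of_hasCompactSupport hfc (by simp)
    have hd : ∀ s ∈ Icc (0 : ℝ) 1, HasDerivAt
        (fun s => ((0 : ℝ), nilY Fr.b c s, nilP Fr.b c s))
        (f (0, nilY Fr.b c s, nilP Fr.b c s)) s := by
      intro s hs
      rw [hfχ _ ((hnil c hc s hs).trans (by linarith))]
      exact (hasDerivAt_const s (0 : ℝ)).prodMk (Fr.hasDerivAt_nil c s)
    refine ODE_solution_unique (v := fun _ => f) (K := K) (fun _ => hK)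
      (fun s _ => (hΦ s _).continuousAt.continuousWithinAt)
      (fun s _ => (hΦ s _).hasDerivWithinAt)
      (fun s hs => (hd s hs).continuousAt.continuousWithinAt)
      (fun s hs => (hd s (Ico_subset_Icc_self hs)).hasDerivWithinAt) ?_
    simp only [hΦ0, nilY_zero, nilP_zero]
  have htube : ∀ᶠ μ : ℝ in 𝓝 0, ∀ p ∈ Icc (0 : ℝ) 1 ×ˢ Metric.closedBall (0 : Model n) R,
      ‖Φ p.1 (μ, (0, covOf p.2))‖ < r + 1 := by
    refine (isCompact_Icc.prod (isCompact_closedBall _ _)).eventually_forall_of_forall_eventually ?_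
    rintro ⟨s, c⟩ ⟨hs, hc⟩
    have hcont : Continuous fun z : ℝ × (ℝ × Model n) => ‖Φ z.2.1 (z.1, (0, covOf z.2.2))‖ :=
      (hΓ.continuous.comp
        (by fun_prop : Continuous fun z : ℝ × (ℝ × Model n) => (z.2.1, (z.2.2, z.1)))).norm
    refine hcont.continuousAt.eventually_lt_const ?_
    simp only [hzero c hc s hs]
    exact (hnil c hc s hs).trans_lt (by linarith)
  obtain ⟨μ₀, hμ₀, htube⟩ := Metric.eventually_nhds_iff.1 htube
  refine ⟨μ₀, hμ₀, r + 1, fun s p => (Φ s (p.2, (0, covOf p.1))).2, contDiff_snd.comp hΓ,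
    fun c hc => ⟨fun s hs => by simp only [hzero c hc s hs], fun μ hμ => ⟨by simp only [hΦ0],
      fun s hs => ?_⟩⟩⟩
  have h1 := htube (by simpa using hμ) (s, c) ⟨hs, hc⟩
  refine ⟨(norm_snd_le _).trans_lt h1, ?_⟩
  have h2 := (ContinuousLinearMap.snd ℝ ℝ (Phase n)).hasFDerivAt.comp_hasDerivAt s
    (hΦ s (μ, (0, covOf c)))
  rw [hfχ _ (h1.le.trans (by linarith))] at h2
  have h3 : Φ s (μ, (0, covOf c)) = (μ, (Φ s (μ, (0, covOf c))).2) :=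
    Prod.ext (hfst _ _) rfl
  simp only [ContinuousLinearMap.coe_snd'] at h2
  rw [h3] at h2
  exact h2

end RescaledFrame

/-! ### Differentiating an equation with respect to a parameter. -/

section MixedPartial

theorem HasDerivAt.fst_comp {A B : Type*} [NormedAddCommGroup A] [NormedSpace ℝ A]
    [NormedAddCommGroup B] [NormedSpace ℝ B] {γ : ℝ → A × B} {γ' : A × B} {s : ℝ}
    (h : HasDerivAt γ γ' s) : HasDerivAt (fun s => (γ s).1) γ'.1 s := by
  have := (ContinuousLinearMap.fst ℝ A B).hasFDerivAt.comp_hasDerivAt s h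
  exact this

theorem HasDerivAt.snd_comp {A B : Type*} [NormedAddCommGroup A] [NormedSpace ℝ A]
    [NormedAddCommGroup B] [NormedSpace ℝ B] {γ : ℝ → A × B} {γ' : A × B} {s : ℝ}
    (h : HasDerivAt γ γ' s) : HasDerivAt (fun s => (γ s).2) γ'.2 s := by
  have := (ContinuousLinearMap.snd ℝ A B).hasFDerivAt.comp_hasDerivAt s h
  exact this

/-- By symmetry of second derivatives, the time derivative of the μ-variation is the μ-derivative of
the velocity `r`. -/
theorem hasDerivAt_fderiv_param {g : ℝ × ℝ → ℝ} (hg : ContDiff ℝ ∞ g) {s : ℝ} {r : ℝ → ℝ} {r' : ℝ}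
    (hr : ∀ᶠ μ in 𝓝 0, HasDerivAt (fun s => g (s, μ)) (r μ) s) (hr' : HasDerivAt r r' 0) :
    HasDerivAt (fun s => fderiv ℝ g (s, 0) (0, 1)) r' s := by
  have hg' : ContDiff ℝ ∞ (fderiv ℝ g) := hg.fderiv_right (by simp)
  have hd := hg.differentiable (by simp)
  have hd' := hg'.differentiable (by simp)
  have hleft : ∀ μ : ℝ, HasDerivAt (fun s : ℝ => (s, μ)) ((1 : ℝ), (0 : ℝ)) s := fun μ =>
    (hasDerivAt_id s).prodMk (hasDerivAt_const s μ)
  have hright : HasDerivAt (fun μ : ℝ => (s, μ)) ((0 : ℝ), (1 : ℝ)) 0 :=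
    (hasDerivAt_const 0 s).prodMk (hasDerivAt_id 0)
  have key : ∀ (v w : ℝ × ℝ) (l : ℝ → ℝ × ℝ) (t : ℝ), HasDerivAt l v t →
      HasDerivAt (fun t => fderiv ℝ g (l t) w) (fderiv ℝ (fderiv ℝ g) (l t) v w) t := by
    intro v w l t hl
    have h5 := (hd' (l t)).hasFDerivAt.comp_hasDerivAt t hl
    exact (ContinuousLinearMap.apply ℝ ℝ w).hasFDerivAt.comp_hasDerivAt t h5
  have h1 := key (1, 0) (0, 1) (fun s => (s, 0)) s (hleft 0)
  have h2 := key (0, 1) (1, 0) (fun μ => (s, μ)) 0 hright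
  have h3 : r =ᶠ[𝓝 0] fun μ => fderiv ℝ g (s, μ) (1, 0) := by
    filter_upwards [hr] with μ hμ
    exact hμ.unique ((hd (s, μ)).hasFDerivAt.comp_hasDerivAt s (hleft μ))
  have h4 : r' = fderiv ℝ (fderiv ℝ g) (s, 0) (0, 1) (1, 0) :=
    hr'.unique (h2.congr_of_eventuallyEq h3)
  have hsymm : IsSymmSndFDerivAt ℝ g (s, 0) :=
    ((contDiff_infty.1 hg 2).contDiffAt (x := (s, 0))).isSymmSndFDerivAt (by simp)
  rw [h4, hsymm.eq]
  exact h1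

end MixedPartial

/-! ### Brackets of the frame and evolution of the momenta. -/

namespace RescaledFrame

open Set Function

variable {n : ℕ} (Fr : RescaledFrame n)

/-- The polarization of twice the quadratic form `q j`. -/
noncomputable def polar (j : Fin (2 * n)) (u v : Model n) : ℝ := Fr.q j u v + Fr.q j v u

/-- The components of the exterior derivative of the first-order perturbation of the vertical
components. -/
noncomputable def curl (j k : Fin (2 * n)) (v : Model n) : ℝ :=
  Fr.polar j (ex k) v - Fr.polar k (ex j) v

theorem zScale_zero_ex (k : Fin (2 * n)) : zScale 0 (ex k) = ex k := by
  refine model_ext (fun j => ?_) ?_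
  · rw [xc_zScale]
  · rw [zc_zScale, zc_ex, mul_zero]

theorem zScale_zero_ez : zScale 0 (ez : Model n) = 0 := by
  refine model_ext (fun j => ?_) ?_
  · rw [xc_zScale, xc_ez, map_zero]
  · rw [zc_zScale, zero_mul, map_zero]

theorem zScale_zero_hvec (a : Fin (2 * n) → ℝ) : zScale 0 (hvec a) = hvec a := by
  refine model_ext (fun j => ?_) ?_
  · rw [xc_zScale]
  · rw [zc_zScale, zc_hvec, mul_zero]

theorem zScale_zero_nilY (b : Fin n → ℝ) (c : Model n) (s : ℝ) :
    zScale 0 (nilY b c s) = hvec (nilX b c s) := by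
  rw [nilY, map_add, map_smul, zScale_zero_ez, smul_zero, add_zero, zScale_zero_hvec]

theorem dW_zero (j : Fin (2 * n)) (Y v : Model n) :
    Fr.dW j (0, Y) v = Fr.polar j (zScale 0 v) (zScale 0 Y) • ez := by
  have h1 : HasFDerivAt (fun Y => zScale 0 Y) (zScale (n := n) 0) Y := (zScale 0).hasFDerivAt
  have h2 : HasFDerivAt (fun Y => Fr.q j (zScale 0 Y) (zScale 0 Y)) _ Y :=
    ((Fr.q j).hasFDerivAt.comp Y h1).clm_apply h1
  have h3 : HasFDerivAt (fun Y => Fr.W j (0, Y)) _ Y :=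
    (h2.smul_const ez).congr_of_eventuallyEq
      (Filter.Eventually.of_forall fun Y => Fr.W_zero j Y)
  rw [(Fr.hasFDerivAt_W j 0 Y).unique h3]
  simp [polar, add_comm]

/-- The vertical part of the brackets of the frame at order one, up to second-order terms. -/
noncomputable def brk (j k : Fin (2 * n)) (p : ℝ × Model n) : Model n :=
  (ell Fr.b j (Fr.W k p) - ell Fr.b k (Fr.W j p)) • ez + Fr.dW j p (Fr.field k p)
    - Fr.dW k p (Fr.field j p)

theorem contDiff_brk (j k : Fin (2 * n)) : ContDiff ℝ ∞ (Fr.brk j k) := by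
  have h1 := Fr.smooth j
  have h2 := Fr.smooth k
  have h3 := (Fr.contDiff_dW j).clm_apply (Fr.contDiff_field k)
  have h4 := (Fr.contDiff_dW k).clm_apply (Fr.contDiff_field j)
  unfold brk
  fun_prop

theorem ell_W_zero (j k : Fin (2 * n)) (Y : Model n) : ell Fr.b j (Fr.W k (0, Y)) = 0 := by
  rw [Fr.W_zero, map_smul, ell_ez, smul_zero]

theorem zScale_field_zero (k : Fin (2 * n)) (Y : Model n) :
    zScale 0 (Fr.field k (0, Y)) = ex k := by
  rw [field, zero_smul, add_zero, map_add, map_smul, zScale_zero_ez, smul_zero, add_zero,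
    zScale_zero_ex]

theorem brk_zero (j k : Fin (2 * n)) (Y : Model n) :
    Fr.brk j k (0, Y) = Fr.curl j k (zScale 0 Y) • ez := by
  rw [brk, ell_W_zero, ell_W_zero, dW_zero, dW_zero, zScale_field_zero, zScale_field_zero, curl,
    sub_zero, zero_smul, zero_add, sub_smul]

/-- Up to sign these are the Lie brackets of the frame: the constant vertical bracket of the
nilpotent structure plus a correction of order μ. -/
theorem dfield_field_sub (j k : Fin (2 * n)) (p : ℝ × Model n) :
    Fr.dfield j p (Fr.field k p) - Fr.dfield k p (Fr.field j p) =
      (ell Fr.b j (ex k) - ell Fr.b k (ex j)) • ez + p.1 • Fr.brk j k p := by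
  have h : ∀ i l, ell Fr.b i (Fr.field l p) = ell Fr.b i (ex l) + p.1 * ell Fr.b i (Fr.W l p) := by
    intro i l
    rw [field, map_add, map_add, map_smul, map_smul, ell_ez, smul_zero, add_zero, smul_eq_mul]
  rw [dfield_apply, dfield_apply, h, h, brk]
  module

theorem sum_ell_ex_mul (b : Fin n → ℝ) (j : Fin (2 * n)) (a : Fin (2 * n) → ℝ) :
    ∑ k, a k * (ell b j (ex k) - ell b k (ex j)) = bIdx b j * rot j (hvec a) := by
  have h1 : ∑ k, a k * ell b j (ex k) = ell b j (hvec a) := by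
    simp only [hvec, map_sum, map_smul, smul_eq_mul]
  have h2 : ∑ k, a k * ell b k (ex j) = -ell b j (hvec a) := by
    have := sum_ell_mul b (ex j) (hvec a)
    simp only [xc_hvec, xc_ex, ite_mul, one_mul, zero_mul] at this
    rw [Finset.sum_ite_eq' ] at this
    simp only [Finset.mem_univ, if_true] at this
    rw [← this]
    exact Finset.sum_congr rfl fun k _ => mul_comm _ _
  simp only [mul_sub, Finset.sum_sub_distrib]
  rw [h1, h2, ell_eq]
  ring

/-- The momenta `P(X_j)` along a Hamiltonian curve. -/
theorem hasDerivAt_momentum {μ s : ℝ} {γ : ℝ → Phase n}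
    (hγ : HasDerivAt γ (Fr.hamField (μ, γ s)) s) (j : Fin (2 * n)) :
    HasDerivAt (fun s => (γ s).2 (Fr.field j (μ, (γ s).1)))
      (∑ k, (γ s).2 (Fr.field k (μ, (γ s).1)) *
        ((ell Fr.b j (ex k) - ell Fr.b k (ex j)) * (γ s).2 ez
          + μ * (γ s).2 (Fr.brk j k (μ, (γ s).1)))) s := by
  have h1 : HasDerivAt (fun s => (γ s).1) (Fr.hamField (μ, γ s)).1 s :=
    hγ.fst_comp
  have h2 : HasDerivAt (fun s => (γ s).2) (Fr.hamField (μ, γ s)).2 s :=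
    hγ.snd_comp
  have h4' := (Fr.hasFDerivAt_field j μ (γ s).1).comp_hasDerivAt s h1
  have h4 : HasDerivAt (fun s => Fr.field j (μ, (γ s).1))
    (Fr.dfield j (μ, (γ s).1) (Fr.hamField (μ, γ s)).1) s := h4'
  refine (h2.clm_apply h4).congr_deriv ?_
  simp only [hamField, neg_apply, sum_apply, smul_apply, ContinuousLinearMap.comp_apply, map_sum,
    map_smul, smul_eq_mul]
  rw [← Finset.sum_neg_distrib, ← Finset.sum_add_distrib]
  refine Finset.sum_congr rfl fun k _ => ?_
  have h3 := congrArg (γ s).2 (Fr.dfield_field_sub j k (μ, (γ s).1))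
  simp only [map_sub, map_add, map_smul, smul_eq_mul] at h3
  rw [← h3]
  ring

theorem hasDerivAt_xc {μ s : ℝ} {γ : ℝ → Phase n}
    (hγ : HasDerivAt γ (Fr.hamField (μ, γ s)) s) (j : Fin (2 * n)) :
    HasDerivAt (fun s => xc j (γ s).1)
      ((γ s).2 (Fr.field j (μ, (γ s).1)) +
        μ * ∑ k, (γ s).2 (Fr.field k (μ, (γ s).1)) * xc j (Fr.W k (μ, (γ s).1))) s := by
  have h1 : HasDerivAt (fun s => xc j (γ s).1) (xc j (Fr.hamField (μ, γ s)).1) s :=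
    (xc j).hasFDerivAt.comp_hasDerivAt s hγ.fst_comp
  refine h1.congr_deriv ?_
  have h2 : ∀ k, xc j (Fr.field k (μ, (γ s).1)) =
      (if j = k then 1 else 0) + μ * xc j (Fr.W k (μ, (γ s).1)) := by
    intro k
    rw [field, map_add, map_add, map_smul, map_smul, xc_ez, xc_ex, smul_zero, add_zero, smul_eq_mul]
  simp only [hamField, map_sum, map_smul, smul_eq_mul, h2, mul_add, Finset.sum_add_distrib]
  simp only [mul_ite, mul_one, mul_zero, Finset.sum_ite_eq, Finset.mem_univ, if_true,
    Finset.mul_sum]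
  congr 1
  exact Finset.sum_congr rfl fun k _ => by ring

/-- The nilpotent frame does not depend on z, so only the perturbation changes the vertical
momentum. -/
theorem hasDerivAt_vertical {μ s : ℝ} {γ : ℝ → Phase n}
    (hγ : HasDerivAt γ (Fr.hamField (μ, γ s)) s) :
    HasDerivAt (fun s => (γ s).2 ez)
      (μ * -∑ k, (γ s).2 (Fr.field k (μ, (γ s).1)) * (γ s).2 (Fr.dW k (μ, (γ s).1) ez)) s := by
  have h2 : HasDerivAt (fun s => (γ s).2) (Fr.hamField (μ, γ s)).2 s :=
    hγ.snd_comp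
  have h3 := h2.clm_apply (hasDerivAt_const s (ez (n := n)))
  refine h3.congr_deriv ?_
  simp only [hamField, neg_apply, sum_apply, smul_apply, ContinuousLinearMap.comp_apply,
    dfield_apply, ell_ez, zero_smul, zero_add, map_smul, smul_eq_mul, map_zero, add_zero]
  rw [mul_neg, Finset.mul_sum]
  congr 1
  exact Finset.sum_congr rfl fun k _ => by ring

end RescaledFrame

/-! ### The first variation of the endpoint. -/

namespace RescaledFrame

open Set Function

variable {n : ℕ} (Fr : RescaledFrame n)

/-- The magnetic force of first order in `μ` along the nilpotent geodesic. -/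
noncomputable def force (c : Model n) (s : ℝ) (j : Fin (2 * n)) : ℝ :=
  ∑ k, nilU Fr.b c s k * (zc c * Fr.curl j k (hvec (nilX Fr.b c s)))

/-- The variation of first order in `μ` of the `k`-th coordinate of the endpoint. -/
noncomputable def firstVar (c : Model n) (k : Fin (2 * n)) : ℝ :=
  ∫ s in (0 : ℝ)..1, (cosInt (zc c * bIdx Fr.b k) (1 - s) * Fr.force c s k +
    sinInt (zc c * bIdx Fr.b k) (1 - s) * rot k (hvec (Fr.force c s)))

theorem continuous_polar (j : Fin (2 * n)) (u : Model n) : Continuous (Fr.polar j u) := by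
  unfold polar
  fun_prop

theorem continuous_force (c : Model n) (j : Fin (2 * n)) :
    Continuous fun s => Fr.force c s j := by
  have h1 : ∀ k, Continuous fun s => nilU Fr.b c s k := fun k => by unfold nilU; fun_prop
  have h2 : Continuous fun s => hvec (nilX Fr.b c s) :=
    continuous_iff_continuousAt.2 fun s =>
      (hasDerivAt_hvec (hasDerivAt_nilX Fr.b c s)).continuousAt
  have h3 : ∀ k, Continuous fun s => Fr.curl j k (hvec (nilX Fr.b c s)) := fun k =>
    ((Fr.continuous_polar j _).comp h2).sub ((Fr.continuous_polar k _).comp h2)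
  unfold force
  fun_prop

theorem continuous_cosInt_snd (θ : ℝ) : Continuous (cosInt θ) :=
  continuous_iff_continuousAt.2 fun s => (hasDerivAt_cosInt θ s).continuousAt

theorem continuous_sinInt_snd (θ : ℝ) : Continuous (sinInt θ) :=
  continuous_iff_continuousAt.2 fun s => (hasDerivAt_sinInt θ s).continuousAt

theorem rot_hvec_rot (b : Fin n → ℝ) (k : Fin (2 * n)) (v : Model n) (w : ℝ)
    (f : Fin (2 * n) → ℝ) :
    rot k (hvec fun j => w * bIdx b j * rot j v + f j) =
      -(w * bIdx b k * xc k v) + rot k (hvec f) := by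
  revert k
  refine idx_cases (fun i => ?_) fun i => ?_
  · rw [rot_oddIdx, xc_hvec, rot_oddIdx, rot_evenIdx, bIdx_evenIdx, bIdx_oddIdx, xc_hvec]; ring
  · rw [rot_evenIdx, xc_hvec, rot_evenIdx, rot_oddIdx, bIdx_evenIdx, bIdx_oddIdx, xc_hvec]; ring

/-- Integration of the linearized magnetic equation `x'' = θ rot x' + f` with vanishing initial
data. -/
theorem eq_integral_of_linearized {b : Fin n → ℝ} {w : ℝ} {x u f : ℝ → Fin (2 * n) → ℝ}
    (hf : ∀ k, Continuous fun s => f s k)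
    (hx : ∀ s ∈ Icc (0 : ℝ) 1, ∀ k, HasDerivAt (fun s => x s k) (u s k) s)
    (hu : ∀ s ∈ Icc (0 : ℝ) 1, ∀ k,
      HasDerivAt (fun s => u s k) (w * bIdx b k * rot k (hvec (u s)) + f s k) s)
    (hx0 : x 0 = 0) (hu0 : u 0 = 0) (k : Fin (2 * n)) :
    x 1 k = ∫ s in (0 : ℝ)..1, (cosInt (w * bIdx b k) (1 - s) * f s k +
      sinInt (w * bIdx b k) (1 - s) * rot k (hvec (f s))) := by
  set θ := w * bIdx b k
  -- Variation of constants: this combination is the endpoint reached by the force-free equation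
  -- from the state at time `s`, so its derivative involves only the force. It equals `x 1 k` at `s
  -- = 1` and 0 at `s = 0`.
  have hd : ∀ s ∈ uIcc (0 : ℝ) 1, HasDerivAt
      (fun s => x s k + cosInt θ (1 - s) * u s k + sinInt θ (1 - s) * rot k (hvec (u s)))
      (cosInt θ (1 - s) * f s k + sinInt θ (1 - s) * rot k (hvec (f s))) s := by
    intro s hs
    rw [uIcc_of_le zero_le_one] at hs
    have hsub : HasDerivAt (fun s : ℝ => 1 - s) (-1) s := by
      simpa using (hasDerivAt_id s).const_sub 1
    have h1 : HasDerivAt (fun s => cosInt θ (1 - s)) (Real.cos (θ * (1 - s)) * -1) s :=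
      (hasDerivAt_cosInt θ (1 - s)).comp s hsub
    have h2 : HasDerivAt (fun s => sinInt θ (1 - s)) (Real.sin (θ * (1 - s)) * -1) s :=
      (hasDerivAt_sinInt θ (1 - s)).comp s hsub
    have h3 : HasDerivAt (fun s => rot k (hvec (u s)))
        (rot k (hvec fun j => w * bIdx b j * rot j (hvec (u s)) + f s j)) s :=
      (rot k).hasFDerivAt.comp_hasDerivAt s (hasDerivAt_hvec (hu s hs))
    rw [rot_hvec_rot, xc_hvec] at h3
    refine (((hx s hs k).add (h1.mul (hu s hs k))).add (h2.mul h3)).congr_deriv ?_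
    have h4 := mul_cosInt θ (1 - s)
    have h5 := mul_sinInt θ (1 - s)
    change _ = _
    linear_combination rot k (hvec (u s)) * h4 - u s k * h5
  have hint : IntervalIntegrable (fun s => cosInt θ (1 - s) * f s k +
      sinInt θ (1 - s) * rot k (hvec (f s))) MeasureTheory.volume 0 1 := by
    have h1 := (continuous_cosInt_snd θ).comp (by fun_prop : Continuous fun s : ℝ => 1 - s)
    have h2 := (continuous_sinInt_snd θ).comp (by fun_prop : Continuous fun s : ℝ => 1 - s)
    have h3 : Continuous fun s => rot k (hvec (f s)) :=
      (rot k).continuous.comp (continuous_hvec.comp (continuous_pi hf))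
    exact ((h1.mul (hf k)).add (h2.mul h3)).intervalIntegrable _ _
  rw [intervalIntegral.integral_eq_sub_of_hasDerivAt hd hint, hx0, hu0]
  simp [cosInt, sinInt, hvec]

/-- Hamilton's equations are differentiated in μ at μ = 0. The perturbation of order μ is vertical
and independent of z, so the vertical momentum has no first variation and the variation of position
has the variation of momenta as velocity. The latter satisfies the linear magnetic equation with
right-hand side `force` and zero initial value. -/
theorem exists_exponential (R : ℝ) :
    ∃ μ₀ > 0, ∃ ρ : ℝ, ∃ G : Model n × ℝ → Model n, ContDiff ℝ ∞ G ∧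
      ∀ c ∈ Metric.closedBall (0 : Model n) R, G (c, 0) = nilY Fr.b c 1 ∧
        (∀ k, xc k (fderiv ℝ G (c, 0) (0, 1)) = Fr.firstVar c k) ∧
        ∀ μ : ℝ, |μ| < μ₀ → ∃ γ : ℝ → Phase n, γ 0 = (0, covOf c) ∧ (γ 1).1 = G (c, μ) ∧
          ∀ s ∈ Icc (0 : ℝ) 1, ‖γ s‖ < ρ ∧ HasDerivAt γ (Fr.hamField (μ, γ s)) s := by
  obtain ⟨μ₀, hμ₀, ρ, Γ, hΓ, hsol⟩ := Fr.exists_smooth_flow R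
  have hG : ContDiff ℝ ∞ fun p : Model n × ℝ => (Γ 1 p).1 :=
    contDiff_fst.comp (hΓ.comp (contDiff_const.prodMk contDiff_id))
  refine ⟨μ₀, hμ₀, ρ, fun p => (Γ 1 p).1, hG, fun c hc => ?_⟩
  obtain ⟨hnil, hode⟩ := hsol c hc
  refine ⟨congrArg Prod.fst (hnil 1 (by simp)), fun k => ?_, fun μ hμ => ⟨fun s => Γ s (c, μ),
    (hode μ hμ).1, rfl, (hode μ hμ).2⟩⟩
  have hev : ∀ᶠ μ : ℝ in 𝓝 0, |μ| < μ₀ :=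
    (continuous_abs.continuousAt (x := (0 : ℝ))).eventually_lt_const (by simpa using hμ₀)
  let γ : ℝ × ℝ → Phase n := fun p => Γ p.1 (c, p.2)
  have hγ : ContDiff ℝ ∞ γ :=
    hΓ.comp (contDiff_fst.prodMk (contDiff_const.prodMk contDiff_snd))
  have hγY : ContDiff ℝ ∞ fun p => (p.2, (γ p).1) := contDiff_snd.prodMk (contDiff_fst.comp hγ)
  have hγP : ContDiff ℝ ∞ fun p => (γ p).2 := contDiff_snd.comp hγ
  let x : Fin (2 * n) → ℝ × ℝ → ℝ := fun j p => xc j (γ p).1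
  let u : Fin (2 * n) → ℝ × ℝ → ℝ := fun j p => (γ p).2 (Fr.field j (p.2, (γ p).1))
  let v : ℝ × ℝ → ℝ := fun p => (γ p).2 ez
  have hx : ∀ j, ContDiff ℝ ∞ (x j) := fun j => (xc j).contDiff.comp (contDiff_fst.comp hγ)
  have hu : ∀ j, ContDiff ℝ ∞ (u j) := fun j => hγP.clm_apply ((Fr.contDiff_field j).comp hγY)
  have hv : ContDiff ℝ ∞ v := hγP.clm_apply contDiff_const
  have hd : ∀ {g : ℝ × ℝ → ℝ}, ContDiff ℝ ∞ g → ∀ s,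
      HasDerivAt (fun μ => g (s, μ)) (fderiv ℝ g (s, 0) (0, 1)) 0 := fun hg s =>
    (hg.differentiable (by simp) (s, 0)).hasFDerivAt.comp_hasDerivAt (0 : ℝ)
      ((hasDerivAt_const (0 : ℝ) s).prodMk (hasDerivAt_id (0 : ℝ)))
  -- Continuity of `g` suffices, since the slope of `μ * g μ` at 0 is `g μ` itself.
  have hmul : ∀ {g : ℝ → ℝ}, Continuous g → HasDerivAt (fun μ => μ * g μ) (g 0) 0 := by
    intro g hg
    rw [hasDerivAt_iff_tendsto_slope]
    refine (hg.tendsto 0).mono_left nhdsWithin_le_nhds |>.congr' ?_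
    filter_upwards [self_mem_nhdsWithin] with μ hμ
    rw [slope_def_field]
    have : μ ≠ 0 := hμ
    field_simp
    simp
  have hline : ∀ s : ℝ, Continuous fun μ : ℝ => (s, μ) := fun s => by fun_prop
  have hγ0 : ∀ s ∈ Icc (0 : ℝ) 1, γ (s, 0) = (nilY Fr.b c s, nilP Fr.b c s) := hnil
  have hv0 : ∀ s ∈ Icc (0 : ℝ) 1, v (s, 0) = zc c := fun s hs => by
    simp only [v, hγ0 s hs, nilP_ez]
  have hu0 : ∀ s ∈ Icc (0 : ℝ) 1, ∀ j, u j (s, 0) = nilU Fr.b c s j := fun s hs j => by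
    simp only [u, hγ0 s hs, nilP_field]
  have hv1 : ∀ s ∈ Icc (0 : ℝ) 1, HasDerivAt (fun s => fderiv ℝ v (s, 0) (0, 1)) 0 s := by
    intro s hs
    refine hasDerivAt_fderiv_param hv (hev.mono fun μ hμ =>
      Fr.hasDerivAt_vertical ((hode μ hμ).2 s hs).2) ?_
    have hcont : Continuous fun μ => -∑ k, u k (s, μ) * (γ (s, μ)).2 (Fr.dW k (μ, (γ (s, μ)).1) ez) := by
      refine (continuous_finsetSum _ fun k _ => ?_).neg
      have h1 := (hγP.clm_apply (((Fr.contDiff_dW k).comp hγY).clm_apply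
        (contDiff_const (c := ez)))).continuous
      exact (((hu k).continuous.mul h1).comp (hline s))
    refine (hmul hcont).congr_deriv ?_
    simp [dW_zero, zScale_zero_ez, polar]
  have hv2 : ∀ s ∈ Icc (0 : ℝ) 1, fderiv ℝ v (s, 0) (0, 1) = 0 := by
    intro s hs
    rw [constant_of_has_deriv_right_zero (f := fun s => fderiv ℝ v (s, 0) (0, 1))
      (fun r hr => (hv1 r hr).continuousAt.continuousWithinAt)
      (fun r hr => (hv1 r (Ico_subset_Icc_self hr)).hasDerivWithinAt) s hs]
    refine (hd hv 0).unique ((hasDerivAt_const (0 : ℝ) (zc c)).congr_of_eventuallyEq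
      (hev.mono fun μ hμ => ?_))
    simp only [v, γ, (hode μ hμ).1, covOf_apply, xc_ez, zc_ez]
    simp
  have hx1 : ∀ s ∈ Icc (0 : ℝ) 1, ∀ j, HasDerivAt (fun s => fderiv ℝ (x j) (s, 0) (0, 1))
      (fderiv ℝ (u j) (s, 0) (0, 1)) s := by
    intro s hs j
    refine hasDerivAt_fderiv_param (hx j) (hev.mono fun μ hμ =>
      Fr.hasDerivAt_xc ((hode μ hμ).2 s hs).2 j) ?_
    have hcont : Continuous fun μ => ∑ k, u k (s, μ) * xc j (Fr.W k (μ, (γ (s, μ)).1)) := by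
      refine continuous_finsetSum _ fun k _ => ?_
      have h1 := ((xc j).contDiff.comp ((Fr.smooth k).comp hγY)).continuous
      exact (((hu k).continuous.mul h1).comp (hline s))
    refine ((hd (hu j) s).add (hmul hcont)).congr_deriv ?_
    simp only [Fr.W_zero, map_smul, xc_ez, smul_zero, mul_zero, Finset.sum_const_zero, add_zero]
  have hu1 : ∀ s ∈ Icc (0 : ℝ) 1, ∀ j, HasDerivAt (fun s => fderiv ℝ (u j) (s, 0) (0, 1))
      (zc c * bIdx Fr.b j * rot j (hvec fun k => fderiv ℝ (u k) (s, 0) (0, 1))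
        + Fr.force c s j) s := by
    intro s hs j
    refine hasDerivAt_fderiv_param (hu j) (hev.mono fun μ hμ =>
      Fr.hasDerivAt_momentum ((hode μ hμ).2 s hs).2 j) ?_
    have h1 : ∀ k, HasDerivAt (fun μ => u k (s, μ) *
        ((ell Fr.b j (ex k) - ell Fr.b k (ex j)) * v (s, μ)
          + μ * (γ (s, μ)).2 (Fr.brk j k (μ, (γ (s, μ)).1)))) 
        (fderiv ℝ (u k) (s, 0) (0, 1) * ((ell Fr.b j (ex k) - ell Fr.b k (ex j)) * zc c) +
          nilU Fr.b c s k * (zc c * Fr.curl j k (hvec (nilX Fr.b c s)))) 0 := by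
      intro k
      have h2 := (hγP.clm_apply ((Fr.contDiff_brk j k).comp hγY)).continuous.comp (hline s)
      refine ((hd (hu k) s).mul (((hd hv s).const_mul _).add (hmul h2))).congr_deriv ?_
      simp only [Pi.add_apply, zero_mul, add_zero, comp_apply, hv2 s hs, hv0 s hs, hu0 s hs, hγ0 s hs, brk_zero, zScale_zero_nilY,
        map_smul, nilP_ez, smul_eq_mul]
      ring
    refine (HasDerivAt.fun_sum fun k _ => h1 k).congr_deriv ?_
    rw [Finset.sum_add_distrib, force]
    congr 1
    have h3 := sum_ell_ex_mul Fr.b j fun k => fderiv ℝ (u k) (s, 0) (0, 1)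
    rw [mul_assoc, ← h3, Finset.mul_sum]
    exact Finset.sum_congr rfl fun k _ => by ring
  have hx2 : ∀ j, fderiv ℝ (x j) (0, 0) (0, 1) = 0 := fun j =>
    (hd (hx j) 0).unique ((hasDerivAt_const (0 : ℝ) (0 : ℝ)).congr_of_eventuallyEq
      (hev.mono fun μ hμ => by simp only [x, γ, (hode μ hμ).1, map_zero]))
  -- The initial momenta depend on μ through the frame at the origin, but their first-order term `W
  -- j (0, 0)` vanishes because it is quadratic.
  have hu2 : ∀ j, fderiv ℝ (u j) (0, 0) (0, 1) = 0 := by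
    intro j
    have hcont : Continuous fun μ : ℝ => covOf c (Fr.W j (μ, 0)) :=
      (covOf c).continuous.comp ((Fr.smooth j).continuous.comp (by fun_prop))
    refine (hd (hu j) 0).unique ((((hmul hcont).const_add (covOf c (ex j))).congr_deriv
      ?_).congr_of_eventuallyEq (hev.mono fun μ hμ => ?_))
    · rw [Fr.W_zero, map_zero, map_zero, zero_smul, map_zero]
    · simp only [u, γ, (hode μ hμ).1, field, map_zero, map_add, map_smul, zero_mul, add_zero,
        smul_eq_mul]
  have h1 := eq_integral_of_linearized (fun k => Fr.continuous_force c k) hx1 hu1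
    (funext hx2) (funext hu2) k
  rw [firstVar, ← h1]
  have h2 : HasDerivAt (fun μ : ℝ => (Γ 1 (c, μ)).1)
      (fderiv ℝ (fun p : Model n × ℝ => (Γ 1 p).1) (c, 0) (0, 1)) 0 :=
    (hG.differentiable (by simp) (c, 0)).hasFDerivAt.comp_hasDerivAt (0 : ℝ)
      ((hasDerivAt_const (0 : ℝ) c).prodMk (hasDerivAt_id (0 : ℝ)))
  exact ((xc k).hasFDerivAt.comp_hasDerivAt (0 : ℝ) h2).unique (hd (hx k) 1)

end RescaledFrame

/-! ### The first variation as a bilinear form at fixed vertical momentum. -/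

namespace RescaledFrame

open Set Function Real

variable {n : ℕ} (Fr : RescaledFrame n)

theorem curl_add (j k : Fin (2 * n)) (u v : Model n) :
    Fr.curl j k (u + v) = Fr.curl j k u + Fr.curl j k v := by
  simp only [curl, polar, map_add, add_apply]; ring

theorem curl_smul (j k : Fin (2 * n)) (a : ℝ) (v : Model n) :
    Fr.curl j k (a • v) = a * Fr.curl j k v := by
  simp only [curl, polar, map_smul, smul_apply, smul_eq_mul]; ring

theorem curl_swap (j k : Fin (2 * n)) (v : Model n) : Fr.curl k j v = -Fr.curl j k v := by
  simp only [curl]; ring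

theorem curl_self (j : Fin (2 * n)) (v : Model n) : Fr.curl j j v = 0 := by
  simp only [curl]; ring

/-- Closedness of the two-form with coefficients `curl`: it is the exterior derivative of a one-form
with quadratic coefficients. -/
theorem curl_cyclic (i j k : Fin (2 * n)) :
    Fr.curl i k (ex j) - Fr.curl j k (ex i) = Fr.curl i j (ex k) := by
  simp only [curl, polar]; ring

theorem curl_sum {ι : Type*} (s : Finset ι) (j k : Fin (2 * n)) (v : ι → Model n) :
    Fr.curl j k (∑ i ∈ s, v i) = ∑ i ∈ s, Fr.curl j k (v i) := by
  classical
  induction s using Finset.induction_on with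
  | empty => simp [curl, polar]
  | insert i s hi ih => rw [Finset.sum_insert hi, Finset.sum_insert hi, curl_add, ih]

theorem continuous_curl (j k : Fin (2 * n)) : Continuous (Fr.curl j k) :=
  (Fr.continuous_polar j _).sub (Fr.continuous_polar k _)

/-- The velocities of the nilpotent geodesics with vertical momentum `w`, as linear functions of the
initial covector. -/
noncomputable def linU (w s : ℝ) (k : Fin (2 * n)) : Model n →L[ℝ] ℝ :=
  cos (w * bIdx Fr.b k * s) • xc k + sin (w * bIdx Fr.b k * s) • rot k

/-- The horizontal components of the nilpotent geodesics with vertical momentum `w`, as linear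
functions of the initial covector. -/
noncomputable def linX (w s : ℝ) : Model n →L[ℝ] Model n :=
  ∑ k, (cosInt (w * bIdx Fr.b k) s • xc k + sinInt (w * bIdx Fr.b k) s • rot k).smulRight (ex k)

theorem linU_apply (w s : ℝ) (k : Fin (2 * n)) (u : Model n) :
    Fr.linU w s k u = cos (w * bIdx Fr.b k * s) * xc k u + sin (w * bIdx Fr.b k * s) * rot k u := rfl

theorem linX_apply (w s : ℝ) (u : Model n) :
    Fr.linX w s u = hvec fun k =>
      cosInt (w * bIdx Fr.b k) s * xc k u + sinInt (w * bIdx Fr.b k) s * rot k u := by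
  simp only [linX, sum_apply, ContinuousLinearMap.smulRight_apply, add_apply, smul_apply,
    smul_eq_mul, hvec]

theorem hasDerivAt_linX (w s : ℝ) (u : Model n) :
    HasDerivAt (fun s => Fr.linX w s u) (hvec fun k => Fr.linU w s k u) s := by
  simp only [linX_apply]
  exact hasDerivAt_hvec fun k =>
    ((hasDerivAt_cosInt _ s).mul_const _).add ((hasDerivAt_sinInt _ s).mul_const _)

/-- The polarization of `force`. -/
noncomputable def force₂ (w : ℝ) (u v : Model n) (s : ℝ) (j : Fin (2 * n)) : ℝ :=
  ∑ k, Fr.linU w s k u * (w * Fr.curl j k (Fr.linX w s v))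

/-- The integrand of `firstVar₂`. -/
noncomputable def varIntegrand (w : ℝ) (k : Fin (2 * n)) (u v : Model n) (s : ℝ) : ℝ :=
  cosInt (w * bIdx Fr.b k) (1 - s) * Fr.force₂ w u v s k +
    sinInt (w * bIdx Fr.b k) (1 - s) * rot k (hvec (Fr.force₂ w u v s))

/-- The polarization of `firstVar`. -/
noncomputable def firstVar₂ (w : ℝ) (k : Fin (2 * n)) (u v : Model n) : ℝ :=
  ∫ s in (0 : ℝ)..1, Fr.varIntegrand w k u v s

/-- Once the vertical momentum is frozen, velocity and position on nilpotent geodesics are linear in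
the covector, and the force is bilinear in the two. -/
theorem firstVar_eq (c : Model n) (k : Fin (2 * n)) :
    Fr.firstVar c k = Fr.firstVar₂ (zc c) k c c := by
  have : Fr.force c = Fr.force₂ (zc c) c c := by
    ext s j
    simp only [force, force₂, linX_apply]
    rfl
  simp only [firstVar, firstVar₂, varIntegrand, this]

theorem continuous_force₂ (w : ℝ) (u v : Model n) (j : Fin (2 * n)) :
    Continuous fun s => Fr.force₂ w u v s j := by
  have h1 : ∀ k, Continuous fun s => Fr.linU w s k u := fun k => by
    simp only [linU_apply]; fun_prop
  have h2 : Continuous fun s => Fr.linX w s v :=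
    continuous_iff_continuousAt.2 fun s => (Fr.hasDerivAt_linX w s v).continuousAt
  have h3 : ∀ k, Continuous fun s => Fr.curl j k (Fr.linX w s v) := fun k =>
    (Fr.continuous_curl j k).comp h2
  unfold force₂
  fun_prop

theorem continuous_varIntegrand (w : ℝ) (k : Fin (2 * n)) (u v : Model n) :
    Continuous (Fr.varIntegrand w k u v) := by
  have h1 := (continuous_cosInt_snd (w * bIdx Fr.b k)).comp
    (by fun_prop : Continuous fun s : ℝ => 1 - s)
  have h2 := (continuous_sinInt_snd (w * bIdx Fr.b k)).comp
    (by fun_prop : Continuous fun s : ℝ => 1 - s)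
  have h3 : Continuous fun s => rot k (hvec (Fr.force₂ w u v s)) :=
    (rot k).continuous.comp (continuous_hvec.comp (continuous_pi (Fr.continuous_force₂ w u v)))
  exact (h1.mul (Fr.continuous_force₂ w u v k)).add (h2.mul h3)

theorem hvec_add (a a' : Fin (2 * n) → ℝ) : hvec (a + a') = hvec a + hvec a' := by
  simp only [hvec, Pi.add_apply, add_smul, Finset.sum_add_distrib]

theorem hvec_smul (t : ℝ) (a : Fin (2 * n) → ℝ) : hvec (t • a) = t • hvec a := by
  simp only [hvec, Pi.smul_apply, smul_eq_mul, Finset.smul_sum, smul_smul]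

theorem varIntegrand_of_force_eq {w : ℝ} {u v u₁ v₁ u₂ v₂ : Model n} {s t : ℝ}
    (h : Fr.force₂ w u v s = Fr.force₂ w u₁ v₁ s + t • Fr.force₂ w u₂ v₂ s) (k : Fin (2 * n)) :
    Fr.varIntegrand w k u v s = Fr.varIntegrand w k u₁ v₁ s + t * Fr.varIntegrand w k u₂ v₂ s := by
  simp only [varIntegrand, h, hvec_add, hvec_smul, map_add, map_smul, Pi.add_apply, Pi.smul_apply,
    smul_eq_mul]
  ring

theorem firstVar₂_of_force_eq {w t : ℝ} {u v u₁ v₁ u₂ v₂ : Model n}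
    (h : ∀ s, Fr.force₂ w u v s = Fr.force₂ w u₁ v₁ s + t • Fr.force₂ w u₂ v₂ s)
    (k : Fin (2 * n)) :
    Fr.firstVar₂ w k u v = Fr.firstVar₂ w k u₁ v₁ + t * Fr.firstVar₂ w k u₂ v₂ := by
  simp only [firstVar₂]
  rw [← intervalIntegral.integral_const_mul, ← intervalIntegral.integral_add
    ((Fr.continuous_varIntegrand ..).intervalIntegrable _ _)
    (((Fr.continuous_varIntegrand ..).const_mul t).intervalIntegrable _ _)]
  exact intervalIntegral.integral_congr fun s _ => Fr.varIntegrand_of_force_eq (h s) k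

theorem firstVar₂_add_smul_left (w t : ℝ) (k : Fin (2 * n)) (u u' v : Model n) :
    Fr.firstVar₂ w k (u + t • u') v = Fr.firstVar₂ w k u v + t * Fr.firstVar₂ w k u' v := by
  refine Fr.firstVar₂_of_force_eq (fun s => ?_) k
  ext j
  simp only [force₂, map_add, map_smul, Pi.add_apply, Pi.smul_apply, smul_eq_mul, Finset.mul_sum]
  rw [← Finset.sum_add_distrib]
  exact Finset.sum_congr rfl fun _ _ => by ring

theorem firstVar₂_add_smul_right (w t : ℝ) (k : Fin (2 * n)) (u v v' : Model n) :
    Fr.firstVar₂ w k u (v + t • v') = Fr.firstVar₂ w k u v + t * Fr.firstVar₂ w k u v' := by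
  refine Fr.firstVar₂_of_force_eq (fun s => ?_) k
  ext j
  simp only [force₂, map_add, map_smul, Pi.add_apply, Pi.smul_apply, smul_eq_mul, Finset.mul_sum,
    curl_add, curl_smul]
  rw [← Finset.sum_add_distrib]
  exact Finset.sum_congr rfl fun _ _ => by ring

/-- `firstVar₂` as a bilinear form. -/
noncomputable def varForm (w : ℝ) (k : Fin (2 * n)) : Model n →ₗ[ℝ] Model n →ₗ[ℝ] ℝ :=
  LinearMap.mk₂ ℝ (Fr.firstVar₂ w k)
    (fun u u' v => by simpa using Fr.firstVar₂_add_smul_left w 1 k u u' v)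
    (fun t u v => by
      have h0 := Fr.firstVar₂_add_smul_left w 1 k 0 0 v
      have h1 := Fr.firstVar₂_add_smul_left w t k 0 u v
      simp only [smul_zero, add_zero, zero_add] at h0 h1
      rw [smul_eq_mul]
      linarith)
    (fun u v v' => by simpa using Fr.firstVar₂_add_smul_right w 1 k u v v')
    (fun t u v => by
      have h0 := Fr.firstVar₂_add_smul_right w 1 k u 0 0
      have h1 := Fr.firstVar₂_add_smul_right w t k u 0 v
      simp only [smul_zero, add_zero, zero_add] at h0 h1
      rw [smul_eq_mul]
      linarith)

theorem varForm_apply (w : ℝ) (k : Fin (2 * n)) (u v : Model n) :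
    Fr.varForm w k u v = Fr.firstVar₂ w k u v := rfl

theorem varForm_ez_left (w : ℝ) (k : Fin (2 * n)) (v : Model n) : Fr.varForm w k ez v = 0 := by
  have h : ∀ s, Fr.force₂ w ez v s = 0 := fun s => by
    ext j
    simp only [force₂, linU_apply, xc_ez, rot_ez]
    simp
  rw [varForm_apply, firstVar₂]
  simp [varIntegrand, h, hvec]

theorem varForm_ez_right (w : ℝ) (k : Fin (2 * n)) (u : Model n) : Fr.varForm w k u ez = 0 := by
  have h0 : ∀ s, Fr.linX w s ez = 0 := fun s => by
    simp only [linX_apply, xc_ez, rot_ez]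
    simp [hvec]
  have h : ∀ s, Fr.force₂ w u ez s = 0 := fun s => by
    ext j
    simp [force₂, h0, curl, polar]
  rw [varForm_apply, firstVar₂]
  simp [varIntegrand, h, hvec]

theorem firstVar_eq_varForm (c : Model n) (k : Fin (2 * n)) :
    Fr.firstVar c k = Fr.varForm (zc c) k c c := Fr.firstVar_eq c k

end RescaledFrame

/-! ### Trigonometric primitives over a full period. -/

section FullPeriod

open Real

theorem two_pi_mul_cosInt (s : ℝ) : 2 * π * cosInt (2 * π) s = sin (2 * π * s) := mul_cosInt _ s

theorem two_pi_mul_sinInt (s : ℝ) : 2 * π * sinInt (2 * π) s = 1 - cos (2 * π * s) := mul_sinInt _ s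

theorem cosInt_two_pi_reverse (s : ℝ) : cosInt (2 * π) (1 - s) = -cosInt (2 * π) s := by
  have h : (2 * π : ℝ) ≠ 0 := by positivity
  apply mul_left_cancel₀ h
  rw [mul_neg, two_pi_mul_cosInt, two_pi_mul_cosInt, mul_sub, mul_one, sin_two_pi_sub]

theorem sinInt_two_pi_reverse (s : ℝ) : sinInt (2 * π) (1 - s) = sinInt (2 * π) s := by
  have h : (2 * π : ℝ) ≠ 0 := by positivity
  apply mul_left_cancel₀ h
  rw [two_pi_mul_sinInt, two_pi_mul_sinInt, mul_sub, mul_one, cos_two_pi_sub]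

theorem cosInt_two_pi_one : cosInt (2 * π) 1 = 0 := by
  have h : (2 * π : ℝ) ≠ 0 := by positivity
  apply mul_left_cancel₀ h
  rw [two_pi_mul_cosInt]; simp

theorem sinInt_two_pi_one : sinInt (2 * π) 1 = 0 := by
  have h : (2 * π : ℝ) ≠ 0 := by positivity
  apply mul_left_cancel₀ h
  rw [two_pi_mul_sinInt]; simp

theorem cosInt_at_zero (θ : ℝ) : cosInt θ 0 = 0 := by simp [cosInt]

theorem sinInt_at_zero (θ : ℝ) : sinInt θ 0 = 0 := by simp [sinInt]

/-- With `σ` and `τ` the primitives over one period: `σ cos + τ sin = σ`. -/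
theorem cosInt_mul_cos_add (s : ℝ) :
    cosInt (2 * π) s * cos (2 * π * s) + sinInt (2 * π) s * sin (2 * π * s) = cosInt (2 * π) s := by
  have h : (2 * π : ℝ) ≠ 0 := by positivity
  apply mul_left_cancel₀ h
  linear_combination (cos (2 * π * s) - 1) * two_pi_mul_cosInt s +
    sin (2 * π * s) * two_pi_mul_sinInt s

theorem cosInt_mul_sin_sub (s : ℝ) :
    cosInt (2 * π) s * sin (2 * π * s) - sinInt (2 * π) s * cos (2 * π * s) = sinInt (2 * π) s := by
  linear_combination sin_mul_cosInt_sub (2 * π) s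

theorem hasDerivAt_sq_add_sq (s : ℝ) :
    HasDerivAt (fun s => cosInt (2 * π) s ^ 2 + sinInt (2 * π) s ^ 2) (2 * cosInt (2 * π) s) s := by
  refine (((hasDerivAt_cosInt _ s).pow 2).add ((hasDerivAt_sinInt _ s).pow 2)).congr_deriv ?_
  have := cosInt_mul_cos_add s
  push_cast
  linear_combination 2 * this

theorem continuous_cosInt_two_pi : Continuous (cosInt (2 * π)) :=
  continuous_iff_continuousAt.2 fun r => (hasDerivAt_cosInt _ r).continuousAt

theorem continuous_sinInt_two_pi : Continuous (sinInt (2 * π)) :=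
  continuous_iff_continuousAt.2 fun r => (hasDerivAt_sinInt _ r).continuousAt

theorem hasDerivAt_cosInt_two_pi (s : ℝ) :
    HasDerivAt (cosInt (2 * π)) (1 - 2 * π * sinInt (2 * π) s) s := by
  have h := two_pi_mul_sinInt s
  exact (hasDerivAt_cosInt _ s).congr_deriv (by linarith)

theorem hasDerivAt_sinInt_two_pi (s : ℝ) :
    HasDerivAt (sinInt (2 * π)) (2 * π * cosInt (2 * π) s) s := by
  have h := two_pi_mul_cosInt s
  exact (hasDerivAt_sinInt _ s).congr_deriv (by linarith)

theorem sq_add_sq_eq (s : ℝ) :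
    π * (cosInt (2 * π) s ^ 2 + sinInt (2 * π) s ^ 2) = sinInt (2 * π) s := by
  have h : (2 * π * (2 * π) : ℝ) ≠ 0 := by positivity
  apply mul_left_cancel₀ h
  linear_combination π * (2 * π * cosInt (2 * π) s + sin (2 * π * s)) * two_pi_mul_cosInt s +
    π * (2 * π * sinInt (2 * π) s + (1 - cos (2 * π * s)) - 2) * two_pi_mul_sinInt s +
    π * sin_sq_add_cos_sq (2 * π * s)

theorem integral_cosInt_mul_sinInt :
    ∫ s in (0 : ℝ)..1, cosInt (2 * π) s * sinInt (2 * π) s = 0 := by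
  have hp : (π : ℝ) ≠ 0 := pi_ne_zero
  have h : ∀ s ∈ Set.uIcc (0 : ℝ) 1, HasDerivAt (fun s => (4 * π)⁻¹ * sinInt (2 * π) s ^ 2)
      (cosInt (2 * π) s * sinInt (2 * π) s) s := fun s _ => by
    refine (((hasDerivAt_sinInt_two_pi s).pow 2).const_mul _).congr_deriv ?_
    push_cast
    field_simp
    ring
  rw [intervalIntegral.integral_eq_sub_of_hasDerivAt h
    ((continuous_cosInt_two_pi.mul continuous_sinInt_two_pi).intervalIntegrable _ _),
    sinInt_two_pi_one, sinInt_at_zero]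
  ring

/-- With σ = `cosInt (2 * π)` and τ = `sinInt (2 * π)`, the relation π(σ² + τ²) = τ makes -στ/π a
primitive of the integrand, and it vanishes at both ends of the period. -/
theorem integral_sinInt_sq_sub :
    ∫ s in (0 : ℝ)..1, (sinInt (2 * π) s ^ 2 - 3 * cosInt (2 * π) s ^ 2) = 0 := by
  have hp : (π : ℝ) ≠ 0 := pi_ne_zero
  have h : ∀ s ∈ Set.uIcc (0 : ℝ) 1, HasDerivAt
      (fun s => -(π⁻¹ * (cosInt (2 * π) s * sinInt (2 * π) s)))
      (sinInt (2 * π) s ^ 2 - 3 * cosInt (2 * π) s ^ 2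
        + (cosInt (2 * π) s ^ 2 + sinInt (2 * π) s ^ 2 - π⁻¹ * sinInt (2 * π) s)) s := fun s _ => by
    refine ((((hasDerivAt_cosInt_two_pi s).mul (hasDerivAt_sinInt_two_pi s)).const_mul _).neg).congr_deriv ?_
    field_simp
    ring
  have h' : ∀ s ∈ Set.uIcc (0 : ℝ) 1, HasDerivAt
      (fun s => -(π⁻¹ * (cosInt (2 * π) s * sinInt (2 * π) s)))
      (sinInt (2 * π) s ^ 2 - 3 * cosInt (2 * π) s ^ 2) s := fun s hs => by
    have e := (inv_mul_eq_iff_eq_mul₀ hp).2 (sq_add_sq_eq s).symm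
    exact (h s hs).congr_deriv (by rw [e]; ring)
  rw [intervalIntegral.integral_eq_sub_of_hasDerivAt h' (Continuous.intervalIntegrable
    ((continuous_sinInt_two_pi.pow 2).sub ((continuous_cosInt_two_pi.pow 2).const_mul 3)) _ _),
    cosInt_two_pi_one, cosInt_at_zero]
  ring

end FullPeriod

/-! ### Relations between the first variations over a full period. -/

namespace RescaledFrame

open Set Function Real

variable {n : ℕ} (Fr : RescaledFrame n) {i : Fin n} {w : ℝ}

theorem rot_ex_oddIdx (i : Fin n) (k : Fin (2 * n)) :
    rot k (ex (oddIdx i)) = if k = evenIdx i then -1 else 0 := by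
  revert k
  refine idx_cases (fun j => ?_) fun j => ?_
  · rw [rot_oddIdx, xc_ex]; simp
  · rw [rot_evenIdx, xc_ex]; by_cases h : i = j <;> simp [h, eq_comm]

theorem rot_ex_evenIdx (i : Fin n) (k : Fin (2 * n)) :
    rot k (ex (evenIdx i)) = if k = oddIdx i then 1 else 0 := by
  revert k
  refine idx_cases (fun j => ?_) fun j => ?_
  · rw [rot_oddIdx, xc_ex]; by_cases h : i = j <;> simp [h, eq_comm]
  · rw [rot_evenIdx, xc_ex]; simp

variable (hw : w * Fr.b i = 2 * π)
include hw

theorem sum_linU_odd (s : ℝ) (a : Fin (2 * n) → ℝ) :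
    ∑ k, Fr.linU w s k (ex (oddIdx i)) * a k =
      cos (2 * π * s) * a (oddIdx i) - sin (2 * π * s) * a (evenIdx i) := by
  rw [sum_pairs, Finset.sum_eq_single i]
  · simp only [linU_apply, rot_ex_oddIdx, xc_ex, bIdx_oddIdx, bIdx_evenIdx, hw]
    simp
    ring
  · intro j _ hj
    simp only [linU_apply, rot_ex_oddIdx, xc_ex]
    simp [hj]
  · simp

theorem sum_linU_even (s : ℝ) (a : Fin (2 * n) → ℝ) :
    ∑ k, Fr.linU w s k (ex (evenIdx i)) * a k =
      sin (2 * π * s) * a (oddIdx i) + cos (2 * π * s) * a (evenIdx i) := by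
  rw [sum_pairs, Finset.sum_eq_single i]
  · simp only [linU_apply, rot_ex_evenIdx, xc_ex, bIdx_oddIdx, bIdx_evenIdx, hw]
    simp
  · intro j _ hj
    simp only [linU_apply, rot_ex_evenIdx, xc_ex]
    simp [hj]
  · simp

theorem linX_odd (s : ℝ) : Fr.linX w s (ex (oddIdx i)) =
    cosInt (2 * π) s • ex (oddIdx i) + (-sinInt (2 * π) s) • ex (evenIdx i) := by
  rw [linX_apply, hvec, sum_pairs, Finset.sum_eq_single i]
  · simp only [rot_ex_oddIdx, xc_ex, bIdx_oddIdx, bIdx_evenIdx, hw]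
    simp
  · intro j _ hj
    simp only [rot_ex_oddIdx, xc_ex]
    simp [hj]
  · simp

theorem linX_even (s : ℝ) : Fr.linX w s (ex (evenIdx i)) =
    sinInt (2 * π) s • ex (oddIdx i) + cosInt (2 * π) s • ex (evenIdx i) := by
  rw [linX_apply, hvec, sum_pairs, Finset.sum_eq_single i]
  · simp only [rot_ex_evenIdx, xc_ex, bIdx_oddIdx, bIdx_evenIdx, hw]
    simp
  · intro j _ hj
    simp only [rot_ex_evenIdx, xc_ex]
    simp [hj]
  · simp

theorem varIntegrand_odd (u v : Model n) (s : ℝ) : Fr.varIntegrand w (oddIdx i) u v s =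
    -cosInt (2 * π) s * Fr.force₂ w u v s (oddIdx i)
      + sinInt (2 * π) s * Fr.force₂ w u v s (evenIdx i) := by
  rw [varIntegrand, bIdx_oddIdx, hw, cosInt_two_pi_reverse, sinInt_two_pi_reverse, rot_oddIdx,
    xc_hvec]

theorem varIntegrand_even (u v : Model n) (s : ℝ) : Fr.varIntegrand w (evenIdx i) u v s =
    -cosInt (2 * π) s * Fr.force₂ w u v s (evenIdx i)
      - sinInt (2 * π) s * Fr.force₂ w u v s (oddIdx i) := by
  rw [varIntegrand, bIdx_evenIdx, hw, cosInt_two_pi_reverse, sinInt_two_pi_reverse, rot_evenIdx,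
    xc_hvec]
  ring

theorem force₂_odd_left (v : Model n) (s : ℝ) (j : Fin (2 * n)) :
    Fr.force₂ w (ex (oddIdx i)) v s j = w * (cos (2 * π * s) * Fr.curl j (oddIdx i) (Fr.linX w s v)
      - sin (2 * π * s) * Fr.curl j (evenIdx i) (Fr.linX w s v)) := by
  rw [force₂, Fr.sum_linU_odd hw]; ring

theorem force₂_even_left (v : Model n) (s : ℝ) (j : Fin (2 * n)) :
    Fr.force₂ w (ex (evenIdx i)) v s j = w * (sin (2 * π * s) * Fr.curl j (oddIdx i) (Fr.linX w s v)
      + cos (2 * π * s) * Fr.curl j (evenIdx i) (Fr.linX w s v)) := by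
  rw [force₂, Fr.sum_linU_even hw]; ring

/-- By antisymmetry only the curl component inside the pair survives, and its trigonometric
coefficient collapses to a single primitive; the next three lemmas work alike. -/
theorem varIntegrand_odd_odd (v : Model n) (s : ℝ) :
    Fr.varIntegrand w (oddIdx i) (ex (oddIdx i)) v s =
      w * sinInt (2 * π) s * Fr.curl (oddIdx i) (evenIdx i) (Fr.linX w s v) := by
  rw [Fr.varIntegrand_odd hw, Fr.force₂_odd_left hw, Fr.force₂_odd_left hw, curl_self, curl_self,
    Fr.curl_swap (oddIdx i) (evenIdx i)]
  linear_combination w * Fr.curl (oddIdx i) (evenIdx i) (Fr.linX w s v) * cosInt_mul_sin_sub s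

theorem varIntegrand_odd_even (v : Model n) (s : ℝ) :
    Fr.varIntegrand w (oddIdx i) (ex (evenIdx i)) v s =
      -(w * cosInt (2 * π) s * Fr.curl (oddIdx i) (evenIdx i) (Fr.linX w s v)) := by
  rw [Fr.varIntegrand_odd hw, Fr.force₂_even_left hw, Fr.force₂_even_left hw, curl_self, curl_self,
    Fr.curl_swap (oddIdx i) (evenIdx i)]
  linear_combination -w * Fr.curl (oddIdx i) (evenIdx i) (Fr.linX w s v) * cosInt_mul_cos_add s

theorem varIntegrand_even_odd (v : Model n) (s : ℝ) :
    Fr.varIntegrand w (evenIdx i) (ex (oddIdx i)) v s =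
      w * cosInt (2 * π) s * Fr.curl (oddIdx i) (evenIdx i) (Fr.linX w s v) := by
  rw [Fr.varIntegrand_even hw, Fr.force₂_odd_left hw, Fr.force₂_odd_left hw, curl_self, curl_self,
    Fr.curl_swap (oddIdx i) (evenIdx i)]
  linear_combination w * Fr.curl (oddIdx i) (evenIdx i) (Fr.linX w s v) * cosInt_mul_cos_add s

theorem varIntegrand_even_even (v : Model n) (s : ℝ) :
    Fr.varIntegrand w (evenIdx i) (ex (evenIdx i)) v s =
      w * sinInt (2 * π) s * Fr.curl (oddIdx i) (evenIdx i) (Fr.linX w s v) := by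
  rw [Fr.varIntegrand_even hw, Fr.force₂_even_left hw, Fr.force₂_even_left hw, curl_self, curl_self,
    Fr.curl_swap (oddIdx i) (evenIdx i)]
  linear_combination w * Fr.curl (oddIdx i) (evenIdx i) (Fr.linX w s v) * cosInt_mul_sin_sub s

/-- Closedness of the two-form trades the sum over directions of motion for the curl inside the
pair, evaluated at the velocity. -/
theorem varIntegrand_right (v : Model n) (s : ℝ) :
    Fr.varIntegrand w (evenIdx i) v (ex (oddIdx i)) s
      - Fr.varIntegrand w (oddIdx i) v (ex (evenIdx i)) s =
      w * (cosInt (2 * π) s ^ 2 + sinInt (2 * π) s ^ 2) *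
        Fr.curl (oddIdx i) (evenIdx i) (hvec fun k => Fr.linU w s k v) := by
  rw [Fr.varIntegrand_even hw, Fr.varIntegrand_odd hw]
  simp only [force₂, Fr.linX_odd hw, Fr.linX_even hw, curl_add, curl_smul, hvec, curl_sum,
    Finset.mul_sum]
  rw [← Finset.sum_sub_distrib, ← Finset.sum_add_distrib, ← Finset.sum_sub_distrib]
  refine Finset.sum_congr rfl fun k _ => ?_
  rw [← Fr.curl_cyclic (oddIdx i) (evenIdx i) k]
  ring

/-- The difference of the integrands is the derivative of w(σ² + τ²) times the curl of the pair at
the position issued from `v`, where σ and τ are the two primitives; both vanish at the two ends of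
the period. With `v` in the pair this gives the mixed coefficients of κ, and with `v` outside it
gives γ₁₂ = γ₂₁. -/
theorem varForm_exchange (v : Model n) :
    Fr.varForm w (evenIdx i) (ex (oddIdx i)) v + Fr.varForm w (evenIdx i) v (ex (oddIdx i)) =
      Fr.varForm w (oddIdx i) (ex (evenIdx i)) v + Fr.varForm w (oddIdx i) v (ex (evenIdx i)) := by
  rw [← sub_eq_zero]
  simp only [varForm_apply, firstVar₂]
  have hI : ∀ (k : Fin (2 * n)) u v, IntervalIntegrable (Fr.varIntegrand w k u v)
      MeasureTheory.volume 0 1 := fun k u v => (Fr.continuous_varIntegrand w k u v).intervalIntegrable _ _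
  rw [← intervalIntegral.integral_add (hI _ _ _) (hI _ _ _),
    ← intervalIntegral.integral_add (hI _ _ _) (hI _ _ _),
    ← intervalIntegral.integral_sub ((hI _ _ _).add (hI _ _ _)) ((hI _ _ _).add (hI _ _ _))]
  have hd : ∀ s ∈ Set.uIcc (0 : ℝ) 1, HasDerivAt
      (fun s => w * ((cosInt (2 * π) s ^ 2 + sinInt (2 * π) s ^ 2) *
        Fr.curl (oddIdx i) (evenIdx i) (Fr.linX w s v)))
      (Fr.varIntegrand w (evenIdx i) (ex (oddIdx i)) v s
        + Fr.varIntegrand w (evenIdx i) v (ex (oddIdx i)) s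
        - (Fr.varIntegrand w (oddIdx i) (ex (evenIdx i)) v s
          + Fr.varIntegrand w (oddIdx i) v (ex (evenIdx i)) s)) s := fun s _ => by
    have hc : HasDerivAt (fun s => Fr.curl (oddIdx i) (evenIdx i) (Fr.linX w s v))
        (Fr.curl (oddIdx i) (evenIdx i) (hvec fun k => Fr.linU w s k v)) s := by
      let L : Model n →ₗ[ℝ] ℝ :=
        { toFun := Fr.curl (oddIdx i) (evenIdx i)
          map_add' := Fr.curl_add _ _
          map_smul' := Fr.curl_smul _ _ }
      have := (LinearMap.toContinuousLinearMap L).hasFDerivAt.comp_hasDerivAt s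
        (Fr.hasDerivAt_linX w s v)
      exact this
    refine (((hasDerivAt_sq_add_sq s).mul hc).const_mul w).congr_deriv ?_
    rw [Fr.varIntegrand_even_odd hw, Fr.varIntegrand_odd_even hw]
    linear_combination -Fr.varIntegrand_right hw v s
  rw [intervalIntegral.integral_eq_sub_of_hasDerivAt hd
    (((hI _ _ _).add (hI _ _ _)).sub ((hI _ _ _).add (hI _ _ _))), cosInt_two_pi_one,
    sinInt_two_pi_one, cosInt_at_zero, sinInt_at_zero]
  ring

/-- The difference of the integrands is a combination of στ and τ² - 3σ², both of zero integral over
the period. -/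
theorem varForm_odd_diag : Fr.varForm w (oddIdx i) (ex (oddIdx i)) (ex (oddIdx i)) =
    3 * Fr.varForm w (oddIdx i) (ex (evenIdx i)) (ex (evenIdx i)) := by
  rw [← sub_eq_zero]
  simp only [varForm_apply, firstVar₂]
  rw [← intervalIntegral.integral_const_mul, ← intervalIntegral.integral_sub
    ((Fr.continuous_varIntegrand ..).intervalIntegrable _ _)
    (((Fr.continuous_varIntegrand ..).const_mul 3).intervalIntegrable _ _)]
  have h : ∀ s, Fr.varIntegrand w (oddIdx i) (ex (oddIdx i)) (ex (oddIdx i)) s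
      - 3 * Fr.varIntegrand w (oddIdx i) (ex (evenIdx i)) (ex (evenIdx i)) s =
      (4 * w * Fr.curl (oddIdx i) (evenIdx i) (ex (oddIdx i))) *
        (cosInt (2 * π) s * sinInt (2 * π) s) -
      (w * Fr.curl (oddIdx i) (evenIdx i) (ex (evenIdx i))) *
        (sinInt (2 * π) s ^ 2 - 3 * cosInt (2 * π) s ^ 2) := fun s => by
    rw [Fr.varIntegrand_odd_odd hw, Fr.varIntegrand_odd_even hw, Fr.linX_odd hw, Fr.linX_even hw]
    simp only [curl_add, curl_smul]
    ring
  simp only [h]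
  rw [intervalIntegral.integral_sub, intervalIntegral.integral_const_mul,
    intervalIntegral.integral_const_mul, integral_cosInt_mul_sinInt, integral_sinInt_sq_sub]
  · ring
  · exact ((continuous_cosInt_two_pi.mul continuous_sinInt_two_pi).const_mul _).intervalIntegrable _ _
  · exact (((continuous_sinInt_two_pi.pow 2).sub
      ((continuous_cosInt_two_pi.pow 2).const_mul 3)).const_mul _).intervalIntegrable _ _

theorem varForm_even_diag : Fr.varForm w (evenIdx i) (ex (evenIdx i)) (ex (evenIdx i)) =
    3 * Fr.varForm w (evenIdx i) (ex (oddIdx i)) (ex (oddIdx i)) := by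
  rw [← sub_eq_zero]
  simp only [varForm_apply, firstVar₂]
  rw [← intervalIntegral.integral_const_mul, ← intervalIntegral.integral_sub
    ((Fr.continuous_varIntegrand ..).intervalIntegrable _ _)
    (((Fr.continuous_varIntegrand ..).const_mul 3).intervalIntegrable _ _)]
  have h : ∀ s, Fr.varIntegrand w (evenIdx i) (ex (evenIdx i)) (ex (evenIdx i)) s
      - 3 * Fr.varIntegrand w (evenIdx i) (ex (oddIdx i)) (ex (oddIdx i)) s =
      (4 * w * Fr.curl (oddIdx i) (evenIdx i) (ex (evenIdx i))) *
        (cosInt (2 * π) s * sinInt (2 * π) s) +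
      (w * Fr.curl (oddIdx i) (evenIdx i) (ex (oddIdx i))) *
        (sinInt (2 * π) s ^ 2 - 3 * cosInt (2 * π) s ^ 2) := fun s => by
    rw [Fr.varIntegrand_even_odd hw, Fr.varIntegrand_even_even hw, Fr.linX_odd hw, Fr.linX_even hw]
    simp only [curl_add, curl_smul]
    ring
  simp only [h]
  rw [intervalIntegral.integral_add, intervalIntegral.integral_const_mul,
    intervalIntegral.integral_const_mul, integral_cosInt_mul_sinInt, integral_sinInt_sq_sub]
  · ring
  · exact ((continuous_cosInt_two_pi.mul continuous_sinInt_two_pi).const_mul _).intervalIntegrable _ _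
  · exact (((continuous_sinInt_two_pi.pow 2).sub
      ((continuous_cosInt_two_pi.pow 2).const_mul 3)).const_mul _).intervalIntegrable _ _

end RescaledFrame

/-! ### Trigonometric inequalities. -/

section TrigPositivity

open Real

theorem mul_cos_lt_sin {φ : ℝ} (h0 : 0 < φ) (h1 : φ < π) : φ * cos φ < sin φ := by
  rcases lt_or_ge φ (π / 2) with h | h
  · have hc : 0 < cos φ := cos_pos_of_mem_Ioo ⟨by linarith [pi_pos], h⟩
    have := lt_tan h0 h
    rwa [tan_eq_sin_div_cos, lt_div_iff₀ hc] at this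
  · have hc : cos φ ≤ 0 := cos_nonpos_of_pi_div_two_le_of_le h (by linarith)
    have := mul_nonpos_of_nonneg_of_nonpos h0.le hc
    exact this.trans_lt (sin_pos_of_pos_of_lt_pi h0 h1)

/-- In terms of φ = θ/2 the expression is 4 sin φ (sin φ - φ cos φ). -/
theorem mul_sin_lt_two_mul_one_sub_cos {θ : ℝ} (h0 : 0 < θ) (h1 : θ < 2 * π) :
    0 < 2 * (1 - cos θ) - θ * sin θ := by
  obtain ⟨φ, rfl⟩ : ∃ φ, θ = 2 * φ := ⟨θ / 2, by ring⟩
  have h2 : 0 < φ := by linarith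
  have h3 : φ < π := by linarith
  have h4 := mul_pos (sin_pos_of_pos_of_lt_pi h2 h3) (sub_pos.2 (mul_cos_lt_sin h2 h3))
  rw [cos_two_mul, sin_two_mul]
  nlinarith [sin_sq_add_cos_sq φ]

theorem cos_lt_one_of_pos_of_lt_two_pi {θ : ℝ} (h0 : 0 < θ) (h1 : θ < 2 * π) : cos θ < 1 := by
  refine lt_of_le_of_ne (cos_le_one θ) fun h => ?_
  have := (cos_eq_one_iff_of_lt_of_lt (by linarith) h1).1 h
  exact h0.ne' this

theorem areaInt_one_zero_asymptotics : HasDerivAt (fun θ => areaInt θ 1) (1 / 12) 0 := by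
  rw [hasDerivAt_iff_isLittleO]
  have h : ∀ᶠ θ in 𝓝 (0 : ℝ), |θ| ≤ 1 := by
    filter_upwards [Metric.ball_mem_nhds (0 : ℝ) one_pos] with θ hθ
    have := mem_ball_zero_iff.1 hθ
    rw [norm_eq_abs] at this
    exact this.le
  have hO : (fun θ : ℝ => areaInt θ 1 - areaInt 0 1 - (θ - 0) • (1 / 12 : ℝ)) =O[𝓝 0]
      fun θ => θ ^ 2 := by
    refine Asymptotics.IsBigO.of_bound 1 (h.mono fun θ hθ => ?_)
    rw [areaInt_zero, sub_zero, sub_zero, smul_eq_mul, one_mul, norm_eq_abs, norm_eq_abs]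
    rcases eq_or_ne θ 0 with rfl | h0
    · simp [areaInt_zero]
    have h1 := mul_areaInt θ 1
    rw [mul_one] at h1
    have h2 := sin_bound hθ
    have hp : 0 < |θ| := abs_pos.2 h0
    have h3 : 2 * θ ^ 2 * (areaInt θ 1 - θ * (1 / 12)) = -(sin θ - (θ - θ ^ 3 / 6)) := by
      rw [mul_sub, h1]; ring
    have h4 : 2 * |θ| ^ 2 * |areaInt θ 1 - θ * (1 / 12)| ≤ |θ| ^ 5 / 100 := by
      rw [← abs_neg, ← h3, abs_mul, abs_mul, abs_pow, abs_two] at h2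
      exact h2
    have h5 : |θ| ^ 5 ≤ |θ| ^ 4 := pow_le_pow_of_le_one hp.le hθ (by norm_num)
    rw [abs_pow]
    have hp2 : 0 < |θ| ^ 2 := by positivity
    nlinarith
  refine hO.trans_isLittleO ?_
  simp only [sub_zero]
  exact Asymptotics.isLittleO_pow_id one_lt_two

end TrigPositivity

/-! ### The derivative of the nilpotent exponential. -/

section NilpotentDerivative

open Real

variable {n : ℕ} {b : Fin n → ℝ} {c : Model n} {G : Model n → Model n} {D : Model n →L[ℝ] Model n}

theorem bIdx_pos (hb : ∀ i, 0 < b i) (k : Fin (2 * n)) : 0 < bIdx b k := hb _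

theorem xc_nilY (b : Fin n → ℝ) (c : Model n) (s : ℝ) (k : Fin (2 * n)) :
    xc k (nilY b c s) = nilX b c s k := by
  rw [nilY, map_add, map_smul, xc_ez, xc_hvec, smul_zero, add_zero]

theorem zc_nilY (b : Fin n → ℝ) (c : Model n) (s : ℝ) :
    zc (nilY b c s) = ∑ k, bIdx b k * areaInt (zc c * bIdx b k) s * xc k c ^ 2 := by
  rw [nilY, map_add, map_smul, zc_ez, zc_hvec, smul_eq_mul, mul_one, zero_add]

theorem mul_xc_nilY (b : Fin n → ℝ) (c : Model n) (k : Fin (2 * n)) :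
    bIdx b k * zc c * xc k (nilY b c 1) =
      sin (zc c * bIdx b k) * xc k c + (1 - cos (zc c * bIdx b k)) * rot k c := by
  have h1 := mul_cosInt (zc c * bIdx b k) 1
  have h2 := mul_sinInt (zc c * bIdx b k) 1
  rw [mul_one] at h1 h2
  rw [xc_nilY, nilX]
  linear_combination xc k c * h1 + rot k c * h2

theorem mul_zc_nilY (hb : ∀ i, 0 < b i) (c : Model n) :
    2 * zc c ^ 2 * zc (nilY b c 1) =
      ∑ k, (bIdx b k)⁻¹ * (zc c * bIdx b k - sin (zc c * bIdx b k)) * xc k c ^ 2 := by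
  rw [zc_nilY, Finset.mul_sum]
  refine Finset.sum_congr rfl fun k _ => ?_
  have h1 := mul_areaInt (zc c * bIdx b k) 1
  have hk := (bIdx_pos hb k).ne'
  rw [mul_one] at h1
  rw [← h1]
  field_simp

section Rows

variable (hD : HasFDerivAt G D c) (hG : ∀ᶠ c' in 𝓝 c, G c' = nilY b c' 1)
include hD hG

omit hD in
theorem eventually_line (v : Model n) : ∀ᶠ t in 𝓝 (0 : ℝ), G (c + t • v) = nilY b (c + t • v) 1 := by
  have : Filter.Tendsto (fun t : ℝ => c + t • v) (𝓝 0) (𝓝 c) := by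
    have h : Continuous fun t : ℝ => c + t • v := by fun_prop
    simpa using h.tendsto 0
  exact this.eventually hG

omit hG in
theorem hasDerivAt_functional_line (L : Model n →L[ℝ] ℝ) (v : Model n) :
    HasDerivAt (fun t : ℝ => L (G (c + t • v))) (L (D v)) 0 := by
  have := (L.hasFDerivAt.comp c hD).hasLineDerivAt v
  exact this

omit hD hG in
theorem hasDerivAt_line (L : Model n →L[ℝ] ℝ) (v : Model n) :
    HasDerivAt (fun t : ℝ => L (c + t • v)) (L v) 0 := by
  have := (L.hasFDerivAt (x := c)).hasLineDerivAt v
  exact this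

/-- The endpoint formula is differentiated after clearing the denominator `bIdx b k * zc c`, so no
quotient rule is needed; `row_z` is obtained in the same way. -/
theorem row_x (k : Fin (2 * n)) (v : Model n) :
    bIdx b k * zc v * xc k (nilY b c 1) + bIdx b k * zc c * xc k (D v) =
      zc v * bIdx b k * cos (zc c * bIdx b k) * xc k c + sin (zc c * bIdx b k) * xc k v +
      (zc v * bIdx b k * sin (zc c * bIdx b k) * rot k c +
        (1 - cos (zc c * bIdx b k)) * rot k v) := by
  have hz := hasDerivAt_line (c := c) zc v
  have hx := hasDerivAt_line (c := c) (xc k) v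
  have hr := hasDerivAt_line (c := c) (rot k) v
  have h1 := (hz.const_mul (bIdx b k)).mul (hasDerivAt_functional_line hD (xc k) v)
  have hθ := hz.mul_const (bIdx b k)
  have h2 := (hθ.sin.mul hx).add ((hθ.cos.const_sub 1).mul hr)
  have := h1.unique (h2.congr_of_eventuallyEq ((eventually_line hG v).mono fun t ht => by
    have := mul_xc_nilY b (c + t • v) k
    rw [← ht] at this
    exact this))
  have hc : G c = nilY b c 1 := hG.self_of_nhds
  simp only [zero_smul, add_zero, hc] at this
  linear_combination this

theorem row_z (hb : ∀ i, 0 < b i) (v : Model n) :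
    4 * zc c * zc v * zc (nilY b c 1) + 2 * zc c ^ 2 * zc (D v) =
      ∑ k, (bIdx b k)⁻¹ * (zc v * bIdx b k * (1 - cos (zc c * bIdx b k)) * xc k c ^ 2 +
        (zc c * bIdx b k - sin (zc c * bIdx b k)) * (2 * xc k c * xc k v)) := by
  have hz := hasDerivAt_line (c := c) zc v
  have h1 := ((hz.pow 2).const_mul 2).mul (hasDerivAt_functional_line hD zc v)
  have h2 := HasDerivAt.fun_sum (u := Finset.univ) fun (k : Fin (2 * n)) _ =>
    ((((hz.mul_const (bIdx b k)).sub (hz.mul_const (bIdx b k)).sin).const_mul (bIdx b k)⁻¹).mul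
      ((hasDerivAt_line (c := c) (xc k) v).pow 2))
  have := h1.unique (h2.congr_of_eventuallyEq ((eventually_line hG v).mono fun t ht => by
    have := mul_zc_nilY hb (c + t • v)
    rw [← ht] at this
    exact this))
  have hc : G c = nilY b c 1 := hG.self_of_nhds
  simp only [zero_smul, add_zero, hc, Pi.pow_apply] at this
  push_cast at this
  calc _ = _ := by linear_combination this
    _ = _ := Finset.sum_congr rfl fun k _ => by simp only [Pi.sub_apply, zero_smul, add_zero]; ring

theorem row_x_of_zc_eq_zero (hc : zc c = 0) {v : Model n} (hv : zc v = 0) (k : Fin (2 * n)) :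
    xc k (D v) = xc k v := by
  refine (hasDerivAt_functional_line hD (xc k) v).unique
    ((hasDerivAt_line (c := c) (xc k) v).congr_of_eventuallyEq
      ((eventually_line hG v).mono fun t ht => ?_))
  have h0 : zc (c + t • v) = 0 := by rw [map_add, map_smul, hc, hv, smul_zero, add_zero]
  beta_reduce
  rw [ht, xc_nilY, nilX, h0, zero_mul, cosInt_zero, sinInt_zero]
  ring

theorem row_z_of_zc_eq_zero (hc : zc c = 0) (v : Model n) :
    zc (D v) = zc v / 12 * ∑ k, bIdx b k ^ 2 * xc k c ^ 2 := by
  have h2 := HasDerivAt.fun_sum (u := Finset.univ) fun (k : Fin (2 * n)) _ => by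
    have hz : HasDerivAt (fun t : ℝ => zc (c + t • v) * bIdx b k) (zc v * bIdx b k) 0 :=
      (hasDerivAt_line (c := c) zc v).mul_const (bIdx b k)
    have ha : HasDerivAt (fun t : ℝ => areaInt (zc (c + t • v) * bIdx b k) 1)
        (1 / 12 * (zc v * bIdx b k)) 0 := by
      have h0 : HasDerivAt (fun θ => areaInt θ 1) (1 / 12) (zc (c + (0 : ℝ) • v) * bIdx b k) := by
        rw [zero_smul, add_zero, hc, zero_mul]; exact areaInt_one_zero_asymptotics
      have := h0.comp 0 hz
      exact this
    exact (ha.const_mul (bIdx b k)).mul ((hasDerivAt_line (c := c) (xc k) v).pow 2)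
  have he := (hasDerivAt_functional_line hD zc v).unique
    (h2.congr_of_eventuallyEq ((eventually_line hG v).mono fun t ht => by
      have := zc_nilY b (c + t • v) 1
      rw [← ht] at this
      exact this))
  rw [he, Finset.mul_sum]
  refine Finset.sum_congr rfl fun k _ => ?_
  simp only [zero_smul, add_zero, hc, zero_mul, areaInt_zero, Pi.pow_apply]
  ring

/-- At zero vertical momentum the vertical row detects `zc v` through the positive coefficient Σ
b_k² c_k² / 12; once `zc v = 0`, the horizontal rows are the identity. -/
theorem injective_of_zc_eq_zero (hb : ∀ i, 0 < b i) (hc : zc c = 0) (h0 : ∃ k, xc k c ≠ 0) :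
    Function.Injective D := by
  refine (injective_iff_map_eq_zero D).2 fun v hv => ?_
  have hz := row_z_of_zc_eq_zero hD hG hc v
  rw [hv, map_zero] at hz
  have hpos : 0 < ∑ k, bIdx b k ^ 2 * xc k c ^ 2 := by
    obtain ⟨k, hk⟩ := h0
    have := bIdx_pos hb
    exact Finset.sum_pos' (fun _ _ => by positivity) ⟨k, Finset.mem_univ _, by
      have := this k; positivity⟩
  have hzv : zc v = 0 := by
    rcases mul_eq_zero.1 hz.symm with h | h
    · linarith
    · exact absurd h hpos.ne'
  refine model_ext (fun k => ?_) (by rw [hzv, map_zero])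
  rw [← row_x_of_zc_eq_zero hD hG hc hzv k, hv]

/-- On a kernel vector the two rows of a pair form a 2 × 2 system; solving it expresses the scalar
product of `v` with `c` in that pair through `zc v`. -/
theorem block_row_x (i : Fin n) {v : Model n} (hv1 : xc (oddIdx i) (D v) = 0)
    (hv2 : xc (evenIdx i) (D v) = 0) :
    2 * (1 - cos (zc c * b i)) * zc c * (xc (oddIdx i) c * xc (oddIdx i) v
        + xc (evenIdx i) c * xc (evenIdx i) v) * b i =
      zc v * (xc (oddIdx i) c ^ 2 + xc (evenIdx i) c ^ 2) *
        (2 * (1 - cos (zc c * b i)) - zc c * b i * sin (zc c * b i)) * b i := by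
  have h1 := row_x hD hG (oddIdx i) v
  have h2 := row_x hD hG (evenIdx i) v
  have h3 := mul_xc_nilY b c (oddIdx i)
  have h4 := mul_xc_nilY b c (evenIdx i)
  simp only [bIdx_oddIdx, bIdx_evenIdx, rot_oddIdx, rot_evenIdx, hv1, hv2] at h1 h2 h3 h4
  have h5 := sin_sq_add_cos_sq (zc c * b i)
  generalize xc (oddIdx i) (nilY b c 1) = X1 at *
  generalize xc (evenIdx i) (nilY b c 1) = X2 at *
  generalize xc (oddIdx i) c = p at *
  generalize xc (evenIdx i) c = q at *
  generalize xc (oddIdx i) v = x at *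
  generalize xc (evenIdx i) v = y at *
  generalize sin (zc c * b i) = S at *
  generalize cos (zc c * b i) = C at *
  generalize zc c = w at *
  generalize zc v = z at *
  generalize b i = β at *
  linear_combination (-w * β * (p * S + q * (1 - C))) * h1 + (-w * β * (q * S - p * (1 - C))) * h2 +
    β * z * (p * S + q * (1 - C)) * h3 + β * z * (q * S - p * (1 - C)) * h4 +
    (-w * β * (p * x + q * y) + z * β * (p ^ 2 + q ^ 2)
      + 0) * h5

end Rows

end NilpotentDerivative

section NilpotentDerivative

open Real

variable {n : ℕ} {b : Fin n → ℝ} {c : Model n} {G : Model n → Model n} {D : Model n →L[ℝ] Model n}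

variable (hD : HasFDerivAt G D c) (hG : ∀ᶠ c' in 𝓝 c, G c' = nilY b c' 1)
include hD hG

theorem block_eq_zero (i : Fin n) (hcos : cos (zc c * b i) < 1) {v : Model n} (hz : zc v = 0)
    (hv1 : xc (oddIdx i) (D v) = 0) (hv2 : xc (evenIdx i) (D v) = 0) :
    xc (oddIdx i) v = 0 ∧ xc (evenIdx i) v = 0 := by
  have h1 := row_x hD hG (oddIdx i) v
  have h2 := row_x hD hG (evenIdx i) v
  simp only [bIdx_oddIdx, bIdx_evenIdx, rot_oddIdx, rot_evenIdx, hv1, hv2, hz] at h1 h2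
  have h5 := sin_sq_add_cos_sq (zc c * b i)
  have h6 : 2 * (1 - cos (zc c * b i)) ≠ 0 := by
    have : 0 < 1 - cos (zc c * b i) := by linarith
    positivity
  constructor
  · apply mul_left_cancel₀ h6
    linear_combination -sin (zc c * b i) * h1 + (1 - cos (zc c * b i)) * h2
      - xc (oddIdx i) v * h5
  · apply mul_left_cancel₀ h6
    linear_combination -sin (zc c * b i) * h2 - (1 - cos (zc c * b i)) * h1
      - xc (evenIdx i) v * h5

/-- Substituting the scalar products from `block_row_x` into the vertical row of a kernel vector
leaves `zc v` times a sum of nonnegative terms, one of them positive. So `zc v = 0`, and each pair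
then vanishes because its determinant 2(1 - cos θ) is nonzero. -/
theorem injective_of_lt (hb : ∀ i, 0 < b i) (hc : 0 < zc c) (hlt : ∀ i, zc c * b i < 2 * π)
    (h0 : ∃ k, xc k c ≠ 0) : Function.Injective D := by
  refine (injective_iff_map_eq_zero D).2 fun v hv => ?_
  have hθ : ∀ i, 0 < zc c * b i := fun i => mul_pos hc (hb i)
  have hcos : ∀ i, cos (zc c * b i) < 1 := fun i => cos_lt_one_of_pos_of_lt_two_pi (hθ i) (hlt i)
  have hrow := row_z hD hG hb v
  have hzc := mul_zc_nilY hb c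
  rw [hv, map_zero, mul_zero, add_zero, sum_pairs] at hrow
  rw [sum_pairs] at hzc
  simp only [bIdx_oddIdx, bIdx_evenIdx] at hrow hzc
  let r : Fin n → ℝ := fun i => xc (oddIdx i) c ^ 2 + xc (evenIdx i) c ^ 2
  let p : Fin n → ℝ := fun i => (b i)⁻¹ * r i * (zc c * b i) *
    (2 * (1 - cos (zc c * b i)) - zc c * b i * sin (zc c * b i)) / (1 - cos (zc c * b i))
  have hblock : ∀ i, (b i)⁻¹ * (zc c * (zc v * b i * (1 - cos (zc c * b i)) * r i +
      2 * (zc c * b i - sin (zc c * b i)) *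
        (xc (oddIdx i) c * xc (oddIdx i) v + xc (evenIdx i) c * xc (evenIdx i) v))
      - 2 * zc v * (zc c * b i - sin (zc c * b i)) * r i) = zc v * p i := fun i => by
    have h1 := block_row_x hD hG i (v := v) (by rw [hv, map_zero]) (by rw [hv, map_zero])
    replace h1 := mul_right_cancel₀ (hb i).ne' h1
    have h5 := sin_sq_add_cos_sq (zc c * b i)
    have hC : 1 - cos (zc c * b i) ≠ 0 := by have := hcos i; intro h; linarith
    have hbi := (hb i).ne'
    simp only [p]
    rw [mul_div_assoc', eq_div_iff hC, mul_assoc, mul_assoc (b i)⁻¹, mul_assoc (b i)⁻¹,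
      mul_left_comm (zc v)]
    congr 1
    simp only [r]
    linear_combination (zc c * b i - sin (zc c * b i)) * h1 +
      zc v * (xc (oddIdx i) c ^ 2 + xc (evenIdx i) c ^ 2) * (zc c * b i) * h5
  -- The vertical coordinate of the endpoint is eliminated between the differentiated row and the
  -- original formula.
  have hsum : zc v * ∑ i, p i = 0 := by
    rw [Finset.mul_sum, ← Finset.sum_congr rfl fun i _ => hblock i]
    have e1 := congrArg (fun t => zc c * t) hrow
    have e2 := congrArg (fun t => 2 * zc v * t) hzc
    simp only [Finset.mul_sum] at e1 e2
    have e3 : (4 * zc c * zc v * zc (nilY b c 1)) * zc c - 2 * zc v * (2 * zc c ^ 2 * zc (nilY b c 1)) = 0 := by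
      ring
    rw [mul_comm, e1, e2, ← Finset.sum_sub_distrib] at e3
    rw [← e3]
    refine Finset.sum_congr rfl fun i _ => ?_
    simp only [r]
    ring
  have hp : ∀ i, 0 ≤ p i := fun i => by
    have h1 := mul_sin_lt_two_mul_one_sub_cos (hθ i) (hlt i)
    have h2 : 0 < 1 - cos (zc c * b i) := by linarith [hcos i]
    have h3 := hθ i
    have h4 := hb i
    have h5 : 0 ≤ r i := by positivity
    positivity
  have hpos : 0 < ∑ i, p i := by
    have : ∃ i, 0 < r i := by
      obtain ⟨k, hk⟩ := h0
      revert hk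
      revert k
      refine idx_cases (fun i hk => ⟨i, ?_⟩) fun i hk => ⟨i, ?_⟩ <;> positivity
    obtain ⟨i, hi⟩ := this
    refine Finset.sum_pos' (fun i _ => hp i) ⟨i, Finset.mem_univ _, ?_⟩
    have h1 := mul_sin_lt_two_mul_one_sub_cos (hθ i) (hlt i)
    have h2 : 0 < 1 - cos (zc c * b i) := by linarith [hcos i]
    have h3 := hθ i
    have h4 := hb i
    positivity
  have hzv : zc v = 0 := (mul_eq_zero.1 hsum).resolve_right hpos.ne'
  have hb' := fun i => block_eq_zero hD hG i (hcos i) hzv (by rw [hv, map_zero]) (by rw [hv, map_zero])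
  exact model_ext (idx_cases (fun i => by rw [(hb' i).1, map_zero]) fun i => by rw [(hb' i).2, map_zero])
    (by rw [hzv, map_zero])

/-- At its period the pair ends at the origin whatever the horizontal covector, so only the
variation of the vertical momentum moves its endpoint. -/
theorem xc_period (i : Fin n) (hw : zc c * b i = 2 * π) (hbi : 0 < b i) (v : Model n) :
    xc (oddIdx i) (D v) = zc v / zc c * xc (oddIdx i) c ∧
      xc (evenIdx i) (D v) = zc v / zc c * xc (evenIdx i) c := by
  have hz : zc c ≠ 0 := fun h => by
    rw [h, zero_mul] at hw
    have := pi_pos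
    linarith
  have h1 := row_x hD hG (oddIdx i) v
  have h2 := row_x hD hG (evenIdx i) v
  have h3 := mul_xc_nilY b c (oddIdx i)
  have h4 := mul_xc_nilY b c (evenIdx i)
  simp only [bIdx_oddIdx, bIdx_evenIdx, rot_oddIdx, rot_evenIdx, hw, sin_two_pi, cos_two_pi] at h1 h2 h3 h4
  have h5 : b i * zc c ≠ 0 := mul_ne_zero hbi.ne' hz
  constructor
  · field_simp
    apply mul_left_cancel₀ h5
    linear_combination zc c * h1 - zc v * h3
  · field_simp
    apply mul_left_cancel₀ h5
    linear_combination zc c * h2 - zc v * h4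

end NilpotentDerivative

/-! ### Uniform Taylor estimates and expansions of zeros near a compact set. -/

section UniformTaylor

open Metric Set

theorem IsCompact.exists_pos_forall_dist_lt {E : Type*} [PseudoMetricSpace E] {K : Set E}
    (hK : IsCompact K) {p : E → Prop} (h : ∀ x ∈ K, ∀ᶠ y in 𝓝 x, p y) :
    ∃ δ > 0, ∀ x ∈ K, ∀ y, dist y x < δ → p y := by
  obtain ⟨δ, hδ, hsub⟩ := hK.exists_thickening_subset_open (isOpen_interior (s := {y | p y}))
    fun x hx => mem_interior_iff_mem_nhds.2 (h x hx)
  refine ⟨δ, hδ, fun x hx y hy => ?_⟩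
  exact interior_subset (hsub (mem_thickening_iff.2 ⟨x, hx, hy⟩))

variable {E F : Type*} [NormedAddCommGroup E] [NormedSpace ℝ E] [NormedAddCommGroup F]
  [NormedSpace ℝ F]

/-- The derivative is Lipschitz near `x₀`, and the mean value inequality is applied on the ball
centred at `x` of radius `dist y x`. The base point `x` is left free so that a compact set can be
covered afterwards. -/
theorem exists_taylor_bound {f : E → F} {x₀ : E} (hf : ContDiffAt ℝ 2 f x₀) :
    ∃ C > 0, ∃ δ > 0, ∀ x, dist x x₀ < δ → ∀ y, dist y x < δ →
      ‖f y - f x - fderiv ℝ f x (y - x)‖ ≤ C * ‖y - x‖ ^ 2 := by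
  obtain ⟨L, t, ht, hL⟩ := (hf.fderiv_right (m := 1) (by norm_num)).exists_lipschitzOnWith
  have hd : ∀ᶠ x in 𝓝 x₀, DifferentiableAt ℝ f x :=
    (hf.eventually (by simp)).mono fun x hx => hx.differentiableAt (by simp)
  obtain ⟨δ, hδ, hball⟩ := Metric.mem_nhds_iff.1 (Filter.inter_mem ht hd)
  refine ⟨L + 1, by positivity, δ / 2, by positivity, fun x hx y hy => ?_⟩
  have hs : closedBall x (dist y x) ⊆ ball x₀ δ := fun z hz => by
    have h1 := mem_closedBall.1 hz
    have h2 := dist_triangle z x x₀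
    exact mem_ball.2 (by linarith)
  have hxs : x ∈ closedBall x (dist y x) := mem_closedBall_self dist_nonneg
  have hys : y ∈ closedBall x (dist y x) := mem_closedBall.2 le_rfl
  have := (convex_closedBall x (dist y x)).norm_image_sub_le_of_norm_hasFDerivWithin_le'
    (φ := fderiv ℝ f x) (C := (L + 1) * dist y x)
    (fun z hz => (hball (hs hz)).2.hasFDerivAt.hasFDerivWithinAt)
    (fun z hz => by
      have h := hL.dist_le_mul z (hball (hs hz)).1 x (hball (hs hxs)).1
      rw [dist_eq_norm] at h
      have h1 : dist z x ≤ dist y x := hz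
      have h0 : (0 : ℝ) ≤ L := L.2
      calc _ ≤ L * dist z x := h
        _ ≤ (L + 1) * dist y x := by
          have : 0 ≤ dist z x := dist_nonneg
          nlinarith) hxs hys
  rw [dist_eq_norm, mul_assoc, ← sq] at this
  exact this

theorem IsCompact.exists_uniform_taylor_bound {f : E → F} {K : Set E} (hK : IsCompact K)
    (hf : ∀ x ∈ K, ContDiffAt ℝ 2 f x) :
    ∃ C > 0, ∃ δ > 0, ∀ x ∈ K, ∀ y, dist y x < δ →
      ‖f y - f x - fderiv ℝ f x (y - x)‖ ≤ C * ‖y - x‖ ^ 2 := by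
  refine hK.induction_on (p := fun s => ∃ C > 0, ∃ δ > 0, ∀ x ∈ s, ∀ y, dist y x < δ →
      ‖f y - f x - fderiv ℝ f x (y - x)‖ ≤ C * ‖y - x‖ ^ 2) ⟨1, one_pos, 1, one_pos, by simp⟩ ?_ ?_ ?_
  · rintro s t hst ⟨C, hC, δ, hδ, h⟩
    exact ⟨C, hC, δ, hδ, fun x hx => h x (hst hx)⟩
  · rintro s t ⟨C, hC, δ, hδ, h⟩ ⟨C', hC', δ', hδ', h'⟩
    refine ⟨max C C', lt_max_of_lt_left hC, min δ δ', lt_min hδ hδ', ?_⟩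
    rintro x (hx | hx) y hy
    · exact (h x hx y (hy.trans_le (min_le_left _ _))).trans (by gcongr; exact le_max_left _ _)
    · exact (h' x hx y (hy.trans_le (min_le_right _ _))).trans (by gcongr; exact le_max_right _ _)
  · intro x₀ hx₀
    obtain ⟨C, hC, δ, hδ, h⟩ := exists_taylor_bound (hf x₀ hx₀)
    exact ⟨ball x₀ δ, mem_nhdsWithin_of_mem_nhds (ball_mem_nhds _ hδ), C, hC, δ, hδ,
      fun x hx => h x hx⟩

/-- Zeros, near a compact set on which `f` vanishes, along a line transverse to `f = 0`. -/
theorem IsCompact.exists_zero_expansion {f : E → ℝ} {K : Set E} (hK : IsCompact K)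
    (hf : ∀ x ∈ K, ContDiffAt ℝ 2 f x) (h0 : ∀ x ∈ K, f x = 0) {u v : E}
    (hu : ∀ x ∈ K, fderiv ℝ f x u ≠ 0) {ρ : ℝ} (hρ : 0 < ρ) :
    ∃ δ ∈ Ioo 0 ρ, ∃ C > 0, ∃ η₀ > 0, ∀ x ∈ K, ∀ η ∈ Ioo 0 η₀,
      (∃ s ∈ Icc (-δ) δ, f (x + (s • u + η • v)) = 0) ∧
      ∀ s ∈ Icc (-δ) δ, f (x + (s • u + η • v)) = 0 →
        |s + η * (fderiv ℝ f x v / fderiv ℝ f x u)| ≤ C * η ^ 2 ∧ |s| ≤ C * η := by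
  rcases K.eq_empty_or_nonempty with rfl | hne
  · exact ⟨ρ / 2, ⟨by positivity, by linarith⟩, 1, one_pos, 1, one_pos, by simp⟩
  obtain ⟨C, hC, δ₁, hδ₁, hT⟩ := hK.exists_uniform_taylor_bound hf
  obtain ⟨δ₂, hδ₂, hcont⟩ := hK.exists_pos_forall_dist_lt (p := fun y => ContinuousAt f y)
    fun x hx => ((hf x hx).eventually (by simp)).mono fun y hy => hy.continuousAt
  have hcu : ContinuousOn (fun x => fderiv ℝ f x) K := fun x hx =>
    ((hf x hx).fderiv_right (m := 1) (by norm_num)).continuousAt.continuousWithinAt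
  have hcu' : ∀ w, ContinuousOn (fun x => |fderiv ℝ f x w|) K := fun w =>
    (hcu.clm_apply continuousOn_const).abs
  obtain ⟨xa, hxa, ha⟩ := hK.exists_isMinOn hne (hcu' u)
  obtain ⟨xb, hxb, hb⟩ := hK.exists_isMaxOn hne (hcu' v)
  obtain ⟨A, hA, hAle⟩ : ∃ A > 0, ∀ x ∈ K, A ≤ |fderiv ℝ f x u| :=
    ⟨_, abs_pos.2 (hu xa hxa), fun x hx => ha hx⟩
  obtain ⟨B, hB, hBle⟩ : ∃ B ≥ 0, ∀ x ∈ K, |fderiv ℝ f x v| ≤ B :=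
    ⟨_, abs_nonneg _, fun x hx => hb hx⟩
  obtain ⟨N, hN, hNle⟩ : ∃ N > 0, ∀ s η : ℝ, ‖s • u + η • v‖ ≤ N * (|s| + |η|) := by
    refine ⟨‖u‖ + ‖v‖ + 1, by positivity, fun s η => (norm_add_le _ _).trans ?_⟩
    rw [norm_smul, norm_smul, Real.norm_eq_abs, Real.norm_eq_abs]
    nlinarith [norm_nonneg u, norm_nonneg v, abs_nonneg s, abs_nonneg η,
      mul_nonneg (norm_nonneg u) (abs_nonneg η), mul_nonneg (norm_nonneg v) (abs_nonneg s)]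
  have hC₁ : 0 < C * N ^ 2 := by positivity
  -- With the factor 16 the quadratic remainder at |s| = δ is at most Aδ/4, and the choice of `η₀`
  -- bounds the η-term by Aδ/2. The sum is below Aδ, so `f` has opposite signs at s = ±δ and the
  -- intermediate value theorem applies.
  obtain ⟨δ, ⟨hδ0, hδρ⟩, hδT, hδc, hδA⟩ : ∃ δ ∈ Ioo 0 ρ,
      N * (2 * δ) < δ₁ ∧ N * (2 * δ) < δ₂ ∧ 16 * (C * N ^ 2) * δ ≤ A := by
    have hev : ∀ᶠ δ in 𝓝[>] (0 : ℝ), δ ∈ Ioo 0 ρ ∧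
        N * (2 * δ) < δ₁ ∧ N * (2 * δ) < δ₂ ∧ 16 * (C * N ^ 2) * δ < A := by
      have key : ∀ k r : ℝ, 0 < r → ∀ᶠ δ in 𝓝[>] (0 : ℝ), k * δ < r := fun k r hr => by
        have hc : Continuous fun δ : ℝ => k * δ := by fun_prop
        exact ((hc.tendsto' 0 0 (mul_zero k)).mono_left nhdsWithin_le_nhds).eventually_lt_const hr
      filter_upwards [Ioo_mem_nhdsGT hρ, key (N * 2) δ₁ hδ₁, key (N * 2) δ₂ hδ₂,
        key (16 * (C * N ^ 2)) A hA] with δ h1 h2 h3 h4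
      exact ⟨h1, by linarith, by linarith, h4⟩
    obtain ⟨δ, h1, h2, h3, h4⟩ := hev.exists
    exact ⟨δ, h1, h2, h3, h4.le⟩
  obtain ⟨η₀, hη₀, hη₀δ, hη₀B⟩ : ∃ η₀ > 0, η₀ ≤ δ ∧ B * η₀ ≤ A * δ / 2 := by
    refine ⟨min δ (A * δ / (2 * (B + 1))), lt_min hδ0 (by positivity), min_le_left _ _, ?_⟩
    calc B * min δ (A * δ / (2 * (B + 1))) ≤ (B + 1) * (A * δ / (2 * (B + 1))) := by
          gcongr
          · linarith
          · exact min_le_right _ _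
      _ = A * δ / 2 := by field_simp
  have hest : ∀ x ∈ K, ∀ η ∈ Ioo 0 η₀, ∀ s ∈ Icc (-δ) δ,
      |f (x + (s • u + η • v)) - (s * fderiv ℝ f x u + η * fderiv ℝ f x v)| ≤
        C * N ^ 2 * (|s| + η) ^ 2 ∧ ContinuousAt f (x + (s • u + η • v)) := by
    intro x hx η hη s hs
    have hn := hNle s η
    rw [abs_of_pos hη.1] at hn
    have hs' : |s| ≤ δ := abs_le.2 hs
    have hn2 : N * (|s| + η) ≤ N * (2 * δ) := by gcongr; linarith [hη.2]
    have hdist : dist (x + (s • u + η • v)) x = ‖s • u + η • v‖ := by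
      rw [dist_eq_norm, add_sub_cancel_left]
    refine ⟨?_, hcont x hx _ (by rw [hdist]; linarith)⟩
    have h := hT x hx (x + (s • u + η • v)) (by rw [hdist]; linarith)
    rw [h0 x hx, sub_zero, add_sub_cancel_left, map_add, map_smul, map_smul, smul_eq_mul,
      smul_eq_mul, Real.norm_eq_abs] at h
    calc _ ≤ C * ‖s • u + η • v‖ ^ 2 := h
      _ ≤ C * (N * (|s| + η)) ^ 2 := by gcongr
      _ = _ := by ring
  have hM : 0 ≤ 2 * B / A + 1 := by positivity
  refine ⟨δ, ⟨hδ0, hδρ⟩, C * N ^ 2 * (2 * B / A + 1 + 1) ^ 2 / A + (2 * B / A + 1), by positivity, η₀,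
    hη₀, fun x hx η hη => ⟨?_, fun s hs hzero => ?_⟩⟩
  · have hcon : ContinuousOn (fun s : ℝ => f (x + (s • u + η • v))) (Icc (-δ) δ) := fun s hs =>
      ((hest x hx η hη s hs).2.comp (f := fun s : ℝ => x + (s • u + η • v))
        (by fun_prop)).continuousWithinAt
    have hside : ∀ s, |s| = δ → |f (x + (s • u + η • v)) - s * fderiv ℝ f x u| <
        |s * fderiv ℝ f x u| := fun s hs => by
      have h1 := (hest x hx η hη s (abs_le.1 hs.le)).1
      have h2 : |η * fderiv ℝ f x v| ≤ A * δ / 2 := by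
        rw [abs_mul, abs_of_pos hη.1]
        calc _ ≤ η₀ * B := by
              have := hBle x hx
              have := hη.2.le
              have := hη.1.le
              gcongr
          _ ≤ _ := by linarith
      have h3 : C * N ^ 2 * (|s| + η) ^ 2 ≤ A * δ / 4 := by
        rw [hs]
        calc _ ≤ C * N ^ 2 * (2 * δ) ^ 2 := by
              have := hη.1
              have : δ + η ≤ 2 * δ := by linarith [hη.2]
              gcongr
          _ = 16 * (C * N ^ 2) * δ * δ / 4 := by ring
          _ ≤ _ := by gcongr
      have h4 : A * δ ≤ |s * fderiv ℝ f x u| := by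
        rw [abs_mul, hs, mul_comm]
        have := hAle x hx
        gcongr
      have h5 := abs_add_le (f (x + (s • u + η • v)) - (s * fderiv ℝ f x u + η * fderiv ℝ f x v))
        (η * fderiv ℝ f x v)
      have h6 : f (x + (s • u + η • v)) - (s * fderiv ℝ f x u + η * fderiv ℝ f x v)
        + η * fderiv ℝ f x v = f (x + (s • u + η • v)) - s * fderiv ℝ f x u := by ring
      rw [h6] at h5
      have h7 : 0 < A * δ := by positivity
      linarith
    have hp := hside δ (abs_of_pos hδ0)
    have hm := hside (-δ) (by rw [abs_neg, abs_of_pos hδ0])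
    have hle : -δ ≤ δ := by linarith
    rcases lt_or_gt_of_ne (hu x hx) with hneg | hpos
    · have e1 : δ * fderiv ℝ f x u < 0 := mul_neg_of_pos_of_neg hδ0 hneg
      rw [abs_of_neg e1, abs_lt] at hp
      rw [abs_of_pos (by linarith : 0 < -δ * fderiv ℝ f x u), abs_lt] at hm
      have := intermediate_value_Icc' hle hcon
        (⟨by linarith [hp.2], by linarith [hm.1]⟩ : (0 : ℝ) ∈ Icc _ _)
      exact this
    · have e1 : 0 < δ * fderiv ℝ f x u := mul_pos hδ0 hpos
      rw [abs_of_pos e1, abs_lt] at hp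
      rw [abs_of_neg (by linarith : -δ * fderiv ℝ f x u < 0), abs_lt] at hm
      have := intermediate_value_Icc hle hcon
        (⟨by linarith [hm.2], by linarith [hp.1]⟩ : (0 : ℝ) ∈ Icc _ _)
      exact this
  · have h1 := (hest x hx η hη s hs).1
    rw [hzero, zero_sub, abs_neg] at h1
    have hs' : |s| ≤ δ := abs_le.2 hs
    have hA' := hAle x hx
    have h2 : |s| * A ≤ B * η + C * N ^ 2 * (|s| + η) ^ 2 := by
      have h3 := abs_sub_abs_le_abs_sub (s * fderiv ℝ f x u) (-(η * fderiv ℝ f x v))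
      rw [sub_neg_eq_add, abs_neg, abs_mul, abs_mul, abs_of_pos hη.1] at h3
      have h4 : |s| * A ≤ |s| * |fderiv ℝ f x u| := by gcongr
      have h5 : η * |fderiv ℝ f x v| ≤ η * B := by
        have := hη.1
        have := hBle x hx
        gcongr
      linarith
    -- On this range the quadratic remainder is a small multiple of |s| + η and is absorbed by A|s|:
    -- first |s| = O(η), and then the remainder is O(η²).
    have h3 : C * N ^ 2 * (|s| + η) ^ 2 ≤ A / 8 * (|s| + η) := by
      have h5 : |s| + η ≤ 2 * δ := by linarith [hη.2]
      have h6 : 0 ≤ |s| + η := add_nonneg (abs_nonneg _) hη.1.le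
      calc _ = C * N ^ 2 * (|s| + η) * (|s| + η) := by ring
        _ ≤ C * N ^ 2 * (2 * δ) * (|s| + η) := by gcongr
        _ ≤ _ := by gcongr; linarith
    have hsM : |s| ≤ (2 * B / A + 1) * η := by
      have h7 : (2 * B / A + 1) * η = (2 * B * η + A * η) / A := by field_simp
      rw [h7, le_div_iff₀ hA]
      nlinarith [hη.1, abs_nonneg s, mul_nonneg hB hη.1.le, mul_pos hA hη.1]
    have hfin : |s + η * (fderiv ℝ f x v / fderiv ℝ f x u)| ≤
        C * N ^ 2 * (2 * B / A + 1 + 1) ^ 2 / A * η ^ 2 := by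
      have e1 : s + η * (fderiv ℝ f x v / fderiv ℝ f x u) =
          (s * fderiv ℝ f x u + η * fderiv ℝ f x v) / fderiv ℝ f x u := by
        have := hu x hx
        field_simp
      rw [e1, abs_div, div_le_iff₀ (abs_pos.2 (hu x hx))]
      calc _ ≤ C * N ^ 2 * (|s| + η) ^ 2 := h1
        _ ≤ C * N ^ 2 * ((2 * B / A + 1) * η + η) ^ 2 := by
          have := hη.1
          gcongr
        _ = C * N ^ 2 * (2 * B / A + 1 + 1) ^ 2 / A * η ^ 2 * A := by field_simp
        _ ≤ _ := by gcongr
    constructor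
    · refine hfin.trans ?_
      have := sq_nonneg η
      nlinarith
    · refine hsM.trans ?_
      have := hη.1
      have h8 : 0 ≤ C * N ^ 2 * (2 * B / A + 1 + 1) ^ 2 / A := by positivity
      nlinarith

end UniformTaylor

/-! ### Bordered systems, a smooth substitute for the determinant. -/

section Bordered

variable {X E : Type*} [NormedAddCommGroup X] [NormedSpace ℝ X] [NormedAddCommGroup E]
  [NormedSpace ℝ E]

/-- The endomorphism `(v, t) ↦ (A v + t e, l v)` of `E × ℝ`. -/
noncomputable def bordered (A : E →L[ℝ] E) (e : E) (l : E →L[ℝ] ℝ) : E × ℝ →L[ℝ] E × ℝ :=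
  (A.comp (ContinuousLinearMap.fst ℝ E ℝ) + (ContinuousLinearMap.snd ℝ E ℝ).smulRight e).prod
    (l.comp (ContinuousLinearMap.fst ℝ E ℝ))

theorem bordered_apply (A : E →L[ℝ] E) (e : E) (l : E →L[ℝ] ℝ) (p : E × ℝ) :
    bordered A e l p = (A p.1 + p.2 • e, l p.1) := rfl

/-- The solution of `A v + t e = 0`, `l v = 1`. -/
noncomputable def borderedSol (A : E →L[ℝ] E) (e : E) (l : E →L[ℝ] ℝ) : E × ℝ :=
  (bordered A e l).inverse (0, 1)

variable [FiniteDimensional ℝ E]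

theorem exists_equiv_of_injective {A : E →L[ℝ] E} (h : Function.Injective A) :
    ∃ T : E ≃L[ℝ] E, (T : E →L[ℝ] E) = A :=
  ⟨(LinearEquiv.ofInjectiveEndo (A : E →ₗ[ℝ] E) h).toContinuousLinearEquiv, by ext v; rfl⟩

variable {A : E →L[ℝ] E} {e : E} {l : E →L[ℝ] ℝ}

theorem borderedSol_unique (h : Function.Injective (bordered A e l)) {p : E × ℝ}
    (h1 : A p.1 + p.2 • e = 0) (h2 : l p.1 = 1) : borderedSol A e l = p := by
  obtain ⟨T, hT⟩ := exists_equiv_of_injective h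
  have hp : T p = (0, 1) := by
    have : (T : E × ℝ →L[ℝ] E × ℝ) p = (0, 1) := by rw [hT, bordered_apply, h1, h2]
    exact this
  rw [borderedSol, ← hT, ContinuousLinearMap.inverse_equiv, ← hp]
  exact T.symm_apply_apply p

theorem borderedSol_spec (h : Function.Injective (bordered A e l)) :
    A (borderedSol A e l).1 + (borderedSol A e l).2 • e = 0 ∧ l (borderedSol A e l).1 = 1 := by
  obtain ⟨T, hT⟩ := exists_equiv_of_injective h
  have h1 : bordered A e l (borderedSol A e l) = (0, 1) := by
    rw [borderedSol, ← hT, ContinuousLinearMap.inverse_equiv]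
    exact T.apply_symm_apply (0, 1)
  rw [bordered_apply, Prod.mk.injEq] at h1
  exact h1

/-- If the scalar unknown vanishes, the solution is a nonzero kernel vector of `A`. Conversely,
invertibility of the bordered map forces `l ≠ 0` on nonzero kernel vectors, so such a vector can be
normalized to be the solution. -/
theorem borderedSol_snd_eq_zero_iff (h : Function.Injective (bordered A e l)) :
    (borderedSol A e l).2 = 0 ↔ ¬Function.Injective A := by
  obtain ⟨h1, h2⟩ := borderedSol_spec h
  constructor
  · intro h0 hinj
    rw [h0, zero_smul, add_zero] at h1
    have h3 := hinj (h1.trans (map_zero A).symm)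
    rw [h3, map_zero] at h2
    exact zero_ne_one h2
  · intro hA
    rw [injective_iff_map_eq_zero] at hA
    push Not at hA
    obtain ⟨v, hv, hv0⟩ := hA
    have hl : l v ≠ 0 := fun hl => by
      have : bordered A e l (v, 0) = bordered A e l 0 := by
        rw [map_zero, bordered_apply]; simp [hv, hl]
      exact hv0 (congrArg Prod.fst (h this))
    rw [borderedSol_unique h (p := ((l v)⁻¹ • v, 0)) (by simp [hv]) (by simp [hl])]

variable {A : X → E →L[ℝ] E} {e : X → E} {l : X → E →L[ℝ] ℝ} {x : X}

omit [FiniteDimensional ℝ E] in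
theorem contDiff_bordered {m : WithTop ℕ∞} (hA : ContDiff ℝ m A) (he : ContDiff ℝ m e)
    (hl : ContDiff ℝ m l) : ContDiff ℝ m fun x => bordered (A x) (e x) (l x) := by
  unfold bordered
  have h1 : ContDiff ℝ m fun x => (A x).comp (ContinuousLinearMap.fst ℝ E ℝ)
      + (ContinuousLinearMap.snd ℝ E ℝ).smulRight (e x) :=
    (hA.clm_comp contDiff_const).add (contDiff_const.smulRight he)
  have h2 : ContDiff ℝ m fun x => (l x).comp (ContinuousLinearMap.fst ℝ E ℝ) :=
    hl.clm_comp contDiff_const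
  have h3 : ContDiff ℝ m (ContinuousLinearMap.prodₗᵢ ℝ :
      (E × ℝ →L[ℝ] E) × (E × ℝ →L[ℝ] ℝ) ≃ₗᵢ[ℝ] (E × ℝ →L[ℝ] E × ℝ)) := LinearIsometryEquiv.contDiff _
  exact h3.comp (h1.prodMk h2)

theorem contDiffAt_borderedSol {m : WithTop ℕ∞} (hA : ContDiff ℝ m A) (he : ContDiff ℝ m e)
    (hl : ContDiff ℝ m l) (h : Function.Injective (bordered (A x) (e x) (l x))) :
    ContDiffAt ℝ m (fun x => borderedSol (A x) (e x) (l x)) x := by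
  obtain ⟨T, hT⟩ := exists_equiv_of_injective h
  have h1 : ContDiffAt ℝ m ContinuousLinearMap.inverse (bordered (A x) (e x) (l x)) := by
    rw [← hT]; exact contDiffAt_map_inverse T
  have h2 := h1.comp x (contDiff_bordered hA he hl).contDiffAt
  exact h2.clm_apply contDiffAt_const

/-- The derivative of the second component of `borderedSol` at a point where `A` is singular. -/
theorem fderiv_borderedSol_snd (hA : ContDiff ℝ 1 A) (he : ContDiff ℝ 1 e) (hl : ContDiff ℝ 1 l)
    (h : Function.Injective (bordered (A x) (e x) (l x))) {k : E} (hk : A x k = 0) (hlk : l x k = 1)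
    {L : E →L[ℝ] ℝ} (hL : ∀ v, L (A x v) = 0) (d : X) :
    L (fderiv ℝ A x d k) +
      fderiv ℝ (fun x => (borderedSol (A x) (e x) (l x)).2) x d * L (e x) = 0 := by
  have hs := (contDiffAt_borderedSol hA he hl h).differentiableAt one_ne_zero
  have hsx : borderedSol (A x) (e x) (l x) = (k, 0) :=
    borderedSol_unique h (by simp [hk]) hlk
  have h1 := hs.hasFDerivAt.fst
  have h2 := hs.hasFDerivAt.snd
  have h3 := ((hA.differentiable one_ne_zero) x).hasFDerivAt.clm_apply h1
  have h4 := h2.smul ((he.differentiable one_ne_zero) x).hasFDerivAt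
  -- Injectivity is an open condition, so the bordered equation holds identically near `x` and can
  -- be differentiated; `L` then annihilates the term with the derivative of the vector unknown.
  have hinj : ∀ᶠ y in 𝓝 x, Function.Injective (bordered (A y) (e y) (l y)) :=
    (contDiff_bordered hA he hl).continuous.continuousAt.eventually
      (ContinuousLinearMap.isOpen_injective.mem_nhds h)
  have h5 : HasFDerivAt (fun _ : X => (0 : E)) _ x :=
    (h3.add h4).congr_of_eventuallyEq (hinj.mono fun y hy => (borderedSol_spec hy).1.symm)
  have h6 := congrArg (fun T : X →L[ℝ] E => L (T d)) (h5.unique (hasFDerivAt_const 0 x))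
  rw [h2.fderiv]
  simp [hsx, hL] at h6
  simpa using h6

end Bordered

/-! ### The nilpotent exponential at the period of one pair. -/

section ConjugateLocus

open Set Function Real Metric

variable {n : ℕ}

theorem model_norm_sq (v : Model n) : ‖v‖ ^ 2 = ∑ k, xc k v ^ 2 + zc v ^ 2 := by
  rw [EuclideanSpace.real_norm_sq_eq, Fin.sum_univ_castSucc]
  rfl

theorem norm_ez : ‖(ez : Model n)‖ = 1 := by
  simp [ez]

/-- The rotation by a right angle in the plane of the `i`-th pair of coordinates. -/
noncomputable def turn (i : Fin n) : Model n →L[ℝ] Model n :=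
  (xc (oddIdx i)).smulRight (ex (evenIdx i)) - (xc (evenIdx i)).smulRight (ex (oddIdx i))

/-- The scalar product with the rotated vector `turn i c`. -/
noncomputable def turnForm (i : Fin n) : Model n →L[ℝ] Model n →L[ℝ] ℝ :=
  (xc (oddIdx i)).smulRight (xc (evenIdx i)) - (xc (evenIdx i)).smulRight (xc (oddIdx i))

theorem turn_apply (i : Fin n) (c : Model n) :
    turn i c = xc (oddIdx i) c • ex (evenIdx i) - xc (evenIdx i) c • ex (oddIdx i) := rfl

theorem turnForm_apply (i : Fin n) (c v : Model n) :
    turnForm i c v = xc (oddIdx i) c * xc (evenIdx i) v - xc (evenIdx i) c * xc (oddIdx i) v := rfl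

theorem xc_odd_turn (i : Fin n) (c : Model n) : xc (oddIdx i) (turn i c) = -xc (evenIdx i) c := by
  rw [turn_apply, map_sub, map_smul, map_smul, xc_ex, xc_ex]; simp

theorem xc_even_turn (i : Fin n) (c : Model n) : xc (evenIdx i) (turn i c) = xc (oddIdx i) c := by
  rw [turn_apply, map_sub, map_smul, map_smul, xc_ex, xc_ex]; simp

theorem xc_turn_of_ne {i j : Fin n} (h : j ≠ i) (c : Model n) :
    xc (oddIdx j) (turn i c) = 0 ∧ xc (evenIdx j) (turn i c) = 0 := by
  rw [turn_apply]
  simp only [map_sub, map_smul, xc_ex]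
  simp [h]

theorem zc_turn (i : Fin n) (c : Model n) : zc (turn i c) = 0 := by
  rw [turn_apply]
  simp only [map_sub, map_smul, zc_ex]
  simp

/-- The squared norm of the component in the `i`-th pair of coordinates. -/
noncomputable def pairSq (i : Fin n) (c : Model n) : ℝ := xc (oddIdx i) c ^ 2 + xc (evenIdx i) c ^ 2

theorem turnForm_turn (i : Fin n) (c : Model n) : turnForm i c (turn i c) = pairSq i c := by
  rw [turnForm_apply, xc_odd_turn, xc_even_turn, pairSq]; ring

section AtThePeriod

variable {b : Fin n → ℝ} {c : Model n} {G : Model n → Model n} {D : Model n →L[ℝ] Model n}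

variable (hD : HasFDerivAt G D c) (hG : ∀ᶠ c' in 𝓝 c, G c' = nilY b c' 1) {i : Fin n}
  (hw : zc c * b i = 2 * π) (hb : ∀ j, 0 < b j) (hlt : ∀ j ≠ i, b j < b i)
include hD hG hw hb

theorem turnForm_period (v : Model n) : turnForm i c (D v) = 0 := by
  obtain ⟨h1, h2⟩ := xc_period hD hG i hw (hb i) v
  rw [turnForm_apply, h1, h2]; ring

omit hD hG in
theorem zc_pos_of_period : 0 < zc c := by
  have h := two_pi_pos
  rw [← hw] at h
  exact pos_of_mul_pos_left h (hb i).le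

omit hD hG in
include hlt in
theorem cos_lt_one_of_ne {j : Fin n} (hj : j ≠ i) : cos (zc c * b j) < 1 := by
  have hz := zc_pos_of_period hw hb
  refine cos_lt_one_of_pos_of_lt_two_pi (mul_pos hz (hb j)) ?_
  rw [← hw]
  exact mul_lt_mul_of_pos_left (hlt j hj) hz

-- The functional `turnForm i c` annihilates the range of `D`, which forces the scalar unknown to
-- vanish. Then `zc v = 0`, the shorter angles 2π b_j / b_i make the other pairs nondegenerate, and
-- the vertical row together with `turnForm i c v = 0` kills both components of `v` in the pair `i`.
include hlt in
theorem bordered_injective (hr : pairSq i c ≠ 0) :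
    Injective (bordered D (turn i c) (turnForm i c)) := by
  refine (injective_iff_map_eq_zero _).2 fun p hp => ?_
  obtain ⟨v, t⟩ := p
  rw [bordered_apply, Prod.mk_eq_zero] at hp
  obtain ⟨h1, h2⟩ := hp
  dsimp only at h1 h2
  have hz := zc_pos_of_period hw hb
  have hDv : D v = -(t • turn i c) := eq_neg_of_add_eq_zero_left h1
  have ht : t = 0 := by
    have := turnForm_period hD hG hw hb v
    rw [hDv, map_neg, map_smul, turnForm_turn, smul_eq_mul, neg_eq_zero] at this
    exact (mul_eq_zero.1 this).resolve_right hr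
  rw [ht, zero_smul, neg_zero] at hDv
  have hzv : zc v = 0 := by
    obtain ⟨h3, h4⟩ := xc_period hD hG i hw (hb i) v
    rw [hDv, map_zero] at h3 h4
    by_contra hne
    have h5 : zc v / zc c ≠ 0 := div_ne_zero hne hz.ne'
    apply hr
    rw [pairSq, (mul_eq_zero.1 h3.symm).resolve_left h5, (mul_eq_zero.1 h4.symm).resolve_left h5]
    ring
  have hblock : ∀ j ≠ i, xc (oddIdx j) v = 0 ∧ xc (evenIdx j) v = 0 := fun j hj =>
    block_eq_zero hD hG j (cos_lt_one_of_ne hw hb hlt hj) hzv (by rw [hDv, map_zero])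
      (by rw [hDv, map_zero])
  have hrow := row_z hD hG hb v
  rw [hDv, hzv, map_zero, sum_pairs, Finset.sum_eq_single i (fun j _ hj => by
    rw [(hblock j hj).1, (hblock j hj).2]; ring) (by simp)] at hrow
  simp only [bIdx_oddIdx, bIdx_evenIdx, hw, sin_two_pi, cos_two_pi] at hrow
  have hdot : xc (oddIdx i) c * xc (oddIdx i) v + xc (evenIdx i) c * xc (evenIdx i) v = 0 := by
    have hne : (b i)⁻¹ * (4 * π) ≠ 0 := by
      have := hb i
      have := pi_pos
      positivity
    apply mul_left_cancel₀ hne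
    linear_combination -hrow
  rw [turnForm_apply] at h2
  have ho : xc (oddIdx i) v = 0 := by
    apply mul_left_cancel₀ hr
    rw [pairSq]
    linear_combination xc (oddIdx i) c * hdot - xc (evenIdx i) c * h2
  have he : xc (evenIdx i) v = 0 := by
    apply mul_left_cancel₀ hr
    rw [pairSq]
    linear_combination xc (evenIdx i) c * hdot + xc (oddIdx i) c * h2
  have hv : v = 0 := by
    refine model_ext (idx_cases (fun j => ?_) fun j => ?_) (by rw [hzv, map_zero])
    · rw [map_zero]
      by_cases hj : j = i
      · rw [hj, ho]
      · exact (hblock j hj).1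
    · rw [map_zero]
      by_cases hj : j = i
      · rw [hj, he]
      · exact (hblock j hj).2
  rw [hv, ht]
  rfl

/-- At the period the pair itself ends at the origin, and the rest of the endpoint depends on that
pair of the covector only through its norm, so rotating the pair does not move the endpoint. -/
theorem period_turn : D (turn i c) = 0 := by
  have hz := zc_pos_of_period hw hb
  have hx : ∀ k, xc k (D (turn i c)) = 0 := by
    intro k
    have h1 := row_x hD hG k (turn i c)
    have hk := (bIdx_pos hb k).ne'
    have h0 : bIdx b k * zc c ≠ 0 := mul_ne_zero hk hz.ne'
    rw [zc_turn] at h1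
    have h2 : sin (zc c * bIdx b k) * xc k (turn i c) +
        (1 - cos (zc c * bIdx b k)) * rot k (turn i c) = 0 := by
      revert k
      refine idx_cases (fun j _ _ _ => ?_) fun j _ _ _ => ?_
      · rw [bIdx_oddIdx, rot_oddIdx]
        by_cases hj : j = i
        · rw [hj, hw]; simp
        · rw [(xc_turn_of_ne hj c).1, (xc_turn_of_ne hj c).2]; ring
      · rw [bIdx_evenIdx, rot_evenIdx]
        by_cases hj : j = i
        · rw [hj, hw]; simp
        · rw [(xc_turn_of_ne hj c).1, (xc_turn_of_ne hj c).2]; ring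
    apply mul_left_cancel₀ h0
    linear_combination h1 + h2
  refine model_ext (fun k => by rw [hx, map_zero]) ?_
  have hrow := row_z hD hG hb (turn i c)
  rw [zc_turn, sum_pairs, Finset.sum_eq_single i (fun j _ hj => by
    rw [(xc_turn_of_ne hj c).1, (xc_turn_of_ne hj c).2]; ring) (by simp), xc_odd_turn,
    xc_even_turn] at hrow
  simp only [bIdx_oddIdx, bIdx_evenIdx] at hrow
  have h0 : 2 * zc c ^ 2 ≠ 0 := by positivity
  rw [map_zero]
  apply mul_left_cancel₀ h0
  linear_combination hrow

end AtThePeriod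

end ConjugateLocus

/-! ### The equation of the singular points and its first derivatives. -/

section ConjugateLocus

open Set Function Real Metric

variable {n : ℕ}

/-- The derivative of `G (c, μ)` with respect to `c`. -/
noncomputable def dexp (G : Model n × ℝ → Model n) (p : Model n × ℝ) : Model n →L[ℝ] Model n :=
  (fderiv ℝ G p).comp (ContinuousLinearMap.inl ℝ (Model n) ℝ)

theorem contDiff_dexp {G : Model n × ℝ → Model n} (hG : ContDiff ℝ ∞ G) :
    ContDiff ℝ ∞ (dexp G) := by
  unfold dexp
  exact (hG.fderiv_right (m := ∞) (by norm_num)).clm_comp contDiff_const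

/-- The change of parameters `(c, η) ↦ (c, η c_z)`. -/
noncomputable def scaleParam (x : Model n × ℝ) : Model n × ℝ := (x.1, x.2 * zc x.1)

theorem contDiff_scaleParam : ContDiff ℝ ∞ (scaleParam (n := n)) := by
  have h : ContDiff ℝ ∞ (zc : Model n → ℝ) := ContinuousLinearMap.contDiff _
  exact contDiff_fst.prodMk (contDiff_snd.mul (h.comp contDiff_fst))

/-- The dilation parameter of an extremal is η times its vertical momentum, hence varies with w as
well; at η = 0 only the factor `zc c` on the η-direction remains. -/
theorem hasFDerivAt_scaleParam (c : Model n) : HasFDerivAt (scaleParam (n := n))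
    ((ContinuousLinearMap.fst ℝ (Model n) ℝ).prod
      (zc c • ContinuousLinearMap.snd ℝ (Model n) ℝ)) (c, 0) := by
  have h1 : HasFDerivAt (fun x : Model n × ℝ => x.2) (ContinuousLinearMap.snd ℝ (Model n) ℝ) (c, 0) :=
    hasFDerivAt_snd
  have h2 : HasFDerivAt (fun x : Model n × ℝ => zc x.1)
      ((zc : Model n →L[ℝ] ℝ).comp (ContinuousLinearMap.fst ℝ (Model n) ℝ)) (c, 0) :=
    (zc : Model n →L[ℝ] ℝ).hasFDerivAt.comp (c, 0) hasFDerivAt_fst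
  refine hasFDerivAt_fst.prodMk ((h1.mul h2).congr_fderiv ?_)
  ext v <;> simp

namespace RescaledFrame

variable (Fr : RescaledFrame n) {G : Model n × ℝ → Model n} (hG : ContDiff ℝ ∞ G) {R : ℝ}
  (hnil : ∀ c ∈ closedBall (0 : Model n) R, G (c, 0) = nilY Fr.b c 1)
  (hvar : ∀ c ∈ closedBall (0 : Model n) R, ∀ k, xc k (fderiv ℝ G (c, 0) (0, 1)) = Fr.firstVar c k)

/-- The two coefficients of the first variation in the direction `turn i c`. -/
noncomputable def turnVar (i : Fin n) (c : Model n) (k : Fin (2 * n)) : ℝ :=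
  Fr.varForm (zc c) k (turn i c) c + Fr.varForm (zc c) k c (turn i c)

/-- The function, on parameters `(c, η)`, whose zeros are the singular points of `G (·, η c_z)`. -/
noncomputable def conj (G : Model n × ℝ → Model n) (i : Fin n) (x : Model n × ℝ) : ℝ :=
  (borderedSol (dexp G (scaleParam x)) (turn i x.1) (turnForm i x.1)).2

section Local

variable {c : Model n} (hc : ‖c‖ < R)

include hc in
theorem eventually_norm_lt : ∀ᶠ c' in 𝓝 c, c' ∈ closedBall (0 : Model n) R := by
  filter_upwards [isOpen_ball.mem_nhds (mem_ball_zero_iff.2 hc)] with c' hc'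
  exact ball_subset_closedBall hc'

include hnil hc in
theorem eventually_eq_nilY : ∀ᶠ c' in 𝓝 c, G (c', 0) = nilY Fr.b c' 1 :=
  (eventually_norm_lt hc).mono hnil

include hG in
theorem hasFDerivAt_dexp (c : Model n) (μ : ℝ) :
    HasFDerivAt (fun c' => G (c', μ)) (dexp G (c, μ)) c := by
  have h1 := ((hG.differentiable (by simp)) (c, μ)).hasFDerivAt
  exact h1.comp c (hasFDerivAt_prodMk_left c μ)

include hG hc

variable {i : Fin n} (hw : zc c * Fr.b i = 2 * π)

-- Symmetry of second derivatives reduces this to differentiating the derivative along `ez` in the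
-- direction `turn i c`. That direction preserves the vertical momentum, so `xc_period` applies
-- along the whole line.
include hnil hw in
theorem second_deriv_ez (k : Fin (2 * n)) (hk : k = oddIdx i ∨ k = evenIdx i) :
    xc k (fderiv ℝ (fderiv ℝ G) (c, 0) (ez, 0) (turn i c, 0)) = xc k (turn i c) / zc c := by
  have hsymm := ((contDiff_infty.1 hG 2).contDiffAt (x := (c, (0 : ℝ)))).isSymmSndFDerivAt (by simp)
  rw [hsymm.eq]
  have hd : HasFDerivAt (fderiv ℝ G) (fderiv ℝ (fderiv ℝ G) (c, 0)) (c, 0) :=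
    ((hG.fderiv_right (m := ∞) (by norm_num)).differentiable (by simp) _).hasFDerivAt
  have h1 := (hd.hasLineDerivAt (turn i c, (0 : ℝ)))
  have h2 : HasDerivAt (fun t : ℝ => xc k (fderiv ℝ G ((c, 0) + t • (turn i c, 0)) (ez, 0)))
      (xc k (fderiv ℝ (fderiv ℝ G) (c, 0) (turn i c, 0) (ez, 0))) 0 := by
    have := (xc k).hasFDerivAt.comp_hasDerivAt (0 : ℝ)
      (HasDerivAt.clm_apply h1 (hasDerivAt_const (0 : ℝ) (ez, (0 : ℝ))))
    simp only [map_zero, add_zero] at this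
    exact this
  refine h2.unique ?_
  have h3 : HasDerivAt (fun t : ℝ => xc k (c + t • turn i c) / zc c) (xc k (turn i c) / zc c) 0 := by
    have := ((xc k).hasFDerivAt (x := c)).hasLineDerivAt (turn i c)
    exact HasDerivAt.div_const this _
  refine h3.congr_of_eventuallyEq ?_
  have hT : Filter.Tendsto (fun t : ℝ => c + t • turn i c) (𝓝 0) (𝓝 c) := by
    have h : Continuous fun t : ℝ => c + t • turn i c := by fun_prop
    simpa using h.tendsto 0
  filter_upwards [hT.eventually (Fr.eventually_eq_nilY hnil hc).eventually_nhds] with t ht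
  have hz : zc (c + t • turn i c) = zc c := by rw [map_add, map_smul, zc_turn, smul_zero, add_zero]
  have hp := xc_period (hasFDerivAt_dexp hG (c + t • turn i c) 0) ht i (by rw [hz]; exact hw)
    (Fr.b_pos i) ez
  rw [zc_ez, hz] at hp
  have he : ((c, (0 : ℝ)) + t • (turn i c, (0 : ℝ))) = (c + t • turn i c, 0) := by simp
  rw [he]
  rcases hk with rfl | rfl
  · rw [div_eq_inv_mul, ← one_div]; exact hp.1
  · rw [div_eq_inv_mul, ← one_div]; exact hp.2

-- By symmetry of second derivatives this is the derivative of the first variation along `turn i c`,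
-- where the vertical momentum is constant and the first variation is a quadratic form.
include hvar in
theorem second_deriv_param (k : Fin (2 * n)) :
    xc k (fderiv ℝ (fderiv ℝ G) (c, 0) (0, 1) (turn i c, 0)) = Fr.turnVar i c k := by
  have hsymm := ((contDiff_infty.1 hG 2).contDiffAt (x := (c, (0 : ℝ)))).isSymmSndFDerivAt (by simp)
  rw [hsymm.eq]
  have hd : HasFDerivAt (fderiv ℝ G) (fderiv ℝ (fderiv ℝ G) (c, 0)) (c, 0) :=
    ((hG.fderiv_right (m := ∞) (by norm_num)).differentiable (by simp) _).hasFDerivAt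
  have h1 := (hd.hasLineDerivAt (turn i c, (0 : ℝ)))
  have h2 : HasDerivAt (fun t : ℝ => xc k (fderiv ℝ G ((c, 0) + t • (turn i c, 0)) (0, 1)))
      (xc k (fderiv ℝ (fderiv ℝ G) (c, 0) (turn i c, 0) (0, 1))) 0 := by
    have := (xc k).hasFDerivAt.comp_hasDerivAt (0 : ℝ)
      (HasDerivAt.clm_apply h1 (hasDerivAt_const (0 : ℝ) ((0 : Model n), (1 : ℝ))))
    simp only [map_zero, add_zero] at this
    exact this
  refine h2.unique ?_
  have h3 : HasDerivAt (fun t : ℝ => Fr.varForm (zc c) k c c + t * Fr.turnVar i c k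
      + t ^ 2 * Fr.varForm (zc c) k (turn i c) (turn i c)) (Fr.turnVar i c k) 0 := by
    have e1 := (hasDerivAt_id (0 : ℝ)).mul_const (Fr.turnVar i c k)
    have e2 := ((hasDerivAt_id (0 : ℝ)).pow 2).mul_const (Fr.varForm (zc c) k (turn i c) (turn i c))
    have := ((e1.const_add (Fr.varForm (zc c) k c c)).add e2)
    exact this.congr_deriv (by simp)
  refine h3.congr_of_eventuallyEq ?_
  have hT : Filter.Tendsto (fun t : ℝ => c + t • turn i c) (𝓝 0) (𝓝 c) := by
    have h : Continuous fun t : ℝ => c + t • turn i c := by fun_prop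
    simpa using h.tendsto 0
  filter_upwards [hT.eventually (eventually_norm_lt hc)] with t ht
  have hz : zc (c + t • turn i c) = zc c := by rw [map_add, map_smul, zc_turn, smul_zero, add_zero]
  have he : ((c, (0 : ℝ)) + t • (turn i c, (0 : ℝ))) = (c + t • turn i c, 0) := by simp
  rw [he, hvar _ ht, Fr.firstVar_eq_varForm, hz, turnVar]
  simp only [map_add, map_smul, LinearMap.add_apply, LinearMap.smul_apply, smul_eq_mul]
  ring

variable (hlt : ∀ j ≠ i, Fr.b j < Fr.b i) (hr : pairSq i c ≠ 0)

include hnil hlt hr hw in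
theorem bordered_dexp_injective :
    Injective (bordered (dexp G (c, 0)) (turn i c) (turnForm i c)) :=
  bordered_injective (hasFDerivAt_dexp hG c 0) (Fr.eventually_eq_nilY hnil hc) hw Fr.b_pos hlt hr

omit hc in
theorem fderiv_dexp_scaleParam (c : Model n) (d : Model n × ℝ) (v : Model n) :
    fderiv ℝ (fun x => dexp G (scaleParam x)) (c, 0) d v =
      fderiv ℝ (fderiv ℝ G) (c, 0) (d.1, zc c * d.2) (v, 0) := by
  have hs : scaleParam (c, (0 : ℝ)) = (c, 0) := by simp [scaleParam]
  have hd : HasFDerivAt (fderiv ℝ G) (fderiv ℝ (fderiv ℝ G) (c, 0)) (scaleParam (c, 0)) := by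
    rw [hs]
    exact ((hG.fderiv_right (m := ∞) (by norm_num)).differentiable (by simp) _).hasFDerivAt
  have h1 := (hd.comp (c, (0 : ℝ)) (hasFDerivAt_scaleParam c)).clm_apply
    (hasFDerivAt_const (v, (0 : ℝ)) (c, (0 : ℝ)))
  have hA : DifferentiableAt ℝ (fun x => dexp G (scaleParam x)) (c, 0) :=
    ((contDiff_dexp hG).comp contDiff_scaleParam).differentiable (by simp) _
  have h2 := hA.hasFDerivAt.clm_apply (hasFDerivAt_const v (c, (0 : ℝ)))
  have h3 := congrArg (fun T : Model n × ℝ →L[ℝ] Model n => T d) (h2.unique h1)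
  simpa using h3

-- Instance of `fderiv_borderedSol_snd` with kernel vector `turn i c` divided by `pairSq i c`, so
-- that `turnForm i c` takes the value 1 on it, and with `turnForm i c` as the functional
-- annihilating the range.
include hnil hlt hr hw in
theorem fderiv_conj (d : Model n × ℝ) :
    turnForm i c (fderiv ℝ (fderiv ℝ G) (c, 0) (d.1, zc c * d.2) (turn i c, 0)) +
      fderiv ℝ (conj G i) (c, 0) d * pairSq i c ^ 2 = 0 := by
  have hs : scaleParam (c, (0 : ℝ)) = (c, 0) := by simp [scaleParam]
  have hD := hasFDerivAt_dexp hG c 0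
  have hev := Fr.eventually_eq_nilY hnil hc
  have ht : ContDiff ℝ ∞ fun x : Model n × ℝ => turn i x.1 := by
    have h : ContDiff ℝ ∞ (turn (n := n) i) := ContinuousLinearMap.contDiff _
    exact h.comp contDiff_fst
  have hf : ContDiff ℝ ∞ fun x : Model n × ℝ => turnForm i x.1 := by
    have h : ContDiff ℝ ∞ (turnForm (n := n) i) := ContinuousLinearMap.contDiff _
    exact h.comp contDiff_fst
  have h := fderiv_borderedSol_snd (x := (c, (0 : ℝ))) (k := (pairSq i c)⁻¹ • turn i c)
    (L := turnForm i c) (d := d)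
    (((contDiff_dexp hG).comp contDiff_scaleParam).of_le (by exact_mod_cast le_top))
    (ht.of_le (by exact_mod_cast le_top)) (hf.of_le (by exact_mod_cast le_top))
    (by
      simp only [Function.comp_apply, hs]
      exact Fr.bordered_dexp_injective hG hnil hc hw hlt hr)
    (by
      simp only [Function.comp_apply, hs]
      rw [map_smul, period_turn hD hev hw Fr.b_pos, smul_zero])
    (by rw [map_smul, turnForm_turn, smul_eq_mul, inv_mul_cancel₀ hr])
    (by
      simp only [Function.comp_apply, hs]
      exact turnForm_period hD hev hw Fr.b_pos)
  have e1 := fderiv_dexp_scaleParam hG c d (turn i c)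
  simp only [Function.comp_def] at h
  rw [map_smul, e1, map_smul, turnForm_turn, smul_eq_mul] at h
  have e2 : fderiv ℝ (fun x : Model n × ℝ => (borderedSol (dexp G (scaleParam x)) (turn i x.1)
    (turnForm i x.1)).2) (c, 0) d = fderiv ℝ (conj G i) (c, 0) d := rfl
  rw [e2] at h
  field_simp at h
  linear_combination h

-- The value is nonzero, so the singular equation is transverse to η = 0 in the direction of the
-- vertical momentum and determines w as a function of η.
include hnil hlt hr hw in
theorem fderiv_conj_ez :
    fderiv ℝ (conj G i) (c, 0) (ez, 0) = -1 / (zc c * pairSq i c) := by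
  have hz := (zc_pos_of_period hw Fr.b_pos).ne'
  have h := Fr.fderiv_conj hG hnil hc hw hlt hr (ez, 0)
  simp only [mul_zero] at h
  rw [turnForm_apply, Fr.second_deriv_ez hG hnil hc hw _ (Or.inl rfl),
    Fr.second_deriv_ez hG hnil hc hw _ (Or.inr rfl), xc_odd_turn, xc_even_turn] at h
  have e : xc (oddIdx i) c * (xc (oddIdx i) c / zc c) - xc (evenIdx i) c * (-xc (evenIdx i) c / zc c)
      = pairSq i c / zc c := by rw [pairSq]; ring
  rw [e] at h
  field_simp
  field_simp at h
  apply mul_left_cancel₀ hr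
  linear_combination h

include hnil hvar hlt hr hw in
theorem fderiv_conj_param :
    fderiv ℝ (conj G i) (c, 0) (0, 1) =
      -(zc c * (xc (oddIdx i) c * Fr.turnVar i c (evenIdx i)
        - xc (evenIdx i) c * Fr.turnVar i c (oddIdx i))) / pairSq i c ^ 2 := by
  have h := Fr.fderiv_conj hG hnil hc hw hlt hr (0, 1)
  have e : ((0 : Model n), zc c * 1) = zc c • ((0 : Model n), (1 : ℝ)) := by simp
  simp only [e] at h
  rw [map_smul, smul_apply, map_smul, turnForm_apply, Fr.second_deriv_param hG hvar hc,
    Fr.second_deriv_param hG hvar hc, smul_eq_mul] at h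
  have hr2 : pairSq i c ^ 2 ≠ 0 := pow_ne_zero 2 hr
  rw [eq_div_iff hr2]
  linear_combination h

end Local

end RescaledFrame

end ConjugateLocus

/-! ### The first singular parameter, uniformly in the covector. -/

section ConjugateLocus

open Set Function Real Metric

variable {n : ℕ}

/-- The covector with horizontal components `u` and vertical component `w`. -/
noncomputable def horVert (u : Fin (2 * n) → ℝ) (w : ℝ) : Model n := hvec u + w • ez

@[simp] theorem xc_horVert (u : Fin (2 * n) → ℝ) (w : ℝ) (k : Fin (2 * n)) :
    xc k (horVert u w) = u k := by
  rw [horVert, map_add, map_smul, xc_hvec, xc_ez, smul_zero, add_zero]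

@[simp] theorem zc_horVert (u : Fin (2 * n) → ℝ) (w : ℝ) : zc (horVert u w) = w := by
  rw [horVert, map_add, map_smul, zc_hvec, zc_ez, zero_add, smul_eq_mul, mul_one]

theorem continuous_horVert : Continuous fun p : (Fin (2 * n) → ℝ) × ℝ => horVert p.1 p.2 := by
  have h := (continuous_hvec (n := n)).comp
    (continuous_fst : Continuous fun p : (Fin (2 * n) → ℝ) × ℝ => p.1)
  exact h.add (continuous_snd.smul continuous_const)

theorem horVert_add_smul (u : Fin (2 * n) → ℝ) (w s : ℝ) :
    horVert u w + s • ez = horVert u (w + s) := by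
  rw [horVert, horVert, add_assoc, ← add_smul]

/-- Unit horizontal covectors whose component in the `i`-th pair is not too small. -/
def unitCovectors (i : Fin n) (ε : ℝ) : Set (Fin (2 * n) → ℝ) :=
  {u | ∑ k, u k ^ 2 = 1 ∧ ε ≤ u (oddIdx i) ^ 2 + u (evenIdx i) ^ 2}

theorem abs_le_one_of_mem {i : Fin n} {ε : ℝ} {u : Fin (2 * n) → ℝ} (hu : u ∈ unitCovectors i ε)
    (k : Fin (2 * n)) : |u k| ≤ 1 := by
  rw [← sq_le_one_iff_abs_le_one, ← hu.1]
  exact Finset.single_le_sum (f := fun k => u k ^ 2) (fun _ _ => sq_nonneg _) (Finset.mem_univ k)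

theorem isCompact_unitCovectors (i : Fin n) (ε : ℝ) : IsCompact (unitCovectors i ε) := by
  refine (isCompact_Icc (a := fun _ : Fin (2 * n) => (-1 : ℝ)) (b := fun _ => 1)).of_isClosed_subset
    ?_ fun u hu => ⟨fun k => (abs_le.1 (abs_le_one_of_mem hu k)).1,
      fun k => (abs_le.1 (abs_le_one_of_mem hu k)).2⟩
  have h1 : Continuous fun u : Fin (2 * n) → ℝ => ∑ k, u k ^ 2 := by fun_prop
  have h2 : Continuous fun u : Fin (2 * n) → ℝ => u (oddIdx i) ^ 2 + u (evenIdx i) ^ 2 := by fun_prop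
  exact (isClosed_eq h1 continuous_const).inter (isClosed_le continuous_const h2)

theorem norm_horVert_lt {i : Fin n} {ε : ℝ} {u : Fin (2 * n) → ℝ} (hu : u ∈ unitCovectors i ε)
    {w R : ℝ} (hw : 0 ≤ w) (hR : w + 1 < R) : ‖horVert u w‖ < R := by
  have h1 := model_norm_sq (horVert u w)
  simp only [xc_horVert, zc_horVert, hu.1] at h1
  have h2 := norm_nonneg (horVert u w)
  nlinarith

theorem abs_xc_le_norm (k : Fin (2 * n)) (v : Model n) : |xc k v| ≤ ‖v‖ := by
  have h := model_norm_sq v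
  have h1 : xc k v ^ 2 ≤ ∑ k, xc k v ^ 2 :=
    Finset.single_le_sum (f := fun k => xc k v ^ 2) (fun _ _ => sq_nonneg _) (Finset.mem_univ k)
  exact abs_le_of_sq_le_sq (by nlinarith [sq_nonneg (zc v)]) (norm_nonneg v)

theorem turn_horVert (i : Fin n) (u : Fin (2 * n) → ℝ) (w : ℝ) :
    turn i (horVert u w) = turn i (hvec u) := by
  simp only [turn_apply, xc_horVert, xc_hvec]

theorem pairSq_horVert (i : Fin n) (u : Fin (2 * n) → ℝ) (w : ℝ) :
    pairSq i (horVert u w) = u (oddIdx i) ^ 2 + u (evenIdx i) ^ 2 := by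
  simp only [pairSq, xc_horVert]

theorem scaleParam_horVert (u : Fin (2 * n) → ℝ) (w η : ℝ) :
    scaleParam (horVert u w, η) = (horVert u w, η * w) := by
  rw [scaleParam, zc_horVert]

namespace RescaledFrame

variable (Fr : RescaledFrame n)

/-- The symmetrized first variation, along `u` and `turn i u`. -/
noncomputable def turnPolar (w : ℝ) (i : Fin n) (u : Fin (2 * n) → ℝ) (k : Fin (2 * n)) : ℝ :=
  Fr.varForm w k (turn i (hvec u)) (hvec u) + Fr.varForm w k (hvec u) (turn i (hvec u))

/-- The second order coefficient of the conjugate time. -/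
noncomputable def timeCoef (w : ℝ) (i : Fin n) (u : Fin (2 * n) → ℝ) : ℝ :=
  w ^ 2 * (u (oddIdx i) * Fr.turnPolar w i u (evenIdx i)
    - u (evenIdx i) * Fr.turnPolar w i u (oddIdx i)) / (u (oddIdx i) ^ 2 + u (evenIdx i) ^ 2)

/-- The second order coefficient of the components of the conjugate point. -/
noncomputable def pointCoef (w : ℝ) (i : Fin n) (u : Fin (2 * n) → ℝ) (k : Fin (2 * n)) : ℝ :=
  w ^ 2 * Fr.varForm w k (hvec u) (hvec u) - u k * Fr.timeCoef w i u

theorem varForm_horVert (w : ℝ) (k : Fin (2 * n)) (u : Fin (2 * n) → ℝ) (w' : ℝ) (v : Model n) :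
    Fr.varForm w k (horVert u w') v = Fr.varForm w k (hvec u) v ∧
      Fr.varForm w k v (horVert u w') = Fr.varForm w k v (hvec u) := by
  simp [horVert, varForm_ez_left, varForm_ez_right]

theorem turnVar_horVert (w : ℝ) (i : Fin n) (u : Fin (2 * n) → ℝ) (k : Fin (2 * n)) :
    Fr.turnVar i (horVert u w) k = Fr.turnPolar w i u k := by
  rw [turnVar, zc_horVert, turn_horVert, (Fr.varForm_horVert w k u w _).1,
    (Fr.varForm_horVert w k u w _).2, turnPolar]

theorem continuous_varForm_hvec (w : ℝ) (k : Fin (2 * n)) :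
    Continuous fun u : Fin (2 * n) → ℝ => Fr.varForm w k (hvec u) (hvec u) := by
  have h : ∀ u : Fin (2 * n) → ℝ, Fr.varForm w k (hvec u) (hvec u) =
      ∑ i, ∑ j, u i * u j * Fr.varForm w k (ex i) (ex j) := fun u => by
    simp only [hvec, map_sum, map_smul, LinearMap.sum_apply, LinearMap.smul_apply, smul_eq_mul,
      Finset.mul_sum]
    rw [Finset.sum_comm]
    exact Finset.sum_congr rfl fun i _ => Finset.sum_congr rfl fun j _ => by ring
  simp only [h]
  fun_prop

variable {G : Model n × ℝ → Model n} (hG : ContDiff ℝ ∞ G) {R : ℝ}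
  (hnil : ∀ c ∈ closedBall (0 : Model n) R, G (c, 0) = nilY Fr.b c 1)
  (hvar : ∀ c ∈ closedBall (0 : Model n) R, ∀ k, xc k (fderiv ℝ G (c, 0) (0, 1)) = Fr.firstVar c k)
  {i : Fin n} {w₁ : ℝ} (hw₁ : w₁ * Fr.b i = 2 * π) (hR : w₁ + 2 < R)
  (hlt : ∀ j ≠ i, Fr.b j < Fr.b i) {ε : ℝ} (hε : 0 < ε)

theorem pos_of_mul_eq_two_pi (hw₁ : w₁ * Fr.b i = 2 * π) : 0 < w₁ := by
  have h := two_pi_pos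
  rw [← hw₁] at h
  exact pos_of_mul_pos_left h (Fr.b_pos i).le

include hG hnil hw₁ hR hlt

/-- No singular point before the period of the first pair. -/
theorem exists_forall_injective {δ : ℝ} (hδ : 0 < δ) : ∃ η₀ > 0, ∀ η ∈ Ioo 0 η₀,
    ∀ u ∈ unitCovectors i ε, ∀ w ∈ Icc 0 (w₁ - δ), Injective (dexp G (horVert u w, η * w)) := by
  -- The compact set includes w = 0, where the rescaled derivative is still injective; this excludes
  -- singular parameters accumulating at 0.
  have hK : IsCompact ((fun p : (Fin (2 * n) → ℝ) × ℝ => (horVert p.1 p.2, (0 : ℝ))) ''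
      (unitCovectors i ε ×ˢ Icc 0 (w₁ - δ))) :=
    ((isCompact_unitCovectors i ε).prod isCompact_Icc).image
      (continuous_horVert.prodMk continuous_const)
  obtain ⟨η₀, hη₀, h⟩ := hK.exists_pos_forall_dist_lt
    (p := fun y => Injective (dexp G (scaleParam y))) (by
      rintro _ ⟨⟨u, w⟩, ⟨hu, hw⟩, rfl⟩
      dsimp only
      have hcont : Continuous fun y => dexp G (scaleParam y) :=
        ((contDiff_dexp hG).comp contDiff_scaleParam).continuous
      refine hcont.continuousAt.eventually (ContinuousLinearMap.isOpen_injective.mem_nhds ?_)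
      have hs : scaleParam (horVert u w, (0 : ℝ)) = (horVert u w, 0) := by simp [scaleParam]
      change Injective (dexp G (scaleParam (horVert u w, (0 : ℝ))))
      rw [hs]
      have hD := hasFDerivAt_dexp hG (horVert u w) 0
      have hev := Fr.eventually_eq_nilY hnil
        (norm_horVert_lt hu hw.1 (by linarith [hw.2] : w + 1 < R))
      have h0 : ∃ k, xc k (horVert u w) ≠ 0 := by
        by_contra! hcon
        simp only [xc_horVert] at hcon
        have := hu.1
        simp [hcon] at this
      rcases hw.1.eq_or_lt with h00 | hpos
      · exact injective_of_zc_eq_zero hD hev Fr.b_pos (by rw [zc_horVert, h00]) h0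
      · refine injective_of_lt hD hev Fr.b_pos (by rwa [zc_horVert]) (fun j => ?_) h0
        rw [zc_horVert, ← hw₁]
        have hj : Fr.b j ≤ Fr.b i := by
          by_cases hj : j = i
          · rw [hj]
          · exact (hlt j hj).le
        calc w * Fr.b j ≤ w * Fr.b i := mul_le_mul_of_nonneg_left hj hw.1
          _ < w₁ * Fr.b i := mul_lt_mul_of_pos_right (by linarith [hw.2]) (Fr.b_pos i))
  refine ⟨η₀, hη₀, fun η hη u hu w hw => ?_⟩
  have := h _ ⟨(u, w), ⟨hu, hw⟩, rfl⟩ (horVert u w, η) (by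
    rw [Prod.dist_eq, dist_self, dist_zero_right, norm_eq_abs, abs_of_pos hη.1,
      max_eq_right hη.1.le]
    exact hη.2)
  rwa [scaleParam, zc_horVert] at this

omit hG hlt in
theorem xc_exp_period (u : Fin (2 * n) → ℝ) (hu : u ∈ unitCovectors i ε) (k : Fin (2 * n))
    (hk : k = oddIdx i ∨ k = evenIdx i) : xc k (G (horVert u w₁, 0)) = 0 := by
  have hpos := Fr.pos_of_mul_eq_two_pi hw₁
  have hlt' := norm_horVert_lt hu hpos.le (by linarith : w₁ + 1 < R)
  rw [hnil _ (mem_closedBall_zero_iff.2 hlt'.le)]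
  have h := mul_xc_nilY Fr.b (horVert u w₁) k
  have hk' : w₁ * bIdx Fr.b k = 2 * π := by rcases hk with rfl | rfl <;> simpa using hw₁
  have hb := (bIdx_pos Fr.b_pos k).ne'
  rw [zc_horVert, hk', sin_two_pi, cos_two_pi] at h
  have h0 : bIdx Fr.b k * w₁ ≠ 0 := mul_ne_zero hb hpos.ne'
  apply mul_left_cancel₀ h0
  linear_combination h

omit hlt in
include hvar in
/-- The first order expansion of the exponential near the first period. -/
theorem exists_exp_expansion : ∃ C > 0, ∃ ρ > 0, ∀ u ∈ unitCovectors i ε, ∀ s η : ℝ, |s| < ρ →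
    |η| < ρ → ∀ k, (k = oddIdx i ∨ k = evenIdx i) →
    |xc k (G (horVert u (w₁ + s), η * (w₁ + s))) -
      (s * (u k / w₁) + η * (w₁ * Fr.varForm w₁ k (hvec u) (hvec u)))| ≤ C * (|s| + |η|) ^ 2 := by
  have hpos := Fr.pos_of_mul_eq_two_pi hw₁
  have hK : IsCompact ((fun u : Fin (2 * n) → ℝ => (horVert u w₁, (0 : ℝ))) '' unitCovectors i ε) :=
    (isCompact_unitCovectors i ε).image ((continuous_horVert.comp
      (continuous_id.prodMk continuous_const)).prodMk continuous_const)
  have hsm : ContDiff ℝ ∞ fun x => G (scaleParam x) := hG.comp contDiff_scaleParam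
  obtain ⟨C, hC, ρ, hρ, hT⟩ := hK.exists_uniform_taylor_bound (f := fun x => G (scaleParam x))
    fun x _ => (contDiff_infty.1 hsm 2).contDiffAt
  refine ⟨C, hC, ρ, hρ, fun u hu s η hs hη k hk => ?_⟩
  have hxlt := norm_horVert_lt hu hpos.le (by linarith : w₁ + 1 < R)
  have hmem := mem_closedBall_zero_iff.2 hxlt.le
  have hnorm : ‖((s • ez : Model n), η)‖ ≤ |s| + |η| := by
    rw [Prod.norm_def, norm_smul, norm_ez, mul_one, norm_eq_abs, norm_eq_abs]
    exact max_le (by linarith [abs_nonneg η]) (by linarith [abs_nonneg s])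
  have hs0 : scaleParam (horVert u w₁, (0 : ℝ)) = (horVert u w₁, 0) := by simp [scaleParam]
  have hy : ((horVert u w₁, (0 : ℝ)) + (s • ez, η)) = (horVert u (w₁ + s), η) := by
    rw [Prod.mk_add_mk, horVert_add_smul, zero_add]
  have h := hT _ ⟨u, hu, rfl⟩ ((horVert u w₁, (0 : ℝ)) + (s • ez, η)) (by
    rw [dist_eq_norm, add_sub_cancel_left, Prod.norm_def, norm_smul, norm_ez, mul_one, norm_eq_abs,
      norm_eq_abs]
    exact max_lt hs hη)
  rw [add_sub_cancel_left] at h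
  have hsy := scaleParam_horVert u (w₁ + s) η
  have hGd : HasFDerivAt G (fderiv ℝ G (horVert u w₁, 0)) (scaleParam (horVert u w₁, (0 : ℝ))) := by
    rw [hs0]; exact (hG.differentiable (by simp) _).hasFDerivAt
  have hder := (hGd.comp (horVert u w₁, (0 : ℝ)) (hasFDerivAt_scaleParam (horVert u w₁))).fderiv
  simp only [Function.comp_def] at hder
  beta_reduce at h
  rw [hy, hder, hsy, hs0] at h
  have e1 := (abs_xc_le_norm k _).trans h
  -- The increment splits into a change of vertical momentum, which moves the pair along `u`, and a
  -- change of frame parameter, which contributes the first variation.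
  have hsplit : fderiv ℝ G (horVert u w₁, 0) (s • ez, w₁ * η) =
      s • dexp G (horVert u w₁, 0) ez + (w₁ * η) • fderiv ℝ G (horVert u w₁, 0) (0, 1) := by
    rw [dexp, ContinuousLinearMap.comp_apply, ContinuousLinearMap.inl_apply, ← map_smul,
      ← map_smul, ← map_add]
    simp
  have e2 : (((fderiv ℝ G (horVert u w₁, 0)).comp ((ContinuousLinearMap.fst ℝ (Model n) ℝ).prod
      (zc (horVert u w₁) • ContinuousLinearMap.snd ℝ (Model n) ℝ))) (s • ez, η)) =
      fderiv ℝ G (horVert u w₁, 0) (s • ez, w₁ * η) := by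
    change fderiv ℝ G (horVert u w₁, 0) (s • ez, zc (horVert u w₁) * η) = _
    rw [zc_horVert]
  have hp : xc k (dexp G (horVert u w₁, 0) ez) = u k / w₁ := by
    have h3 := xc_period (hasFDerivAt_dexp hG (horVert u w₁) 0) (Fr.eventually_eq_nilY hnil hxlt) i
      (by rw [zc_horVert]; exact hw₁) (Fr.b_pos i) ez
    rw [zc_ez, zc_horVert, xc_horVert, xc_horVert] at h3
    rcases hk with rfl | rfl
    · rw [h3.1]; ring
    · rw [h3.2]; ring
  rw [e2, hsplit, map_sub, map_sub, map_add, map_smul, map_smul, hp, hvar _ hmem,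
    Fr.firstVar_eq_varForm, zc_horVert, (Fr.varForm_horVert ..).1, (Fr.varForm_horVert ..).2,
    Fr.xc_exp_period hnil hw₁ hR u hu k hk, smul_eq_mul, smul_eq_mul, sub_zero] at e1
  calc _ = |xc k (G (horVert u (w₁ + s), η * (w₁ + s))) -
        (s * (u k / w₁) + w₁ * η * Fr.varForm w₁ k (hvec u) (hvec u))| := by
        congr 2; ring
    _ ≤ _ := e1
    _ ≤ _ := by gcongr

include hvar hε in
/-- Existence and expansion of the first singular time. -/
theorem exists_first_singular : ∃ C > 0, ∃ η₀ > 0, ∀ η ∈ Ioo 0 η₀, ∀ u ∈ unitCovectors i ε,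
    ∃ w ∈ Ioo 0 (w₁ + 1), ¬Injective (dexp G (horVert u w, η * w)) ∧
      (∀ w' ∈ Ico 0 w, Injective (dexp G (horVert u w', η * w'))) ∧
      ∀ k, (k = oddIdx i ∨ k = evenIdx i) →
        |η * w * xc k (G (horVert u w, η * w)) - η ^ 2 * Fr.pointCoef w₁ i u k| ≤ C * η ^ 3 := by
  have hpos := Fr.pos_of_mul_eq_two_pi hw₁
  have hK : IsCompact ((fun u : Fin (2 * n) → ℝ => (horVert u w₁, (0 : ℝ))) '' unitCovectors i ε) :=
    (isCompact_unitCovectors i ε).image ((continuous_horVert.comp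
      (continuous_id.prodMk continuous_const)).prodMk continuous_const)
  have hA : ContDiff ℝ ∞ fun x => dexp G (scaleParam x) := (contDiff_dexp hG).comp contDiff_scaleParam
  have ht : ContDiff ℝ ∞ fun x : Model n × ℝ => turn i x.1 := by
    have h : ContDiff ℝ ∞ (turn (n := n) i) := ContinuousLinearMap.contDiff _
    exact h.comp contDiff_fst
  have hf : ContDiff ℝ ∞ fun x : Model n × ℝ => turnForm i x.1 := by
    have h : ContDiff ℝ ∞ (turnForm (n := n) i) := ContinuousLinearMap.contDiff _
    exact h.comp contDiff_fst
  have hs0 : ∀ u : Fin (2 * n) → ℝ, scaleParam (horVert u w₁, (0 : ℝ)) = (horVert u w₁, 0) :=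
    fun u => by simp [scaleParam]
  have hxlt : ∀ u ∈ unitCovectors i ε, ‖horVert u w₁‖ < R := fun u hu =>
    norm_horVert_lt hu hpos.le (by linarith : w₁ + 1 < R)
  have hz : ∀ u : Fin (2 * n) → ℝ, zc (horVert u w₁) * Fr.b i = 2 * π := fun u => by
    rw [zc_horVert, hw₁]
  have hr : ∀ u ∈ unitCovectors i ε, pairSq i (horVert u w₁) ≠ 0 := fun u hu => by
    rw [pairSq_horVert]; exact (hε.trans_le hu.2).ne'
  have hbor : ∀ u ∈ unitCovectors i ε, Injective (bordered (dexp G (scaleParam (horVert u w₁, 0)))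
      (turn i (horVert u w₁)) (turnForm i (horVert u w₁))) := fun u hu => by
    rw [hs0]
    exact Fr.bordered_dexp_injective hG hnil (hxlt u hu) (hz u) hlt (hr u hu)
  have hconj : ∀ x, Injective (bordered (dexp G (scaleParam x)) (turn i x.1) (turnForm i x.1)) →
      ContDiffAt ℝ ∞ (conj G i) x := fun x hx => (contDiffAt_borderedSol hA ht hf hx).snd
  obtain ⟨ρ₁, hρ₁, hbor'⟩ := hK.exists_pos_forall_dist_lt
    (p := fun x => Injective (bordered (dexp G (scaleParam x)) (turn i x.1) (turnForm i x.1))) (by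
      rintro _ ⟨u, hu, rfl⟩
      exact (contDiff_bordered hA ht hf).continuous.continuousAt.eventually
        (ContinuousLinearMap.isOpen_injective.mem_nhds (hbor u hu)))
  obtain ⟨C₁, hC₁, ρ₂, hρ₂, hexp⟩ := Fr.exists_exp_expansion hG hnil hvar hw₁ hR (ε := ε)
  have hez : ∀ u ∈ unitCovectors i ε, fderiv ℝ (conj G i) (horVert u w₁, 0) (ez, 0) =
      -1 / (w₁ * (u (oddIdx i) ^ 2 + u (evenIdx i) ^ 2)) := fun u hu => by
    rw [Fr.fderiv_conj_ez hG hnil (hxlt u hu) (hz u) hlt (hr u hu), zc_horVert, pairSq_horVert]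
  -- By implicit differentiation the zero near w₁ is w₁ minus η times this ratio, to first order.
  have hpar : ∀ u ∈ unitCovectors i ε, fderiv ℝ (conj G i) (horVert u w₁, 0) (0, 1) /
      fderiv ℝ (conj G i) (horVert u w₁, 0) (ez, 0) = Fr.timeCoef w₁ i u := fun u hu => by
    have h1 := hr u hu
    rw [pairSq_horVert] at h1
    rw [hez u hu, Fr.fderiv_conj_param hG hnil hvar (hxlt u hu) (hz u) hlt (hr u hu), zc_horVert,
      pairSq_horVert, xc_horVert, xc_horVert, turnVar_horVert, turnVar_horVert, timeCoef]
    field_simp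
  obtain ⟨δ, ⟨hδ0, hδρ⟩, C₂, hC₂, η₁, hη₁, hzero⟩ := hK.exists_zero_expansion (f := conj G i)
    (by
      rintro _ ⟨u, hu, rfl⟩
      exact contDiffAt_infty.1 (hconj _ (hbor u hu)) 2)
    (by
      rintro _ ⟨u, hu, rfl⟩
      refine (borderedSol_snd_eq_zero_iff (hbor u hu)).2 fun hinj => hr u hu ?_
      have hD := hasFDerivAt_dexp hG (horVert u w₁) 0
      rw [hs0] at hinj
      have h1 := period_turn hD (Fr.eventually_eq_nilY hnil (hxlt u hu)) (hz u) Fr.b_pos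
      have h2 := hinj (h1.trans (map_zero _).symm)
      rw [← turnForm_turn, h2, map_zero])
    (u := ((ez : Model n), (0 : ℝ))) (v := ((0 : Model n), (1 : ℝ)))
    (by
      rintro _ ⟨u, hu, rfl⟩
      have h1 := hr u hu
      rw [pairSq_horVert] at h1
      rw [hez u hu]
      exact div_ne_zero (by norm_num) (mul_ne_zero hpos.ne' h1))
    -- `ρ₁` keeps the bordered map invertible, `ρ₂` the expansion of the endpoint valid, `w₁ / 2`
    -- keeps w positive and `1 / 2` keeps it below `w₁ + 1`.
    (ρ := min (min ρ₁ ρ₂) (min (w₁ / 2) (1 / 2))) (by positivity)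
  simp only [lt_min_iff] at hδρ
  obtain ⟨⟨hδ1, hδ2⟩, hδw, hδ12⟩ := hδρ
  obtain ⟨η₂, hη₂, hearly⟩ := Fr.exists_forall_injective hG hnil hw₁ hR hlt (ε := ε) hδ0
  obtain ⟨B, hB, hBle⟩ : ∃ B ≥ 0, ∀ u ∈ unitCovectors i ε, ∀ k, (k = oddIdx i ∨ k = evenIdx i) →
      |Fr.varForm w₁ k (hvec u) (hvec u)| ≤ B := by
    obtain ⟨B₁, h1⟩ := (isCompact_unitCovectors i ε).exists_bound_of_continuousOn
      (Fr.continuous_varForm_hvec w₁ (oddIdx i)).continuousOn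
    obtain ⟨B₂, h2⟩ := (isCompact_unitCovectors i ε).exists_bound_of_continuousOn
      (Fr.continuous_varForm_hvec w₁ (evenIdx i)).continuousOn
    refine ⟨max 0 (max B₁ B₂), le_max_left _ _, fun u hu k hk => ?_⟩
    rcases hk with rfl | rfl
    · exact (h1 u hu).trans ((le_max_left _ _).trans (le_max_right _ _))
    · exact (h2 u hu).trans ((le_max_right _ _).trans (le_max_right _ _))
  -- The four summands bound the four terms of the decomposition `hdec` below.
  refine ⟨(w₁ + 1) * (C₁ * (C₂ + 1) ^ 2) + C₂ + C₂ ^ 2 / w₁ + C₂ * w₁ * B, by positivity,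
    min (min η₁ η₂) (min ρ₁ ρ₂), by positivity, fun η hη u hu => ?_⟩
  have hη0 := hη.1
  have hη' := hη.2
  simp only [lt_min_iff] at hη'
  obtain ⟨⟨hη1, hη2⟩, hηρ1, hηρ2⟩ := hη'
  have hy : ∀ s : ℝ, ((horVert u w₁, (0 : ℝ)) + (s • ((ez : Model n), (0 : ℝ)) +
      η • ((0 : Model n), (1 : ℝ)))) = (horVert u (w₁ + s), η) := fun s => by
    rw [← horVert_add_smul]; simp
  have hsy : ∀ w, scaleParam (horVert u w, η) = (horVert u w, η * w) := fun w =>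
    scaleParam_horVert u w η
  have hinjb : ∀ s ∈ Icc (-δ) δ, Injective (bordered (dexp G (scaleParam (horVert u (w₁ + s), η)))
      (turn i (horVert u (w₁ + s))) (turnForm i (horVert u (w₁ + s)))) := fun s hs =>
    hbor' _ ⟨u, hu, rfl⟩ (horVert u (w₁ + s), η) (by
      rw [← horVert_add_smul, Prod.dist_eq, dist_eq_norm, dist_eq_norm, add_sub_cancel_left,
        norm_smul, norm_ez, mul_one, norm_eq_abs, sub_zero, norm_eq_abs, abs_of_pos hη0]
      exact max_lt ((abs_le.2 hs).trans_lt hδ1) hηρ1)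
  have hiff : ∀ s ∈ Icc (-δ) δ, (conj G i (horVert u (w₁ + s), η) = 0 ↔
      ¬Injective (dexp G (horVert u (w₁ + s), η * (w₁ + s)))) := fun s hs => by
    rw [← hsy]; exact borderedSol_snd_eq_zero_iff (hinjb s hs)
  obtain ⟨⟨s₀, hs₀, hzs₀⟩, hbound⟩ := hzero _ ⟨u, hu, rfl⟩ η ⟨hη0, hη1⟩
  simp only [hy] at hzs₀ hbound
  have hcont : ContinuousOn (fun s => conj G i (horVert u (w₁ + s), η)) (Icc (-δ) δ) := fun s hs => by
    have h1 := (hconj _ (hinjb s hs)).continuousAt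
    have h2 : Continuous fun s : ℝ => (horVert u (w₁ + s), η) :=
      (continuous_horVert.comp (continuous_const.prodMk (continuous_const.add continuous_id))).prodMk
        continuous_const
    exact (h1.comp (f := fun s : ℝ => (horVert u (w₁ + s), η)) h2.continuousAt).continuousWithinAt
  -- Zeros in the window need not be known to be unique: compactness gives a least one, and earlier
  -- parameters are excluded by `hearly`.
  have hZ : IsCompact (Icc (-δ) δ ∩ (fun s => conj G i (horVert u (w₁ + s), η)) ⁻¹' {0}) :=
    isCompact_Icc.of_isClosed_subset (hcont.preimage_isClosed_of_isClosed isClosed_Icc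
      isClosed_singleton) inter_subset_left
  obtain ⟨s, ⟨hs, hzs⟩, hmin⟩ := hZ.exists_isLeast ⟨s₀, hs₀, hzs₀⟩
  have hzs' : conj G i (horVert u (w₁ + s), η) = 0 := hzs
  refine ⟨w₁ + s, ⟨by linarith [hs.1], by linarith [hs.2]⟩, (hiff s hs).1 hzs', fun w' hw' => ?_,
    fun k hk => ?_⟩
  · rcases le_or_gt w' (w₁ - δ) with hle | hgt
    · exact hearly η ⟨hη0, hη2⟩ u hu w' ⟨hw'.1, hle⟩
    · by_contra hninj
      have hs' : w' - w₁ ∈ Icc (-δ) δ := ⟨by linarith, by linarith [hw'.2, hs.2]⟩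
      have h1 : conj G i (horVert u (w₁ + (w' - w₁)), η) = 0 :=
        (hiff _ hs').2 (by rw [add_sub_cancel]; exact hninj)
      have := hmin ⟨hs', h1⟩
      linarith [hw'.2]
  · obtain ⟨hb1, hb2⟩ := hbound s hs hzs'
    rw [hpar u hu] at hb1
    have hE := hexp u hu s η ((abs_le.2 hs).trans_lt hδ2) (by rwa [abs_of_pos hη0]) k hk
    have hBk := hBle u hu k hk
    have huk := abs_le_one_of_mem hu k
    rw [pointCoef]
    rw [abs_of_pos hη0] at hE
    set T := Fr.timeCoef w₁ i u
    set Q := Fr.varForm w₁ k (hvec u) (hvec u)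
    set g := xc k (G (horVert u (w₁ + s), η * (w₁ + s)))
    -- Substituting the expansion of the endpoint and s ≈ -ηT leaves only terms of order η³.
    have hdec : η * (w₁ + s) * g - η ^ 2 * (w₁ ^ 2 * Q - u k * T) =
        η * ((w₁ + s) * (g - (s * (u k / w₁) + η * (w₁ * Q)))) + η * (u k * (s + η * T))
          + η * (s ^ 2 * (u k / w₁)) + η ^ 2 * (s * (w₁ * Q)) := by
      field_simp
      ring
    have hwb : |w₁ + s| ≤ w₁ + 1 := by
      rw [abs_of_pos (by linarith [hs.1])]; linarith [hs.2]
    have hE' : |g - (s * (u k / w₁) + η * (w₁ * Q))| ≤ C₁ * (C₂ + 1) ^ 2 * η ^ 2 :=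
      hE.trans (by
        calc _ ≤ C₁ * (C₂ * η + η) ^ 2 := by gcongr
          _ = _ := by ring)
    rw [hdec]
    calc _ ≤ |η * ((w₁ + s) * (g - (s * (u k / w₁) + η * (w₁ * Q))))| + |η * (u k * (s + η * T))|
          + |η * (s ^ 2 * (u k / w₁))| + |η ^ 2 * (s * (w₁ * Q))| :=
          (abs_add_le _ _).trans (add_le_add_left ((abs_add_le _ _).trans
            (add_le_add_left (abs_add_le _ _) _)) _)
      _ ≤ η * ((w₁ + 1) * (C₁ * (C₂ + 1) ^ 2 * η ^ 2)) + η * (1 * (C₂ * η ^ 2))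
          + η * ((C₂ * η) ^ 2 * (1 / w₁)) + η ^ 2 * (C₂ * η * (w₁ * B)) := by
          simp only [abs_mul, abs_pow, abs_div, abs_of_pos hη0, abs_of_pos hpos]
          gcongr
      _ = _ := by ring

end RescaledFrame

end ConjugateLocus

/-! ### The coefficients κ, γ, δ and the final polynomials. -/

section Invariants

open Real

variable {n : ℕ}

namespace RescaledFrame

variable (Fr : RescaledFrame n)

/-- The coefficients of the quadratic form `u ↦ w² B_k(u, u)`. -/
noncomputable def quadCoef (w : ℝ) (i j k : Fin (2 * n)) : ℝ :=
  w ^ 2 * if i = j then Fr.varForm w k (ex i) (ex i)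
    else Fr.varForm w k (ex i) (ex j) + Fr.varForm w k (ex j) (ex i)

theorem quadCoef_self (w : ℝ) (i k : Fin (2 * n)) :
    Fr.quadCoef w i i k = w ^ 2 * Fr.varForm w k (ex i) (ex i) := by
  rw [quadCoef, if_pos rfl]

theorem quadCoef_of_ne (w : ℝ) {i j : Fin (2 * n)} (h : i ≠ j) (k : Fin (2 * n)) :
    Fr.quadCoef w i j k =
      w ^ 2 * (Fr.varForm w k (ex i) (ex j) + Fr.varForm w k (ex j) (ex i)) := by
  rw [quadCoef, if_neg h]

theorem varForm_hvec (w : ℝ) (k : Fin (2 * n)) (u v : Fin (2 * n) → ℝ) :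
    Fr.varForm w k (hvec u) (hvec v) = ∑ i, ∑ j, u i * v j * Fr.varForm w k (ex i) (ex j) := by
  simp only [hvec, map_sum, map_smul, LinearMap.sum_apply, LinearMap.smul_apply, smul_eq_mul,
    Finset.mul_sum]
  rw [Finset.sum_comm]
  exact Finset.sum_congr rfl fun i _ => Finset.sum_congr rfl fun j _ => by ring

theorem sum_quadCoef (w : ℝ) (k : Fin (2 * n)) (u : Fin (2 * n) → ℝ) :
    (∑ i, ∑ j, if i ≤ j then Fr.quadCoef w i j k * u i * u j else 0) =
      w ^ 2 * Fr.varForm w k (hvec u) (hvec u) := by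
  have h1 : ∀ i j : Fin (2 * n), (if i ≤ j then Fr.quadCoef w i j k * u i * u j else 0) =
      w ^ 2 * (if i ≤ j then u i * u j * Fr.varForm w k (ex i) (ex j) else 0) +
      w ^ 2 * (if i < j then u j * u i * Fr.varForm w k (ex j) (ex i) else 0) := fun i j => by
    rcases lt_trichotomy i j with h | h | h
    · rw [if_pos h.le, if_pos h.le, if_pos h, quadCoef_of_ne _ _ h.ne]; ring
    · subst h
      rw [if_pos le_rfl, if_pos le_rfl, if_neg (lt_irrefl _), quadCoef_self]; ring
    · rw [if_neg h.not_ge, if_neg h.not_ge, if_neg h.not_gt]; ring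
  simp only [h1, Finset.sum_add_distrib, ← Finset.mul_sum]
  rw [Finset.sum_comm (f := fun i j => if i < j then u j * u i * Fr.varForm w k (ex j) (ex i) else 0),
    ← mul_add, ← Finset.sum_add_distrib, varForm_hvec]
  congr 1
  refine Finset.sum_congr rfl fun i _ => ?_
  rw [← Finset.sum_add_distrib]
  refine Finset.sum_congr rfl fun j _ => ?_
  rcases lt_or_ge j i with h | h
  · rw [if_neg h.not_ge, if_pos h, zero_add]
  · rw [if_pos h, if_neg h.not_gt, add_zero]

variable [NeZero n]

/-- The components of a covector outside of the first pair. -/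
noncomputable def restVec (u : Fin (2 * n) → ℝ) : Model n := hvec fun k => if 2 ≤ k.val then u k else 0

theorem oddIdx_zero_val : (oddIdx (0 : Fin n)).val = 0 := by simp [oddIdx]

theorem evenIdx_zero_val : (evenIdx (0 : Fin n)).val = 1 := by simp [evenIdx]

theorem not_two_le_iff (k : Fin (2 * n)) : ¬2 ≤ k.val ↔ k = oddIdx 0 ∨ k = evenIdx 0 := by
  rw [Fin.ext_iff, Fin.ext_iff, oddIdx_zero_val, evenIdx_zero_val]
  omega

theorem hvec_eq_add_restVec (u : Fin (2 * n) → ℝ) :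
    hvec u = u (oddIdx 0) • ex (oddIdx 0) + u (evenIdx 0) • ex (evenIdx 0) + restVec u := by
  refine model_ext (fun k => ?_) ?_
  · rw [restVec]
    simp only [map_add, map_smul, xc_hvec, xc_ex, smul_eq_mul]
    by_cases hk : 2 ≤ k.val
    · have h1 : k ≠ oddIdx 0 := fun h => (not_two_le_iff k).2 (Or.inl h) hk
      have h2 : k ≠ evenIdx 0 := fun h => (not_two_le_iff k).2 (Or.inr h) hk
      simp [hk, h1, h2]
    · rw [if_neg hk]
      rcases (not_two_le_iff k).1 hk with rfl | rfl <;> simp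
  · rw [restVec]
    simp only [map_add, map_smul, zc_hvec, zc_ex, smul_zero, add_zero]

omit [NeZero n] in
theorem varForm_restVec (w : ℝ) (k : Fin (2 * n)) (u : Fin (2 * n) → ℝ) (v : Model n) :
    Fr.varForm w k v (restVec u) = (∑ j, if 2 ≤ j.val then u j * Fr.varForm w k v (ex j) else 0) ∧
    Fr.varForm w k (restVec u) v = ∑ j, if 2 ≤ j.val then u j * Fr.varForm w k (ex j) v else 0 := by
  constructor <;>
  · simp only [restVec, hvec, map_sum, map_smul, LinearMap.sum_apply, LinearMap.smul_apply, smul_eq_mul]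
    refine Finset.sum_congr rfl fun j _ => ?_
    split_ifs <;> simp

theorem gammaCoef_quadCoef (w : ℝ) (u : Fin (2 * n) → ℝ) (i : Fin (2 * n)) {j : Fin (2 * n)}
    (hj : j = oddIdx 0 ∨ j = evenIdx 0) : gammaCoef (Fr.quadCoef w) u i j =
      w ^ 2 * (Fr.varForm w i (ex j) (restVec u) + Fr.varForm w i (restVec u) (ex j)) := by
  rw [(Fr.varForm_restVec w i u _).1, (Fr.varForm_restVec w i u _).2, ← Finset.sum_add_distrib,
    Finset.mul_sum, gammaCoef]
  refine Finset.sum_congr rfl fun k _ => ?_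
  by_cases hk : 2 ≤ k.val
  · have hne : j ≠ k := fun h => (not_two_le_iff j).2 hj (h ▸ hk)
    rw [if_pos hk, if_pos hk, if_pos hk, quadCoef_of_ne _ _ hne]; ring
  · rw [if_neg hk, if_neg hk, if_neg hk]; ring

theorem deltaCoef_quadCoef (w a : ℝ) (u : Fin (2 * n) → ℝ) (m : Fin (2 * n)) :
    deltaCoef (Fr.quadCoef w) a u m = a * (u (oddIdx 0) ^ 2 + u (evenIdx 0) ^ 2) ^ 2 +
      (u (oddIdx 0) ^ 2 + u (evenIdx 0) ^ 2) *
        (w ^ 2 * Fr.varForm w m (restVec u) (restVec u)) := by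
  rw [deltaCoef]
  have h := Fr.sum_quadCoef w m fun k => if 2 ≤ k.val then u k else 0
  rw [← restVec] at h
  rw [← h]
  congr 2
  refine Finset.sum_congr rfl fun i _ => Finset.sum_congr rfl fun j _ => ?_
  by_cases hi : 2 ≤ i.val
  · by_cases hij : i ≤ j
    · have hj : 2 ≤ j.val := hi.trans hij
      simp [hi, hij, hj]
    · simp [hij]
  · simp [hi]

section Period

variable {w : ℝ} (hw : w * Fr.b 0 = 2 * π)
include hw

theorem quadCoef_relations :
    Fr.quadCoef w (oddIdx 0) (oddIdx 0) (oddIdx 0) =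
      3 * Fr.quadCoef w (evenIdx 0) (evenIdx 0) (oddIdx 0) ∧
    Fr.quadCoef w (oddIdx 0) (evenIdx 0) (evenIdx 0) =
      2 * Fr.quadCoef w (evenIdx 0) (evenIdx 0) (oddIdx 0) ∧
    Fr.quadCoef w (evenIdx 0) (evenIdx 0) (evenIdx 0) =
      3 * Fr.quadCoef w (oddIdx 0) (oddIdx 0) (evenIdx 0) ∧
    Fr.quadCoef w (oddIdx 0) (evenIdx 0) (oddIdx 0) =
      2 * Fr.quadCoef w (oddIdx 0) (oddIdx 0) (evenIdx 0) := by
  have h1 := Fr.varForm_odd_diag hw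
  have h2 := Fr.varForm_even_diag hw
  have h3 := Fr.varForm_exchange hw (ex (oddIdx 0))
  have h4 := Fr.varForm_exchange hw (ex (evenIdx 0))
  simp only [quadCoef_self, quadCoef_of_ne _ _ (oddIdx_ne_evenIdx (0 : Fin n) 0)]
  refine ⟨?_, ?_, ?_, ?_⟩
  · rw [h1]; ring
  · linear_combination w ^ 2 * h4
  · rw [h2]; ring
  · linear_combination -w ^ 2 * h3

/-- Splitting the covector into its first pair and the rest, the two diagonal relations and the
exchange relation at `ex (oddIdx 0)`, `ex (evenIdx 0)` and `restVec u` eliminate five coefficients;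
what remains is an identity of rational functions. -/
theorem pointCoef_eq (u : Fin (2 * n) → ℝ) (hr : u (oddIdx 0) ^ 2 + u (evenIdx 0) ^ 2 ≠ 0) :
    Fr.pointCoef w 0 u (oddIdx 0) = 1 / (u (oddIdx 0) ^ 2 + u (evenIdx 0) ^ 2) *
      ((gammaCoef (Fr.quadCoef w) u (oddIdx 0) (oddIdx 0)
          - gammaCoef (Fr.quadCoef w) u (evenIdx 0) (evenIdx 0)) * u (oddIdx 0) ^ 3
        + gammaCoef (Fr.quadCoef w) u (oddIdx 0) (evenIdx 0) * u (evenIdx 0) ^ 3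
        + (gammaCoef (Fr.quadCoef w) u (evenIdx 0) (oddIdx 0)
          + 2 * gammaCoef (Fr.quadCoef w) u (oddIdx 0) (evenIdx 0)) * u (oddIdx 0) ^ 2 * u (evenIdx 0)
        + deltaCoef (Fr.quadCoef w) (Fr.quadCoef w (evenIdx 0) (evenIdx 0) (oddIdx 0)) u (oddIdx 0)) ∧
    Fr.pointCoef w 0 u (evenIdx 0) = 1 / (u (oddIdx 0) ^ 2 + u (evenIdx 0) ^ 2) *
      (gammaCoef (Fr.quadCoef w) u (oddIdx 0) (evenIdx 0) * u (oddIdx 0) ^ 3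
        - (gammaCoef (Fr.quadCoef w) u (oddIdx 0) (oddIdx 0)
          - gammaCoef (Fr.quadCoef w) u (evenIdx 0) (evenIdx 0)) * u (evenIdx 0) ^ 3
        + (gammaCoef (Fr.quadCoef w) u (oddIdx 0) (evenIdx 0)
          + 2 * gammaCoef (Fr.quadCoef w) u (evenIdx 0) (oddIdx 0)) * u (oddIdx 0) * u (evenIdx 0) ^ 2
        + deltaCoef (Fr.quadCoef w) (Fr.quadCoef w (oddIdx 0) (oddIdx 0) (evenIdx 0)) u
          (evenIdx 0)) := by
  have h1 := Fr.varForm_odd_diag hw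
  have h2 := Fr.varForm_even_diag hw
  have h3 := Fr.varForm_exchange hw (ex (oddIdx 0))
  have h4 := Fr.varForm_exchange hw (ex (evenIdx 0))
  have h5 := Fr.varForm_exchange hw (restVec u)
  simp only [Fr.gammaCoef_quadCoef w u _ (Or.inl rfl), Fr.gammaCoef_quadCoef w u _ (Or.inr rfl),
    deltaCoef_quadCoef, quadCoef_self, pointCoef, timeCoef, turnPolar, turn_apply, xc_hvec]
  rw [hvec_eq_add_restVec u]
  simp only [map_add, map_sub, map_smul, LinearMap.add_apply, LinearMap.sub_apply,
    LinearMap.smul_apply, smul_eq_mul]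
  generalize Fr.varForm w (oddIdx 0) (restVec u) (restVec u) = a1 at *
  generalize Fr.varForm w (evenIdx 0) (restVec u) (restVec u) = a2 at *
  generalize Fr.varForm w (oddIdx 0) (restVec u) (ex (oddIdx 0)) = a3 at *
  generalize Fr.varForm w (oddIdx 0) (restVec u) (ex (evenIdx 0)) = a4 at *
  generalize Fr.varForm w (evenIdx 0) (restVec u) (ex (oddIdx 0)) = a5 at *
  generalize Fr.varForm w (evenIdx 0) (restVec u) (ex (evenIdx 0)) = a6 at *
  generalize Fr.varForm w (oddIdx 0) (ex (oddIdx 0)) (restVec u) = a7 at *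
  generalize Fr.varForm w (oddIdx 0) (ex (evenIdx 0)) (restVec u) = a8 at *
  generalize Fr.varForm w (evenIdx 0) (ex (oddIdx 0)) (restVec u) = a9 at *
  generalize Fr.varForm w (evenIdx 0) (ex (evenIdx 0)) (restVec u) = c1 at *
  generalize Fr.varForm w (oddIdx 0) (ex (oddIdx 0)) (ex (oddIdx 0)) = c2 at *
  generalize Fr.varForm w (oddIdx 0) (ex (oddIdx 0)) (ex (evenIdx 0)) = c3 at *
  generalize Fr.varForm w (oddIdx 0) (ex (evenIdx 0)) (ex (oddIdx 0)) = c4 at *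
  generalize Fr.varForm w (oddIdx 0) (ex (evenIdx 0)) (ex (evenIdx 0)) = c5 at *
  generalize Fr.varForm w (evenIdx 0) (ex (oddIdx 0)) (ex (oddIdx 0)) = c6 at *
  generalize Fr.varForm w (evenIdx 0) (ex (oddIdx 0)) (ex (evenIdx 0)) = c7 at *
  generalize Fr.varForm w (evenIdx 0) (ex (evenIdx 0)) (ex (oddIdx 0)) = c8 at *
  generalize Fr.varForm w (evenIdx 0) (ex (evenIdx 0)) (ex (evenIdx 0)) = c9 at *
  generalize u (oddIdx 0) = p at *
  generalize u (evenIdx 0) = q at *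
  obtain rfl : c2 = 3 * c5 := h1
  obtain rfl : c9 = 3 * c6 := h2
  obtain rfl : c4 = 2 * c6 - c3 := by linarith
  obtain rfl : c8 = 2 * c5 - c7 := by linarith
  obtain rfl : a5 = a8 + a4 - a9 := by linarith
  constructor
  · field_simp
    ring
  · field_simp
    ring

end Period

omit [NeZero n] in
theorem pointCoef_smul (w t : ℝ) (ht : t ≠ 0) (i : Fin n) (u : Fin (2 * n) → ℝ) (k : Fin (2 * n)) :
    Fr.pointCoef w i (t • u) k = t ^ 2 * Fr.pointCoef w i u k := by
  simp only [pointCoef, timeCoef, turnPolar, hvec_smul, map_smul, LinearMap.smul_apply,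
    smul_eq_mul, Pi.smul_apply]
  rw [show (t * u (oddIdx i)) ^ 2 + (t * u (evenIdx i)) ^ 2 =
    t ^ 2 * (u (oddIdx i) ^ 2 + u (evenIdx i) ^ 2) by ring]
  -- When the pair vanishes, division by zero makes both values of `timeCoef` zero, and homogeneity
  -- persists.
  rcases eq_or_ne (u (oddIdx i) ^ 2 + u (evenIdx i) ^ 2) 0 with h | h
  · rw [h]; simp; ring
  · field_simp

end RescaledFrame

end Invariants

/-! ### Tangent and cotangent vectors in charts. -/

section ChartCalculus

variable {n : ℕ} {M : Type*} [TopologicalSpace M] [ChartedSpace (Model n) M]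

/-- The derivative of the chart `φ` at `q`. -/
noncomputable def chartD (φ : OpenPartialHomeomorph M (Model n)) (q : M) : Model n →L[ℝ] Model n :=
  mfderiv (𝓡 (2 * n + 1)) 𝓘(ℝ, Model n) φ q

/-- The derivative of the inverse of the chart `φ` at `y`. -/
noncomputable def chartSymmD (φ : OpenPartialHomeomorph M (Model n)) (y : Model n) :
    Model n →L[ℝ] Model n :=
  mfderiv 𝓘(ℝ, Model n) (𝓡 (2 * n + 1)) φ.symm y

theorem chartCovec_apply (φ : OpenPartialHomeomorph M (Model n)) (q : M) (ξ : Model n →L[ℝ] ℝ)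
    (v : Model n) : chartCovec φ q ξ v = ξ (chartD φ q v) := rfl

theorem chartVec_eq (φ : OpenPartialHomeomorph M (Model n)) (y v : Model n) :
    chartVec φ y v = chartSymmD φ y v := rfl

variable {φ ψ : OpenPartialHomeomorph M (Model n)}

theorem chart_mdifferentiable (hφ : φ ∈ IsManifold.maximalAtlas (𝓡 (2 * n + 1)) ∞ M) :
    φ.MDifferentiable (𝓡 (2 * n + 1)) 𝓘(ℝ, Model n) :=
  ⟨(contMDiffOn_of_mem_maximalAtlas hφ).mdifferentiableOn (by simp),
    (contMDiffOn_symm_of_mem_maximalAtlas hφ).mdifferentiableOn (by simp)⟩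

variable (hφ : φ ∈ IsManifold.maximalAtlas (𝓡 (2 * n + 1)) ∞ M)
  (hψ : ψ ∈ IsManifold.maximalAtlas (𝓡 (2 * n + 1)) ∞ M)
include hφ

theorem chartD_chartSymmD {y : Model n} (hy : y ∈ φ.target) (v : Model n) :
    chartD φ (φ.symm y) (chartSymmD φ y v) = v := by
  have h := congrArg (fun T : Model n →L[ℝ] Model n => T v)
    ((chart_mdifferentiable hφ).comp_symm_deriv hy)
  exact h

theorem chartSymmD_chartD {q : M} (hq : q ∈ φ.source) (v : Model n) :
    chartSymmD φ (φ q) (chartD φ q v) = v := by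
  have h := congrArg (fun T : Model n →L[ℝ] Model n => T v)
    ((chart_mdifferentiable hφ).symm_comp_deriv hq)
  exact h

theorem chartSymmD_chartD' {y : Model n} (hy : y ∈ φ.target) (v : Model n) :
    chartSymmD φ y (chartD φ (φ.symm y) v) = v := by
  have h := chartSymmD_chartD hφ (φ.map_target hy) v
  rwa [φ.right_inv hy] at h

theorem chartCovec_chartVec {y : Model n} (hy : y ∈ φ.target) (ξ : Model n →L[ℝ] ℝ) (v : Model n) :
    chartCovec φ (φ.symm y) ξ (chartVec φ y v) = ξ v := by
  rw [chartVec_eq]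
  exact congrArg ξ (chartD_chartSymmD hφ hy v)

theorem chartCovec_injective {q : M} (hq : q ∈ φ.source) :
    Function.Injective (chartCovec φ q) := fun ξ ξ' h => by
  ext v
  have h1 := congrArg (fun T : Model n →L[ℝ] ℝ => T (chartSymmD φ (φ q) v)) h
  have h2 := chartD_chartSymmD hφ (φ.map_source hq) v
  rw [φ.left_inv hq] at h2
  have h3 : ∀ ξ : Model n →L[ℝ] ℝ, chartCovec φ q ξ (chartSymmD φ (φ q) v) = ξ v := fun ξ => by
    rw [chartCovec_apply, h2]
  exact (h3 ξ).symm.trans (h1.trans (h3 ξ'))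

include hψ in
theorem hasFDerivAt_transition {y : Model n} (hy : y ∈ φ.target) (hy' : φ.symm y ∈ ψ.source) :
    HasFDerivAt (fun z => ψ (φ.symm z)) ((chartD ψ (φ.symm y)).comp (chartSymmD φ y)) y := by
  have h1 : HasMFDerivAt 𝓘(ℝ, Model n) (𝓡 (2 * n + 1)) φ.symm y
      (mfderiv 𝓘(ℝ, Model n) (𝓡 (2 * n + 1)) φ.symm y) :=
    ((chart_mdifferentiable hφ).symm.mdifferentiableAt hy).hasMFDerivAt
  have h2 : HasMFDerivAt (𝓡 (2 * n + 1)) 𝓘(ℝ, Model n) ψ (φ.symm y)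
      (mfderiv (𝓡 (2 * n + 1)) 𝓘(ℝ, Model n) ψ (φ.symm y)) :=
    ((chart_mdifferentiable hψ).mdifferentiableAt hy').hasMFDerivAt
  exact (HasMFDerivAt.comp y h2 h1).hasFDerivAt

include hψ in
theorem contDiffAt_transition {y : Model n} (hy : y ∈ φ.target) (hy' : φ.symm y ∈ ψ.source) :
    ContDiffAt ℝ ∞ (fun z => ψ (φ.symm z)) y := by
  have h1 : ContMDiffAt 𝓘(ℝ, Model n) (𝓡 (2 * n + 1)) ∞ φ.symm y :=
    (contMDiffOn_symm_of_mem_maximalAtlas hφ).contMDiffAt (φ.open_target.mem_nhds hy)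
  have h2 : ContMDiffAt (𝓡 (2 * n + 1)) 𝓘(ℝ, Model n) ∞ ψ (φ.symm y) :=
    (contMDiffOn_of_mem_maximalAtlas hψ).contMDiffAt (ψ.open_source.mem_nhds hy')
  exact (ContMDiffAt.comp y h2 h1).contDiffAt

include hψ in
theorem chartCovec_change {q : M} (hq : q ∈ φ.source) (hq' : q ∈ ψ.source)
    (ξ : Model n →L[ℝ] ℝ) :
    chartCovec ψ q ξ = chartCovec φ q (ξ.comp (fderiv ℝ (fun z => ψ (φ.symm z)) (φ q))) := by
  have h := (hasFDerivAt_transition hφ hψ (φ.map_source hq) (by rwa [φ.left_inv hq])).fderiv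
  rw [φ.left_inv hq] at h
  have key : ∀ v : Model n, ξ (chartD ψ q v) =
      ξ.comp (fderiv ℝ (fun z => ψ (φ.symm z)) (φ q)) (chartD φ q v) := fun v => by
    rw [h]
    simp only [ContinuousLinearMap.comp_apply]
    rw [chartSymmD_chartD hφ hq]
  exact ContinuousLinearMap.ext key

end ChartCalculus

/-! ### The Hamiltonian in terms of an orthonormal frame. -/

section HamiltonianOfFrame

variable {n : ℕ}

/-- The Hamiltonian of the frame `X`. -/
noncomputable def frameHam (X : Fin (2 * n) → Model n → Model n) (y : Model n)
    (ξ : Model n →L[ℝ] ℝ) : ℝ := 1 / 2 * ∑ i, ξ (X i y) ^ 2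

/-- Cauchy–Schwarz, with equality at the vector Σ p(e_i) e_i dual to `p`. -/
theorem iSup_sq_div_eq_sum {ι V : Type*} [Fintype ι] [DecidableEq ι] [AddCommGroup V] [Module ℝ V]
    (g : LinearMap.BilinForm ℝ V) (e : ι → V) (hspan : Submodule.span ℝ (Set.range e) = ⊤)
    (hg : ∀ i j, g (e i) (e j) = if i = j then 1 else 0) (p : V →ₗ[ℝ] ℝ) :
    ⨆ v : {v : V // v ≠ 0}, p v.1 ^ 2 / g v.1 v.1 = ∑ i, p (e i) ^ 2 := by
  have hrep : ∀ v, ∃ a : ι → ℝ, v = ∑ i, a i • e i := fun v => by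
    have hv : v ∈ Submodule.span ℝ (Set.range e) := by rw [hspan]; trivial
    obtain ⟨a, ha⟩ := (Submodule.mem_span_range_iff_exists_fun ℝ).1 hv
    exact ⟨a, ha.symm⟩
  have hgv : ∀ a : ι → ℝ, g (∑ i, a i • e i) (∑ i, a i • e i) = ∑ i, a i ^ 2 := fun a => by
    simp only [map_sum, map_smul, LinearMap.sum_apply, LinearMap.smul_apply, hg, smul_eq_mul]
    simp [sq]
  have hpv : ∀ a : ι → ℝ, p (∑ i, a i • e i) = ∑ i, a i * p (e i) := fun a => by
    simp only [map_sum, map_smul, smul_eq_mul]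
  have hle : ∀ v : {v : V // v ≠ 0}, p v.1 ^ 2 / g v.1 v.1 ≤ ∑ i, p (e i) ^ 2 := by
    rintro ⟨v, hv⟩
    obtain ⟨a, rfl⟩ := hrep v
    dsimp only
    rw [hgv, hpv]
    have hpos : 0 < ∑ i, a i ^ 2 := by
      refine lt_of_le_of_ne (Finset.sum_nonneg fun _ _ => sq_nonneg _) fun h => hv ?_
      have := (Finset.sum_eq_zero_iff_of_nonneg fun _ _ => sq_nonneg _).1 h.symm
      exact Finset.sum_eq_zero fun i hi => by rw [pow_eq_zero_iff two_ne_zero |>.1 (this i hi), zero_smul]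
    rw [div_le_iff₀ hpos, mul_comm]
    exact Finset.sum_mul_sq_le_sq_mul_sq _ _ _
  refine le_antisymm (Real.iSup_le hle (Finset.sum_nonneg fun _ _ => sq_nonneg _)) ?_
  -- The extremal vector is zero exactly here; then `p = 0`, and the supremum is 0 even if there are
  -- no nonzero vectors.
  by_cases h0 : ∑ i, p (e i) ^ 2 = 0
  · rw [h0]
    have hp0 : ∀ v, p v = 0 := fun v => by
      obtain ⟨a, rfl⟩ := hrep v
      rw [hpv]
      have := (Finset.sum_eq_zero_iff_of_nonneg fun i _ => sq_nonneg (p (e i))).1 h0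
      exact Finset.sum_eq_zero fun i hi => by rw [pow_eq_zero_iff two_ne_zero |>.1 (this i hi), mul_zero]
    simp [hp0]
  · have hv : ∑ i, p (e i) • e i ≠ 0 := fun h => h0 (by
      have := hpv fun i => p (e i)
      rw [h, map_zero] at this
      simpa [sq] using this.symm)
    have hb : BddAbove (Set.range fun v : {v : V // v ≠ 0} => p v.1 ^ 2 / g v.1 v.1) :=
      ⟨_, by rintro _ ⟨v, rfl⟩; exact hle v⟩
    have := le_ciSup hb ⟨∑ i, p (e i) • e i, hv⟩
    dsimp only at this
    rw [hgv, hpv] at this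
    refine le_trans (le_of_eq ?_) this
    rw [eq_div_iff h0]
    simp only [sq]

variable {M : Type*} [TopologicalSpace M] [ChartedSpace (Model n) M]
  (S : ContactSubRiemannian n M) {φ : OpenPartialHomeomorph M (Model n)}
  {X : Fin (2 * n) → Model n → Model n}

theorem ham_eq_sum (hX : IsOrthonormalFrame S.Δ S.g φ X) {y : Model n} (hy : y ∈ φ.target)
    (p : TangentSpace (𝓡 (2 * n + 1)) (φ.symm y) →L[ℝ] ℝ) :
    S.ham (φ.symm y) p = 1 / 2 * ∑ i, p (chartVec φ y (X i y)) ^ 2 := by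
  obtain ⟨hspan, hmem, hg⟩ := hX.2 y hy
  have h := iSup_sq_div_eq_sum (S.g (φ.symm y))
    (fun i => (⟨_, hmem i⟩ : S.Δ (φ.symm y))) (by
      apply Submodule.map_injective_of_injective (S.Δ (φ.symm y)).injective_subtype
      rw [Submodule.map_span, Submodule.map_subtype_top, ← Set.range_comp]
      exact hspan) hg
    ((p : TangentSpace (𝓡 (2 * n + 1)) (φ.symm y) →ₗ[ℝ] ℝ).comp (S.Δ (φ.symm y)).subtype)
  exact congrArg (fun t => 1 / 2 * t) h

theorem hamChart_eq (hφ : φ ∈ IsManifold.maximalAtlas (𝓡 (2 * n + 1)) ∞ M)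
    (hX : IsOrthonormalFrame S.Δ S.g φ X) {y : Model n} (hy : y ∈ φ.target)
    (ξ : Model n →L[ℝ] ℝ) : S.hamChart φ y ξ = frameHam X y ξ := by
  rw [ContactSubRiemannian.hamChart, ham_eq_sum S hX hy, frameHam]
  simp only [chartCovec_chartVec hφ hy]

end HamiltonianOfFrame

/-! ### Invariance of Hamilton's equations under changes of charts. -/

section ExtremalsInCharts

open Set

variable {n : ℕ}

theorem hasFDerivAt_frameHam_momentum (X : Fin (2 * n) → Model n → Model n) (y : Model n)
    (A : Model n →L[ℝ] Model n) (ξ : Model n →L[ℝ] ℝ) :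
    HasFDerivAt (fun ξ₁ : Model n →L[ℝ] ℝ => frameHam X y (ξ₁.comp A))
      (∑ i, ξ (A (X i y)) • ContinuousLinearMap.apply ℝ ℝ (A (X i y))) ξ := by
  have h1 : ∀ i : Fin (2 * n), HasFDerivAt (fun ξ₁ : Model n →L[ℝ] ℝ => ξ₁ (A (X i y)))
      (ContinuousLinearMap.apply ℝ ℝ (A (X i y))) ξ := fun i =>
    (ContinuousLinearMap.apply ℝ ℝ (A (X i y))).hasFDerivAt
  have h2 := (HasFDerivAt.fun_sum (u := Finset.univ) fun (i : Fin (2 * n)) _ => (h1 i).pow 2).const_mul (1 / 2)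
  refine HasFDerivAt.congr_fderiv h2 ?_
  rw [Finset.smul_sum]
  refine Finset.sum_congr rfl fun i _ => ?_
  rw [smul_smul]
  congr 1
  norm_num
  ring

theorem hasFDerivAt_half_sum_sq {Z : Fin (2 * n) → Model n → Model n} {y : Model n}
    {Z' : Fin (2 * n) → Model n →L[ℝ] Model n} (hZ : ∀ i, HasFDerivAt (Z i) (Z' i) y)
    (ξ : Model n →L[ℝ] ℝ) : HasFDerivAt (fun y₁ => frameHam Z y₁ ξ)
      (∑ i, ξ (Z i y) • ξ.comp (Z' i)) y := by
  have h1 : ∀ i : Fin (2 * n), HasFDerivAt (fun y₁ => ξ (Z i y₁)) (ξ.comp (Z' i)) y := fun i =>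
    ξ.hasFDerivAt.comp y (hZ i)
  have h2 := (HasFDerivAt.fun_sum (u := Finset.univ) fun (i : Fin (2 * n)) _ => (h1 i).pow 2).const_mul (1 / 2)
  refine HasFDerivAt.congr_fderiv h2 ?_
  rw [Finset.smul_sum]
  refine Finset.sum_congr rfl fun i _ => ?_
  rw [smul_smul]
  congr 1
  norm_num
  ring

/-- The Hamiltonian vector field of a frame. -/
noncomputable def frameField (X : Fin (2 * n) → Model n → Model n) (p : RescaledFrame.Phase n) : RescaledFrame.Phase n :=
  (∑ i, p.2 (X i p.1) • X i p.1, -∑ i, p.2 (X i p.1) • p.2.comp (fderiv ℝ (X i) p.1))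

/-- The second derivatives of a local diffeomorphism and of its inverse. -/
theorem second_deriv_inverse {τ σ : Model n → Model n} {y : Model n} (hτ : ContDiffAt ℝ ∞ τ y)
    (hσ : ContDiffAt ℝ ∞ σ (τ y)) (hinv : ∀ᶠ z in 𝓝 y, σ (τ z) = z)
    (hinv' : ∀ᶠ z in 𝓝 (τ y), τ (σ z) = z) (u v : Model n) :
    fderiv ℝ (fderiv ℝ σ) (τ y) (fderiv ℝ τ y u) v =
      -fderiv ℝ σ (τ y) (fderiv ℝ (fderiv ℝ τ) y (fderiv ℝ σ (τ y) v) u) := by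
  have hτd : ∀ᶠ z in 𝓝 y, DifferentiableAt ℝ τ z :=
    ((contDiffAt_infty.1 hτ 1).eventually (by simp)).mono fun z hz => hz.differentiableAt (by simp)
  have hσd : ∀ᶠ z in 𝓝 (τ y), DifferentiableAt ℝ σ z :=
    ((contDiffAt_infty.1 hσ 1).eventually (by simp)).mono fun z hz => hz.differentiableAt (by simp)
  have hcont : Filter.Tendsto τ (𝓝 y) (𝓝 (τ y)) := hτ.continuousAt
  have hid : ∀ᶠ z in 𝓝 y, (fderiv ℝ σ (τ z)).comp (fderiv ℝ τ z) =
      ContinuousLinearMap.id ℝ (Model n) := by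
    filter_upwards [hτd, hcont.eventually hσd, hinv.eventually_nhds] with z h1 h2 h3
    have h4 := (h2.hasFDerivAt.comp z h1.hasFDerivAt)
    exact h4.unique ((hasFDerivAt_id z).congr_of_eventuallyEq h3)
  have hid' : (fderiv ℝ τ y).comp (fderiv ℝ σ (τ y)) = ContinuousLinearMap.id ℝ (Model n) := by
    have h3 := hinv.self_of_nhds
    have h1 : HasFDerivAt τ (fderiv ℝ τ y) (σ (τ y)) := by
      rw [h3]; exact hτd.self_of_nhds.hasFDerivAt
    have h4 := h1.comp (τ y) hσd.self_of_nhds.hasFDerivAt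
    exact h4.unique ((hasFDerivAt_id (τ y)).congr_of_eventuallyEq hinv')
  have hτ2 : HasFDerivAt (fderiv ℝ τ) (fderiv ℝ (fderiv ℝ τ) y) y :=
    (((contDiffAt_infty.1 hτ 2).fderiv_right (m := 1) (by norm_num)).differentiableAt (by simp)).hasFDerivAt
  have hσ2 : HasFDerivAt (fderiv ℝ σ) (fderiv ℝ (fderiv ℝ σ) (τ y)) (τ y) :=
    (((contDiffAt_infty.1 hσ 2).fderiv_right (m := 1) (by norm_num)).differentiableAt (by simp)).hasFDerivAt
  have h5 := (hσ2.comp y hτd.self_of_nhds.hasFDerivAt).clm_comp hτ2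
  have h6 := h5.unique ((hasFDerivAt_const (ContinuousLinearMap.id ℝ (Model n)) y).congr_of_eventuallyEq hid)
  have h7 := congrArg (fun T : Model n →L[ℝ] Model n →L[ℝ] Model n => T u (fderiv ℝ σ (τ y) v)) h6
  have h8 : fderiv ℝ τ y (fderiv ℝ σ (τ y) v) = v :=
    congrArg (fun T : Model n →L[ℝ] Model n => T v) hid'
  have hsymm := (contDiffAt_infty.1 hτ 2).isSymmSndFDerivAt (by simp)
  simp [h8] at h7
  rw [hsymm.eq]
  exact eq_neg_of_add_eq_zero_right h7

variable {M : Type*} [TopologicalSpace M] [ChartedSpace (Model n) M]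
  (S : ContactSubRiemannian n M) {φ ψ : OpenPartialHomeomorph M (Model n)}
  {X : Fin (2 * n) → Model n → Model n}
  (hφ : φ ∈ IsManifold.maximalAtlas (𝓡 (2 * n + 1)) ∞ M)
  (hψ : ψ ∈ IsManifold.maximalAtlas (𝓡 (2 * n + 1)) ∞ M)
  (hX : IsOrthonormalFrame S.Δ S.g φ X)

include hφ hψ hX

theorem hamChart_change {z : Model n} (hz : z ∈ ψ.target) (hz' : ψ.symm z ∈ φ.source)
    (ξ : Model n →L[ℝ] ℝ) : S.hamChart ψ z ξ =
      frameHam X (φ (ψ.symm z)) (ξ.comp (fderiv ℝ (fun y => ψ (φ.symm y)) (φ (ψ.symm z)))) := by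
  rw [← hamChart_eq S hφ hX (φ.map_source hz'), ContactSubRiemannian.hamChart,
    ContactSubRiemannian.hamChart, chartCovec_change hφ hψ hz' (ψ.map_target hz)]
  exact congrArg (fun q => S.ham q (chartCovec φ q _)) (φ.left_inv hz').symm

/-- An extremal must satisfy Hamilton's equations in every chart, whereas solutions are constructed
in one. The cotangent lift (y, ξ) ↦ (τ(y), ξ ∘ Dσ), with σ inverse to τ, carries one system to the
other. -/
theorem extremal_change {T : Set ℝ} {s : ℝ} (hs : s ∈ T) {lam : ℝ → CotBundle n M}
    {γ : ℝ → RescaledFrame.Phase n}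
    (hlam : ∀ᶠ r in 𝓝[T] s, (γ r).1 ∈ φ.target ∧
      lam r = ⟨φ.symm (γ r).1, chartCovec φ (φ.symm (γ r).1) (γ r).2⟩)
    (hγ : HasDerivWithinAt γ (frameField X (γ s)) T s) (hsψ : (lam s).1 ∈ ψ.source) :
    ∃ (y : ℝ → Model n) (ξ : ℝ → (Model n →L[ℝ] ℝ)) (y' : Model n) (ξ' : Model n →L[ℝ] ℝ),
      (∀ᶠ r in 𝓝[T] s,
        (lam r).1 ∈ ψ.source ∧ y r = ψ (lam r).1 ∧ (lam r).2 = chartCovec ψ (lam r).1 (ξ r)) ∧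
      HasDerivWithinAt y y' T s ∧ HasDerivWithinAt ξ ξ' T s ∧
      (∀ ζ : Model n →L[ℝ] ℝ, ζ y' = fderiv ℝ (fun ξ₁ => S.hamChart ψ (y s) ξ₁) (ξ s) ζ) ∧
      (∀ v : Model n, ξ' v = -fderiv ℝ (fun y₁ => S.hamChart ψ y₁ (ξ s)) (y s) v) := by
  obtain ⟨hys, hls⟩ := hlam.self_of_nhdsWithin hs
  set τ : Model n → Model n := fun z => ψ (φ.symm z) with hτdef
  set σ : Model n → Model n := fun z => φ (ψ.symm z) with hσdef
  set y₀ := (γ s).1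
  set ξ₀ := (γ s).2
  have hsψ' : φ.symm y₀ ∈ ψ.source := by rw [hls] at hsψ; exact hsψ
  have hψt : τ y₀ ∈ ψ.target := ψ.map_source hsψ'
  have hψφ : ψ.symm (τ y₀) ∈ φ.source := by
    rw [hτdef]; dsimp only; rw [ψ.left_inv hsψ']; exact φ.map_target hys
  have hτ := contDiffAt_transition hφ hψ hys hsψ'
  have hσ := contDiffAt_transition hψ hφ hψt hψφ
  have hστ : ∀ z ∈ φ.target, φ.symm z ∈ ψ.source → σ (τ z) = z := fun z hz hz' => by
    simp only [hτdef, hσdef]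
    rw [ψ.left_inv hz', φ.right_inv hz]
  have hcs : ∀ᶠ z in 𝓝 y₀, z ∈ φ.target ∧ φ.symm z ∈ ψ.source :=
    (φ.open_target.eventually_mem hys).and
      ((φ.continuousAt_symm hys).eventually_mem (ψ.open_source.mem_nhds hsψ'))
  have hct : ∀ᶠ z in 𝓝 (τ y₀), z ∈ ψ.target ∧ ψ.symm z ∈ φ.source :=
    (ψ.open_target.eventually_mem hψt).and
      ((ψ.continuousAt_symm hψt).eventually_mem (φ.open_source.mem_nhds hψφ))
  have hinv : ∀ᶠ z in 𝓝 y₀, σ (τ z) = z := hcs.mono fun z hz => hστ z hz.1 hz.2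
  have hinv' : ∀ᶠ z in 𝓝 (τ y₀), τ (σ z) = z := hct.mono fun z hz => by
    simp only [hτdef, hσdef]
    rw [φ.left_inv hz.2, ψ.right_inv hz.1]
  have hσy : σ (τ y₀) = y₀ := hinv.self_of_nhds
  have hτ1 : HasFDerivAt τ (fderiv ℝ τ y₀) y₀ := (hτ.differentiableAt (by simp)).hasFDerivAt
  have hσ1 : HasFDerivAt σ (fderiv ℝ σ (τ y₀)) (τ y₀) := (hσ.differentiableAt (by simp)).hasFDerivAt
  have hτ2 : HasFDerivAt (fderiv ℝ τ) (fderiv ℝ (fderiv ℝ τ) y₀) y₀ :=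
    (((contDiffAt_infty.1 hτ 2).fderiv_right (m := 1) (by norm_num)).differentiableAt (by simp)).hasFDerivAt
  have hσ2 : HasFDerivAt (fderiv ℝ σ) (fderiv ℝ (fderiv ℝ σ) (τ y₀)) (τ y₀) :=
    (((contDiffAt_infty.1 hσ 2).fderiv_right (m := 1) (by norm_num)).differentiableAt (by simp)).hasFDerivAt
  have hBA : ∀ v, fderiv ℝ σ (τ y₀) (fderiv ℝ τ y₀ v) = v := fun v => by
    have h := (hσ1.comp y₀ hτ1).unique ((hasFDerivAt_id y₀).congr_of_eventuallyEq hinv)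
    exact congrArg (fun T : Model n →L[ℝ] Model n => T v) h
  have hγ1 : HasDerivWithinAt (fun r => (γ r).1) (frameField X (γ s)).1 T s :=
    ((ContinuousLinearMap.fst ℝ (Model n) (Model n →L[ℝ] ℝ)).hasFDerivAt.comp_hasDerivWithinAt s hγ)
  have hγ2 : HasDerivWithinAt (fun r => (γ r).2) (frameField X (γ s)).2 T s :=
    ((ContinuousLinearMap.snd ℝ (Model n) (Model n →L[ℝ] ℝ)).hasFDerivAt.comp_hasDerivWithinAt s hγ)
  have hy' : HasDerivWithinAt (fun r => τ (γ r).1) (fderiv ℝ τ y₀ (frameField X (γ s)).1) T s := by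
    have h := HasFDerivAt.comp_hasDerivWithinAt (f := fun r => (γ r).1) s hτ1 hγ1
    exact h
  have hξ' : HasDerivWithinAt (fun r => (γ r).2.comp (fderiv ℝ σ (τ (γ r).1)))
      ((frameField X (γ s)).2.comp (fderiv ℝ σ (τ y₀)) +
        ξ₀.comp (fderiv ℝ (fderiv ℝ σ) (τ y₀) (fderiv ℝ τ y₀ (frameField X (γ s)).1))) T s :=
    hγ2.clm_comp (hσ2.comp_hasDerivWithinAt s hy')
  refine ⟨fun r => τ (γ r).1, fun r => (γ r).2.comp (fderiv ℝ σ (τ (γ r).1)), _, _, ?_, hy', hξ',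
    fun ζ => ?_, fun v => ?_⟩
  · have hT : Filter.Tendsto (fun r => (γ r).1) (𝓝[T] s) (𝓝 y₀) := hγ1.continuousWithinAt
    filter_upwards [hlam, hT.eventually hcs] with r hr hr'
    rw [hr.2]
    refine ⟨hr'.2, rfl, ?_⟩
    exact chartCovec_change hψ hφ hr'.2 (φ.map_target hr'.1) _
  · have h1 : (fun ξ₁ => S.hamChart ψ (τ y₀) ξ₁) =
        fun ξ₁ => frameHam X y₀ (ξ₁.comp (fderiv ℝ τ y₀)) := by
      funext ξ₁
      rw [hamChart_change S hφ hψ hX hψt hψφ]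
      change frameHam X (σ (τ y₀)) (ξ₁.comp (fderiv ℝ τ (σ (τ y₀)))) = _
      rw [hσy]
    beta_reduce
    rw [h1, (hasFDerivAt_frameHam_momentum X y₀ (fderiv ℝ τ y₀) _).fderiv]
    simp only [frameField, map_sum, map_smul, sum_apply, smul_apply,
      ContinuousLinearMap.apply_apply, ContinuousLinearMap.comp_apply]
    refine Finset.sum_congr rfl fun i _ => ?_
    change _ = ξ₀ (fderiv ℝ σ (τ y₀) (fderiv ℝ τ y₀ (X i y₀))) • _
    rw [hBA]
  · have hXd : ∀ i, HasFDerivAt (X i) (fderiv ℝ (X i) y₀) (σ (τ y₀)) := fun i => by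
      rw [hσy]
      exact (((hX.1 i).contDiffAt (φ.open_target.mem_nhds hys)).differentiableAt (by simp)).hasFDerivAt
    have hτ2' : HasFDerivAt (fderiv ℝ τ) (fderiv ℝ (fderiv ℝ τ) y₀) (σ (τ y₀)) := by rwa [hσy]
    have hZ : ∀ i, HasFDerivAt (fun z => fderiv ℝ τ (σ z) (X i (σ z))) _ (τ y₀) := fun i =>
      (hτ2'.comp (τ y₀) hσ1).clm_apply ((hXd i).comp (τ y₀) hσ1)
    have h1 : (fun y₁ => S.hamChart ψ y₁ (ξ₀.comp (fderiv ℝ σ (τ y₀)))) =ᶠ[𝓝 (τ y₀)] fun y₁ =>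
        frameHam (fun i z => fderiv ℝ τ (σ z) (X i (σ z))) y₁ (ξ₀.comp (fderiv ℝ σ (τ y₀))) :=
      hct.mono fun z hz => hamChart_change S hφ hψ hX hz.1 hz.2 _
    have h2 := ((hasFDerivAt_half_sum_sq hZ (ξ₀.comp (fderiv ℝ σ (τ y₀)))).congr_of_eventuallyEq h1).fderiv
    -- The transformed covector brings in D²σ and the transformed frame D²τ; this identity matches
    -- the two contributions.
    have h3 := second_deriv_inverse hτ hσ hinv hinv' (frameField X (γ s)).1 v
    have h4 : fderiv ℝ (fun y₁ => S.hamChart ψ y₁ (ξ₀.comp (fderiv ℝ σ (τ y₀)))) (τ y₀) v =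
        ∑ i, ξ₀ (X i y₀) * (ξ₀ (fderiv ℝ (X i) y₀ (fderiv ℝ σ (τ y₀) v)) +
          ξ₀ (fderiv ℝ σ (τ y₀) (fderiv ℝ (fderiv ℝ τ) y₀ (fderiv ℝ σ (τ y₀) v) (X i y₀)))) := by
      rw [h2]
      simp only [sum_apply, smul_apply, ContinuousLinearMap.comp_apply, smul_eq_mul]
      refine Finset.sum_congr rfl fun i _ => ?_
      simp [hσy, hBA]
    rw [h4]
    simp only [add_apply, ContinuousLinearMap.comp_apply]
    rw [h3]
    simp only [frameField, neg_apply, sum_apply, smul_apply, ContinuousLinearMap.comp_apply,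
      map_sum, map_smul, map_neg, smul_eq_mul, mul_add, Finset.sum_add_distrib, neg_add]
    rfl

end ExtremalsInCharts

/-! ### Uniqueness of extremals and evaluation of the exponential. -/

section Uniqueness

open Set Filter

variable {n : ℕ} {M : Type*} [TopologicalSpace M] [ChartedSpace (Model n) M]

/-- The point of the cotangent bundle with coordinates `p` in the chart `φ`. -/
noncomputable def chartLift (φ : OpenPartialHomeomorph M (Model n)) (p : RescaledFrame.Phase n) :
    CotBundle n M := ⟨φ.symm p.1, chartCovec φ (φ.symm p.1) p.2⟩

/-- The coordinates in the chart `φ` of a point of the cotangent bundle. -/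
noncomputable def chartCoord (φ : OpenPartialHomeomorph M (Model n)) (x : CotBundle n M) :
    RescaledFrame.Phase n := (φ x.1, ContinuousLinearMap.comp (M₁ := Model n) x.2 (chartSymmD φ (φ x.1)))

/-- Solutions of Hamilton's equations of the frame `X` on `[0, t]`, in the target of `φ`. -/
def IsFrameSolution (φ : OpenPartialHomeomorph M (Model n)) (X : Fin (2 * n) → Model n → Model n)
    (t : ℝ) (γ : ℝ → RescaledFrame.Phase n) : Prop :=
  ∀ s ∈ Icc 0 t, (γ s).1 ∈ φ.target ∧ HasDerivWithinAt γ (frameField X (γ s)) (Icc 0 t) s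

variable (S : ContactSubRiemannian n M) {φ : OpenPartialHomeomorph M (Model n)}
  {X : Fin (2 * n) → Model n → Model n}
  (hφ : φ ∈ IsManifold.maximalAtlas (𝓡 (2 * n + 1)) ∞ M)

include hφ

theorem chartCoord_chartLift {p : RescaledFrame.Phase n} (hp : p.1 ∈ φ.target) :
    chartCoord φ (chartLift φ p) = p := by
  refine Prod.ext (φ.right_inv hp) ?_
  have key : ∀ v : Model n,
      p.2 (chartD φ (φ.symm p.1) (chartSymmD φ (φ (φ.symm p.1)) v)) = p.2 v := fun v => by
    rw [φ.right_inv hp, chartD_chartSymmD hφ hp]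
  exact ContinuousLinearMap.ext key

theorem chartLift_chartCoord {x : CotBundle n M} (hx : x.1 ∈ φ.source) :
    chartLift φ (chartCoord φ x) = x := by
  obtain ⟨q, p⟩ := x
  have h1 : chartCovec φ q (chartCoord φ ⟨q, p⟩).2 = p := by
    have key : ∀ v : Model n, p (chartSymmD φ (φ q) (chartD φ q v)) = p v := fun v => by
      rw [chartSymmD_chartD hφ hx]
    exact ContinuousLinearMap.ext key
  calc chartLift φ (chartCoord φ ⟨q, p⟩) = ⟨q, chartCovec φ q (chartCoord φ ⟨q, p⟩).2⟩ :=
        congrArg (fun q' => (⟨q', chartCovec φ q' (chartCoord φ ⟨q, p⟩).2⟩ : CotBundle n M))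
          (φ.left_inv hx)
    _ = _ := by rw [h1]

variable (hX : IsOrthonormalFrame S.Δ S.g φ X)
include hX

theorem IsFrameSolution.isExtremal {t : ℝ} {γ : ℝ → RescaledFrame.Phase n}
    (hγ : IsFrameSolution φ X t γ) : S.IsExtremal t fun s => chartLift φ (γ s) := by
  intro s hs ψ hψ hsψ
  refine extremal_change S hφ hψ hX hs ?_ (hγ s hs).2 hsψ
  exact eventually_mem_nhdsWithin.mono fun r hr => ⟨(hγ r hr).1, rfl⟩

theorem extremal_coord {t s : ℝ} {lam : ℝ → CotBundle n M} (hlam : S.IsExtremal t lam)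
    (hs : s ∈ Icc 0 t) (hsφ : (lam s).1 ∈ φ.source) :
    HasDerivWithinAt (fun r => chartCoord φ (lam r)) (frameField X (chartCoord φ (lam s)))
      (Icc 0 t) s ∧ ∀ᶠ r in 𝓝[Icc 0 t] s, (lam r).1 ∈ φ.source := by
  obtain ⟨y, ξ, y', ξ', hev, hy, hξ, h1, h2⟩ := hlam s hs φ hφ hsφ
  have hcoord : ∀ᶠ r in 𝓝[Icc 0 t] s, chartCoord φ (lam r) = (y r, ξ r) := by
    filter_upwards [hev] with r hr
    obtain ⟨hr1, hr2, hr3⟩ := hr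
    have hr4 : lam r = chartLift φ (y r, ξ r) := by
      rw [chartLift]
      dsimp only
      rw [hr2]
      calc lam r = ⟨(lam r).1, chartCovec φ (lam r).1 (ξ r)⟩ := by rw [← hr3]
        _ = _ := congrArg (fun q' => (⟨q', chartCovec φ q' (ξ r)⟩ : CotBundle n M))
          (φ.left_inv hr1).symm
    rw [hr4, chartCoord_chartLift hφ]
    dsimp only
    rw [hr2]
    exact φ.map_source hr1
  have hsc := hcoord.self_of_nhdsWithin hs
  refine ⟨?_, hev.mono fun r hr => hr.1⟩
  refine HasDerivWithinAt.congr_of_eventuallyEq ?_ hcoord hsc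
  rw [hsc]
  have hys : y s ∈ φ.target := by
    have := congrArg Prod.fst hsc
    dsimp only at this
    rw [← this]
    exact φ.map_source hsφ
  refine (hy.prodMk hξ).congr_deriv (Prod.ext ?_ ?_)
  · have h3 : (fun ξ₁ => S.hamChart φ (y s) ξ₁) =
        fun ξ₁ => frameHam X (y s) (ξ₁.comp (ContinuousLinearMap.id ℝ (Model n))) := by
      funext ξ₁
      rw [hamChart_eq S hφ hX hys, ContinuousLinearMap.comp_id]
    have h4 : ∀ ζ : Model n →L[ℝ] ℝ, ζ y' = ζ (frameField X (y s, ξ s)).1 := fun ζ => by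
      rw [h1 ζ, h3, (hasFDerivAt_frameHam_momentum X (y s) _ _).fderiv]
      simp only [frameField, sum_apply, smul_apply, ContinuousLinearMap.apply_apply,
        ContinuousLinearMap.id_apply, map_sum, map_smul]
    exact model_ext (fun k => h4 _) (h4 _)
  · have h3 : (fun y₁ => S.hamChart φ y₁ (ξ s)) =ᶠ[𝓝 (y s)] fun y₁ => frameHam X y₁ (ξ s) :=
      (φ.open_target.eventually_mem hys).mono fun z hz => hamChart_eq S hφ hX hz _
    have hXd : ∀ i, HasFDerivAt (X i) (fderiv ℝ (X i) (y s)) (y s) := fun i =>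
      (((hX.1 i).contDiffAt (φ.open_target.mem_nhds hys)).differentiableAt (by simp)).hasFDerivAt
    refine ContinuousLinearMap.ext fun v => ?_
    rw [h2 v, ((hasFDerivAt_half_sum_sq hXd (ξ s)).congr_of_eventuallyEq h3).fderiv]
    rfl

omit [ChartedSpace (Model n) M] hφ hX in
theorem contDiffAt_frameField (hX : ∀ i, ContDiffOn ℝ ∞ (X i) φ.target)
    {p : RescaledFrame.Phase n} (hp : p.1 ∈ φ.target) : ContDiffAt ℝ ∞ (frameField X) p := by
  have h1 : ∀ i, ContDiffAt ℝ ∞ (X i) p.1 := fun i =>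
    (hX i).contDiffAt (φ.open_target.mem_nhds hp)
  have h2 : ∀ i, ContDiffAt ℝ ∞ (fun p : RescaledFrame.Phase n => X i p.1) p := fun i =>
    (h1 i).comp p contDiffAt_fst
  have h3 : ∀ i, ContDiffAt ℝ ∞ (fun p : RescaledFrame.Phase n => fderiv ℝ (X i) p.1) p := fun i =>
    ((h1 i).fderiv_right (m := ∞) (by norm_num)).comp p contDiffAt_fst
  have h4 : ContDiffAt ℝ ∞ (fun p : RescaledFrame.Phase n => p.2) p := contDiffAt_snd
  have h5 : ∀ i, ContDiffAt ℝ ∞ (fun p : RescaledFrame.Phase n => p.2 (X i p.1)) p := fun i =>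
    h4.clm_apply (h2 i)
  exact (ContDiffAt.sum fun i _ => (h5 i).smul (h2 i)).prodMk
    (ContDiffAt.sum fun i _ => (h5 i).smul (h4.clm_comp (h3 i))).neg

omit hφ hX in
theorem extremal_continuousOn [IsManifold (𝓡 (2 * n + 1)) ∞ M] {t : ℝ} {lam : ℝ → CotBundle n M}
    (hlam : S.IsExtremal t lam) : ContinuousOn (fun r => (lam r).1) (Icc 0 t) := by
  intro s hs
  have hsrc := mem_chart_source (Model n) (lam s).1
  obtain ⟨y, ξ, y', ξ', hev, hy, -⟩ := hlam s hs (chartAt (Model n) (lam s).1)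
    (IsManifold.chart_mem_maximalAtlas _) hsrc
  have hys : y s = chartAt (Model n) (lam s).1 (lam s).1 := (hev.self_of_nhdsWithin hs).2.1
  have h1 : ContinuousWithinAt (fun r => (chartAt (Model n) (lam s).1).symm (y r)) (Icc 0 t) s := by
    refine ContinuousAt.comp_continuousWithinAt ?_ hy.continuousWithinAt
    rw [hys]
    exact (chartAt (Model n) (lam s).1).continuousAt_symm
      ((chartAt (Model n) (lam s).1).map_source hsrc)
  refine h1.congr_of_eventuallyEq (hev.mono fun r hr => ?_) ?_
  · beta_reduce
    rw [hr.2.1, (chartAt (Model n) (lam s).1).left_inv hr.1]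
  · rw [hys, (chartAt (Model n) (lam s).1).left_inv hsrc]

/-- Uniqueness of extremals, as long as one of them stays in the domain of the chart. -/
theorem IsFrameSolution.eq_of_isExtremal [T2Space M] [IsManifold (𝓡 (2 * n + 1)) ∞ M] {t : ℝ}
    {γ : ℝ → RescaledFrame.Phase n} (hγ : IsFrameSolution φ X t γ) {lam : ℝ → CotBundle n M}
    (hlam : S.IsExtremal t lam) (h0 : lam 0 = chartLift φ (γ 0)) :
    ∀ s ∈ Icc 0 t, lam s = chartLift φ (γ s) := by
  have hcont := extremal_continuousOn S hlam
  have hγc : ContinuousOn γ (Icc 0 t) := fun s hs => (hγ s hs).2.continuousWithinAt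
  have hsrc : ∀ s ∈ Icc 0 t, lam s = chartLift φ (γ s) → (lam s).1 ∈ φ.source := fun s hs h => by
    rw [h]; exact φ.map_target (hγ s hs).1
  -- Continuous induction: agreement is a closed condition because M is Hausdorff, and it propagates
  -- to the right because the field is locally Lipschitz in the chart.
  refine IsClosed.Icc_subset_of_forall_exists_gt (s := {s | lam s = chartLift φ (γ s)}) ?_ h0 ?_
  · refine isClosed_of_closure_subset fun s hs => ?_
    have hsI : s ∈ Icc 0 t := isClosed_Icc.closure_subset_iff.2 inter_subset_right hs
    have hne : (𝓝[{s | lam s = chartLift φ (γ s)} ∩ Icc 0 t] s).NeBot :=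
      mem_closure_iff_nhdsWithin_neBot.1 hs
    have hle : 𝓝[{s | lam s = chartLift φ (γ s)} ∩ Icc 0 t] s ≤ 𝓝[Icc 0 t] s :=
      nhdsWithin_mono _ inter_subset_right
    have hmem : ∀ᶠ r in 𝓝[{s | lam s = chartLift φ (γ s)} ∩ Icc 0 t] s,
        lam r = chartLift φ (γ r) ∧ r ∈ Icc 0 t := eventually_mem_nhdsWithin
    have hbase : (lam s).1 = φ.symm (γ s).1 := by
      have h1 : Tendsto (fun r => φ.symm (γ r).1) (𝓝[Icc 0 t] s) (𝓝 (φ.symm (γ s).1)) :=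
        (φ.continuousAt_symm (hγ s hsI).1).tendsto.comp
          (continuous_fst.continuousAt.comp_continuousWithinAt (hγc s hsI))
      refine tendsto_nhds_unique_of_eventuallyEq ((hcont s hsI).mono_left hle) (h1.mono_left hle)
        (hmem.mono fun r hr => ?_)
      beta_reduce
      rw [hr.1]
      rfl
    have hsφ : (lam s).1 ∈ φ.source := by rw [hbase]; exact φ.map_target (hγ s hsI).1
    have hcl : chartCoord φ (lam s) = γ s := by
      have h1 := (extremal_coord S hφ hX hlam hsI hsφ).1.continuousWithinAt
      refine tendsto_nhds_unique_of_eventuallyEq (h1.mono_left hle) ((hγc s hsI).mono_left hle)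
        (hmem.mono fun r hr => ?_)
      beta_reduce
      rw [hr.1, chartCoord_chartLift hφ (hγ r hr.2).1]
    refine ⟨?_, hsI⟩
    change lam s = chartLift φ (γ s)
    rw [← hcl, chartLift_chartCoord hφ hsφ]
  · rintro s ⟨hs, hsI⟩ y hy
    have hs' : lam s = chartLift φ (γ s) := hs
    have hsI' : s ∈ Icc 0 t := Ico_subset_Icc_self hsI
    have hsφ := hsrc s hsI' hs'
    have hcl : chartCoord φ (lam s) = γ s := by
      rw [hs', chartCoord_chartLift hφ (hγ s hsI').1]
    obtain ⟨hd, hev⟩ := extremal_coord S hφ hX hlam hsI' hsφ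
    obtain ⟨K, U, hU, hLip⟩ := ContDiffAt.exists_lipschitzOnWith
      (contDiffAt_infty.1 (contDiffAt_frameField hX.1 (hγ s hsI').1) 1)
    have hall : ∀ᶠ r in 𝓝[Icc 0 t] s, (lam r).1 ∈ φ.source ∧ chartCoord φ (lam r) ∈ U ∧ γ r ∈ U := by
      have h1 : ∀ᶠ r in 𝓝[Icc 0 t] s, chartCoord φ (lam r) ∈ U :=
        hd.continuousWithinAt.eventually_mem (by beta_reduce; rw [hcl]; exact hU)
      exact hev.and (h1.and ((hγc s hsI').eventually_mem hU))
    have hIcc : 𝓝[≥] s = 𝓝[Icc s t] s := (nhdsWithin_Icc_eq_nhdsGE hsI.2).symm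
    have hall' : ∀ᶠ r in 𝓝[≥] s, (lam r).1 ∈ φ.source ∧ chartCoord φ (lam r) ∈ U ∧ γ r ∈ U := by
      rw [hIcc]
      exact hall.filter_mono (nhdsWithin_mono _ (Icc_subset_Icc_left hsI.1))
    obtain ⟨z₁, hz₁, hz₁'⟩ := mem_nhdsGE_iff_exists_Icc_subset.1 hall'
    have hsz : s < min z₁ (min y t) := lt_min hz₁ (lt_min hy hsI.2)
    have hsub : Icc s (min z₁ (min y t)) ⊆ Icc 0 t :=
      Icc_subset_Icc hsI.1 ((min_le_right _ _).trans (min_le_right _ _))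
    have hgood : ∀ r ∈ Icc s (min z₁ (min y t)),
        (lam r).1 ∈ φ.source ∧ chartCoord φ (lam r) ∈ U ∧ γ r ∈ U := fun r hr =>
      hz₁' ⟨hr.1, hr.2.trans (min_le_left _ _)⟩
    have hIci : ∀ r ∈ Ico s (min z₁ (min y t)), Icc 0 t ∈ 𝓝[≥] r := fun r hr =>
      mem_of_superset (Icc_mem_nhdsGE (hr.2.trans_le ((min_le_right _ _).trans (min_le_right _ _))))
        (Icc_subset_Icc_left (hsI.1.trans hr.1))
    have huniq := ODE_solution_unique_of_mem_Icc_right (v := fun _ => frameField X) (s := fun _ => U)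
      (K := K) (f := fun r => chartCoord φ (lam r)) (g := γ) (a := s) (b := min z₁ (min y t))
      (fun _ _ => hLip)
      (fun r hr => ((extremal_coord S hφ hX hlam (hsub hr) (hgood r hr).1).1.continuousWithinAt).mono hsub)
      (fun r hr => ((extremal_coord S hφ hX hlam (hsub (Ico_subset_Icc_self hr))
        (hgood r (Ico_subset_Icc_self hr)).1).1).mono_of_mem_nhdsWithin (hIci r hr))
      (fun r hr => (hgood r (Ico_subset_Icc_self hr)).2.1)
      (hγc.mono hsub)
      (fun r hr => ((hγ r (hsub (Ico_subset_Icc_self hr))).2).mono_of_mem_nhdsWithin (hIci r hr))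
      (fun r hr => (hgood r (Ico_subset_Icc_self hr)).2.2) hcl
    have hend := huniq (right_mem_Icc.2 hsz.le)
    refine ⟨min z₁ (min y t), ?_, hsz, (min_le_right _ _).trans (min_le_left _ _)⟩
    change lam _ = chartLift φ (γ _)
    rw [← hend]
    exact (chartLift_chartCoord hφ (hgood _ (right_mem_Icc.2 hsz.le)).1).symm

/-- `srExp` evaluates an arbitrarily chosen extremal; by uniqueness every choice gives the solution
found in the chart. -/
theorem IsFrameSolution.srExp_eq [T2Space M] [IsManifold (𝓡 (2 * n + 1)) ∞ M] {t : ℝ} (ht : 0 ≤ t)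
    {γ : ℝ → RescaledFrame.Phase n} (hγ : IsFrameSolution φ X t γ) {q : M}
    {p : TangentSpace (𝓡 (2 * n + 1)) q →L[ℝ] ℝ} (h0 : chartLift φ (γ 0) = ⟨q, p⟩) :
    p ∈ S.expDomain q t ∧ S.srExp q t p = φ.symm (γ t).1 := by
  have hex : ∃ lam : ℝ → CotBundle n M, S.IsExtremal t lam ∧ lam 0 = ⟨q, p⟩ :=
    ⟨_, hγ.isExtremal S hφ hX, h0⟩
  refine ⟨hex, ?_⟩
  rw [ContactSubRiemannian.srExp, dif_pos hex]
  rw [hγ.eq_of_isExtremal S hφ hX hex.choose_spec.1 (hex.choose_spec.2.trans h0.symm) t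
    (right_mem_Icc.2 ht)]
  rfl

end Uniqueness

/-! ### First-order consequences of the normal form. -/

section NormalForm

open Set Filter Metric

theorem exists_contDiff_eqOn_ball {E F ι : Type*} [NormedAddCommGroup E] [NormedSpace ℝ E]
    [HasContDiffBump E] [FiniteDimensional ℝ E] [NormedAddCommGroup F] [NormedSpace ℝ F]
    {X : ι → E → F} {U : Set E} (hU : IsOpen U) {x₀ : E} (hx₀ : x₀ ∈ U)
    (hX : ∀ i, ContDiffOn ℝ ∞ (X i) U) :
    ∃ r > 0, ball x₀ r ⊆ U ∧ ∃ Z : ι → E → F, (∀ i, ContDiff ℝ ∞ (Z i)) ∧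
      ∀ i, EqOn (Z i) (X i) (ball x₀ r) := by
  obtain ⟨ε, hε, hsub⟩ := nhds_basis_closedBall.mem_iff.1 (hU.mem_nhds hx₀)
  let f : ContDiffBump x₀ := ⟨ε / 2, ε, by linarith, by linarith⟩
  refine ⟨ε / 2, by linarith, fun y hy => hsub (closedBall_subset_closedBall (by linarith)
    (ball_subset_closedBall hy)), fun i y => f y • X i y, fun i => ?_, fun i y hy => ?_⟩
  · refine contDiff_iff_contDiffAt.2 fun y => ?_
    by_cases hy : y ∈ closedBall x₀ ε
    · exact f.contDiff.contDiffAt.smul ((hX i).contDiffAt (hU.mem_nhds (hsub hy)))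
    · refine (contDiffAt_const (c := (0 : F))).congr_of_eventuallyEq ?_
      filter_upwards [isClosed_closedBall.isOpen_compl.mem_nhds hy] with z hz
      have hz' : f z = 0 := f.zero_of_le_dist (le_of_lt (not_le.1 fun h => hz h))
      rw [hz', zero_smul]
  · beta_reduce
    rw [f.one_of_mem_closedBall (ball_subset_closedBall hy), one_smul]

variable {n : ℕ}

/-- First-order consequences of a radial identity satisfied by a frame. -/
theorem radial_identity {X : Fin (2 * n) → Model n → Model n} (hX : ∀ i, DifferentiableAt ℝ (X i) 0)
    {l m : Model n →L[ℝ] ℝ} (h : ∀ᶠ y in 𝓝 (0 : Model n), ∑ j, l (X j y) * xc j y = m y) :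
    (∀ j, l (X j 0) = m (ex j)) ∧ ∀ v, ∑ j, l (fderiv ℝ (X j) 0 v) * xc j v = 0 := by
  have hd : ∀ v : Model n, HasDerivAt (fun t : ℝ => ∑ j, l (X j (t • v)) * xc j v - m v)
      (∑ j, l (fderiv ℝ (X j) 0 v) * xc j v) 0 := fun v => by
    have h1 : HasDerivAt (fun t : ℝ => t • v) v 0 := by
      simpa using (hasDerivAt_id (0 : ℝ)).smul_const v
    have h2 : ∀ j, HasDerivAt (fun t : ℝ => l (X j (t • v))) (l (fderiv ℝ (X j) 0 v)) 0 := fun j => by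
      have h3 : HasFDerivAt (X j) (fderiv ℝ (X j) 0) ((0 : ℝ) • v) := by
        rw [zero_smul]; exact (hX j).hasFDerivAt
      have h4 := l.hasFDerivAt.comp_hasDerivAt (0 : ℝ) (h3.comp_hasDerivAt (0 : ℝ) h1)
      exact h4
    have h5 := (HasDerivAt.fun_sum (u := Finset.univ) fun j _ => (h2 j).mul_const (xc j v)).sub_const (m v)
    exact h5
  -- On the ray through `v` the identity has a factor `t`, which is divided out; continuity recovers
  -- `t = 0`, and differentiation at 0 gives the second claim.
  have hp : ∀ v : Model n, ∀ᶠ t in 𝓝[≠] (0 : ℝ), ∑ j, l (X j (t • v)) * xc j v - m v = 0 := fun v => by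
    have hc : Tendsto (fun t : ℝ => t • v) (𝓝 0) (𝓝 0) := by
      have h1 : Continuous fun t : ℝ => t • v := by fun_prop
      simpa using h1.tendsto 0
    filter_upwards [(hc.eventually h).filter_mono nhdsWithin_le_nhds, self_mem_nhdsWithin] with t ht ht0
    have ht0' : t ≠ 0 := ht0
    refine (mul_eq_zero.1 (?_ : t * _ = 0)).resolve_left ht0'
    rw [mul_sub, Finset.mul_sum, sub_eq_zero]
    simp only [map_smul, smul_eq_mul] at ht
    rw [← ht]
    exact Finset.sum_congr rfl fun j _ => by ring
  have h0 : ∀ v : Model n, ∑ j, l (X j ((0 : ℝ) • v)) * xc j v - m v = 0 := fun v => by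
    have h1 : Tendsto (fun t : ℝ => ∑ j, l (X j (t • v)) * xc j v - m v) (𝓝[≠] 0)
        (𝓝 (∑ j, l (X j ((0 : ℝ) • v)) * xc j v - m v)) :=
      (hd v).continuousAt.tendsto.mono_left nhdsWithin_le_nhds
    exact tendsto_nhds_unique_of_eventuallyEq h1 tendsto_const_nhds (hp v)
  refine ⟨fun j => ?_, fun v => ?_⟩
  · have h1 := h0 (ex j)
    simp only [zero_smul, xc_ex, mul_ite, mul_one, mul_zero, Finset.sum_ite_eq', Finset.mem_univ,
      if_true] at h1
    linarith
  · refine (hd v).unique ((hasDerivAt_const (0 : ℝ) (0 : ℝ)).congr_of_eventuallyEq ?_)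
    rw [← nhdsNE_sup_pure]
    exact eventually_sup.2 ⟨hp v, h0 v⟩

theorem zScale_zero (v : Model n) : zScale 0 v = ∑ k, xc k v • ex k := by
  refine model_ext (fun j => ?_) ?_
  · rw [xc_zScale, map_sum]
    simp only [map_smul, xc_ex, smul_eq_mul, mul_ite, mul_one, mul_zero, Finset.sum_ite_eq,
      Finset.mem_univ, if_true]
  · rw [zc_zScale, map_sum]
    simp only [map_smul, zc_ex, smul_zero, Finset.sum_const_zero, zero_mul]

/-- The derivative ∂_k (X_j)_i is symmetric in i, j by the symmetry of the frame and antisymmetric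
in j, k by the radial identity; such a three-index array vanishes. -/
theorem horizontal_deriv_eq_zero {X : Fin (2 * n) → Model n → Model n}
    (hX : ∀ i, DifferentiableAt ℝ (X i) 0)
    (hsymm : ∀ᶠ y in 𝓝 (0 : Model n), ∀ i j, xc j (X i y) = xc i (X j y))
    (hrad : ∀ᶠ y in 𝓝 (0 : Model n), ∀ i, ∑ j, xc i (X j y) * xc j y = xc i y)
    (i j : Fin (2 * n)) (v : Model n) : xc j (fderiv ℝ (X i) 0 (zScale 0 v)) = 0 := by
  have hs : ∀ i j v, xc j (fderiv ℝ (X i) 0 v) = xc i (fderiv ℝ (X j) 0 v) := fun i j v => by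
    have h1 : HasFDerivAt (fun y => xc j (X i y)) (xc j ∘L fderiv ℝ (X i) 0) 0 :=
      (xc j).hasFDerivAt.comp (0 : Model n) (hX i).hasFDerivAt
    have h2 : HasFDerivAt (fun y => xc i (X j y)) (xc i ∘L fderiv ℝ (X j) 0) 0 :=
      (xc i).hasFDerivAt.comp (0 : Model n) (hX j).hasFDerivAt
    have h3 := h1.unique (h2.congr_of_eventuallyEq (hsymm.mono fun y hy => hy i j))
    exact congrArg (fun T : Model n →L[ℝ] ℝ => T v) h3
  have ha : ∀ i j k, xc i (fderiv ℝ (X j) 0 (ex k)) = -xc i (fderiv ℝ (X k) 0 (ex j)) := by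
    intro i j k
    have hq := (radial_identity hX (hrad.mono fun y hy => hy i)).2
    have e1 := hq (ex j + ex k)
    have e2 := hq (ex j)
    have e3 := hq (ex k)
    simp only [map_add, xc_ex, mul_add, mul_ite, mul_one, mul_zero, Finset.sum_add_distrib,
      Finset.sum_ite_eq', Finset.mem_univ, if_true] at e1 e2 e3
    linarith
  have h0 : ∀ k, xc j (fderiv ℝ (X i) 0 (ex k)) = 0 := fun k => by
    linarith [ha j i k, hs k j (ex i), ha k j i, hs i k (ex j), ha i k j, hs i j (ex k)]
  rw [zScale_zero, map_sum, map_sum]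
  refine Finset.sum_eq_zero fun k _ => ?_
  rw [map_smul, map_smul, h0, smul_zero]

variable {M : Type*} [TopologicalSpace M] [ChartedSpace (Model n) M]
  {S : ContactSubRiemannian n M} {q₀ : M} {φ : OpenPartialHomeomorph M (Model n)}
  {X : Fin (2 * n) → Model n → Model n} {b : Fin n → ℝ}

namespace ContactSubRiemannian.IsNormalForm

variable (hN : S.IsNormalForm q₀ φ X b)
include hN

theorem zero_mem_target : (0 : Model n) ∈ φ.target := hN.map_zero ▸ φ.map_source hN.mem_source

theorem symm_zero : φ.symm 0 = q₀ := by rw [← hN.map_zero, φ.left_inv hN.mem_source]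

theorem differentiableAt_frame (i : Fin (2 * n)) : DifferentiableAt ℝ (X i) 0 :=
  ((hN.frame.1 i).contDiffAt (φ.open_target.mem_nhds hN.zero_mem_target)).differentiableAt (by simp)

theorem eventually_target : ∀ᶠ y in 𝓝 (0 : Model n), y ∈ φ.target :=
  φ.open_target.mem_nhds hN.zero_mem_target

theorem frame_zero (i : Fin (2 * n)) : X i 0 = ex i := by
  refine model_ext (fun j => ?_) ?_
  · exact (radial_identity hN.differentiableAt_frame (l := xc j) (m := xc j)
      (hN.eventually_target.mono fun y hy => hN.hor_radial y hy j)).1 i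
  · rw [(radial_identity hN.differentiableAt_frame (l := zc) (m := 0)
      (hN.eventually_target.mono fun y hy => hN.vert_radial y hy)).1 i, zc_ex]
    rfl

theorem zc_fderiv_frame (i : Fin (2 * n)) (v : Model n) : zc (fderiv ℝ (X i) 0 v) = ell b i v := by
  have h : ∀ i, fderiv ℝ (fun y => X i y (Fin.last (2 * n))) 0 v = zc (fderiv ℝ (X i) 0 v) :=
    fun i => by
      have h1 : HasFDerivAt (fun y => zc (X i y)) (zc ∘L fderiv ℝ (X i) 0) 0 :=
        (zc (n := n)).hasFDerivAt.comp (0 : Model n) (hN.differentiableAt_frame i).hasFDerivAt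
      exact congrArg (fun T : Model n →L[ℝ] ℝ => T v) h1.fderiv
  refine idx_cases (p := fun i => zc (fderiv ℝ (X i) 0 v) = ell b i v) (fun k => ?_) (fun k => ?_) i
  · rw [← h, hN.vert_odd, ell_oddIdx]; rfl
  · rw [← h, hN.vert_even, ell_evenIdx]; rfl

/-- A frame in normal form, seen through the dilations, extends to a rescaled frame. -/
theorem exists_rescaledFrame : ∃ Fr : RescaledFrame n, Fr.b = b ∧ ∃ r > 0, ball 0 r ⊆ φ.target ∧
    ∀ i μ Y, dil μ Y ∈ ball (0 : Model n) r →
      dil μ (Fr.field i (μ, Y)) = μ • X i (dil μ Y) := by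
  obtain ⟨r, hr, hsub, Z, hZ, hZX⟩ :=
    exists_contDiff_eqOn_ball φ.open_target hN.zero_mem_target hN.frame.1
  have hev : ∀ i, Z i =ᶠ[𝓝 0] X i := fun i => (hZX i).eventuallyEq_of_mem (ball_mem_nhds 0 hr)
  obtain ⟨Fr, hb, hFr⟩ := _root_.exists_rescaledFrame b hN.b_pos Z hZ
    (fun i => (hev i).self_of_nhds.trans (hN.frame_zero i))
    (fun i v => by rw [(hev i).fderiv_eq, hN.zc_fderiv_frame])
    (fun i j v => by
      rw [(hev i).fderiv_eq]
      exact horizontal_deriv_eq_zero hN.differentiableAt_frame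
        (hN.eventually_target.mono fun y hy i j => hN.hor_symm y hy i j)
        (hN.eventually_target.mono fun y hy i => hN.hor_radial y hy i) i j v)
  exact ⟨Fr, hb, r, hr, hsub, fun i μ Y hY => by rw [hFr, hZX i hY]⟩

end ContactSubRiemannian.IsNormalForm

end NormalForm

/-! ### From rescaled solutions to extremals of the original structure. -/

section Rescaling

open Set Filter Metric

variable {n : ℕ}

theorem dil_dil_inv {μ : ℝ} (hμ : μ ≠ 0) (v : Model n) : dil μ (dil μ⁻¹ v) = v := by
  rw [dil_dil, mul_inv_cancel₀ hμ, dil_one]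

theorem dil_inv_dil {μ : ℝ} (hμ : μ ≠ 0) (v : Model n) : dil μ⁻¹ (dil μ v) = v := by
  rw [dil_dil, inv_mul_cancel₀ hμ, dil_one]

/-- The action of the dilation `dil μ` on covectors, composed with the homothety of ratio `κ`. -/
noncomputable def codil (κ μ : ℝ) : (Model n →L[ℝ] ℝ) →L[ℝ] (Model n →L[ℝ] ℝ) :=
  κ • (ContinuousLinearMap.compL ℝ (Model n) (Model n) ℝ).flip (dil μ⁻¹)

theorem codil_apply (κ μ : ℝ) (ξ : Model n →L[ℝ] ℝ) (v : Model n) :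
    codil κ μ ξ v = κ * ξ (dil μ⁻¹ v) := rfl

theorem codil_covOf {κ μ w : ℝ} {u h : Fin (2 * n) → ℝ} (h1 : ∀ k, κ * μ⁻¹ * u k = h k)
    {h₀ : ℝ} (h2 : κ * μ⁻¹ ^ 2 * w = h₀) :
    codil κ μ (covOf (horVert u w)) = covOf (horVert h h₀) := by
  ext v
  rw [codil_apply, covOf_apply, covOf_apply]
  simp only [xc_horVert, zc_horVert, xc_dil, zc_dil]
  rw [mul_add, Finset.mul_sum]
  congr 1
  · exact Finset.sum_congr rfl fun k _ => by rw [← h1 k]; ring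
  · rw [← h2]; ring

variable {X : Fin (2 * n) → Model n → Model n}

/-- Under the dilation, its dual on covectors and the homothety μ²/t, each momentum P(X_i) is
multiplied by μ/t. The dilation contributes μ to each field, so all velocities acquire the factor
1/t of the reparametrized clock s/t. -/
theorem hasDerivWithinAt_rescale {Fr : RescaledFrame n} {U : Set (Model n)} (hU : IsOpen U)
    (hX : ∀ i, ∀ y ∈ U, DifferentiableAt ℝ (X i) y)
    (hFr : ∀ i μ Y, dil μ Y ∈ U → dil μ (Fr.field i (μ, Y)) = μ • X i (dil μ Y))
    {μ t : ℝ} (hμ : μ ≠ 0) (ht : 0 < t) {γ : ℝ → RescaledFrame.Phase n} {s : ℝ}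
    (hs : dil μ (γ (s / t)).1 ∈ U) (hγ : HasDerivAt γ (Fr.hamField (μ, γ (s / t))) (s / t)) :
    HasDerivAt (fun s => (dil μ (γ (s / t)).1, codil (μ ^ 2 / t) μ (γ (s / t)).2))
      (frameField X (dil μ (γ (s / t)).1, codil (μ ^ 2 / t) μ (γ (s / t)).2)) s := by
  have h0 : HasDerivAt (fun s => γ (s / t)) (t⁻¹ • Fr.hamField (μ, γ (s / t))) s := by
    have h1 : HasDerivAt (fun s : ℝ => s / t) t⁻¹ s := by
      simpa using (hasDerivAt_id s).div_const t
    have h2 := HasDerivAt.scomp (h := fun s : ℝ => s / t) s hγ h1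
    exact h2
  have h1 := (dil (n := n) μ).hasFDerivAt.comp_hasDerivAt s h0.fst_comp
  have h2 := (codil (n := n) (μ ^ 2 / t) μ).hasFDerivAt.comp_hasDerivAt s h0.snd_comp
  refine (h1.prodMk h2).congr_deriv ?_
  generalize γ (s / t) = p at hs ⊢
  have e1 : ∀ i, codil (μ ^ 2 / t) μ p.2 (X i (dil μ p.1)) = μ / t * p.2 (Fr.field i (μ, p.1)) :=
    fun i => by
      have e : X i (dil μ p.1) = μ⁻¹ • dil μ (Fr.field i (μ, p.1)) := by
        rw [hFr i μ p.1 hs, smul_smul, inv_mul_cancel₀ hμ, one_smul]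
      rw [e, codil_apply, map_smul, map_smul, dil_inv_dil hμ, smul_eq_mul]
      field_simp
  have e2 : ∀ i v, dil μ (Fr.dfield i (μ, p.1) (dil μ⁻¹ v)) = μ • fderiv ℝ (X i) (dil μ p.1) v :=
    fun i v => by
      have d1 : HasFDerivAt (fun Y => dil μ (Fr.field i (μ, Y))) (dil μ ∘L Fr.dfield i (μ, p.1)) p.1 :=
        (dil μ).hasFDerivAt.comp p.1 (Fr.hasFDerivAt_field i μ p.1)
      have d2 : HasFDerivAt (fun Y => μ • X i (dil μ Y))
          (μ • fderiv ℝ (X i) (dil μ p.1) ∘L dil μ) p.1 :=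
        ((hX i _ hs).hasFDerivAt.comp p.1 (dil μ).hasFDerivAt).const_smul μ
      have hev : (fun Y => dil μ (Fr.field i (μ, Y))) =ᶠ[𝓝 p.1] fun Y => μ • X i (dil μ Y) :=
        ((dil μ).continuous.continuousAt.eventually (hU.mem_nhds hs)).mono fun Y hY => hFr i μ Y hY
      have d3 := congrArg (fun T : Model n →L[ℝ] Model n => T (dil μ⁻¹ v))
        (d1.unique (d2.congr_of_eventuallyEq hev))
      have d4 : μ • fderiv ℝ (X i) (dil μ p.1) (dil μ (dil μ⁻¹ v)) = μ • fderiv ℝ (X i) (dil μ p.1) v := by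
        rw [dil_dil_inv hμ]
      exact d3.trans d4
  refine Prod.ext ?_ (ContinuousLinearMap.ext fun v => ?_)
  · change dil μ (t⁻¹ • ∑ i, p.2 (Fr.field i (μ, p.1)) • Fr.field i (μ, p.1)) =
      ∑ i, codil (μ ^ 2 / t) μ p.2 (X i (dil μ p.1)) • X i (dil μ p.1)
    rw [map_smul, map_sum, Finset.smul_sum]
    refine Finset.sum_congr rfl fun i _ => ?_
    rw [map_smul, hFr i μ p.1 hs, e1, smul_smul, smul_smul]
    congr 1
    ring
  · change codil (μ ^ 2 / t) μ (t⁻¹ • -∑ i, p.2 (Fr.field i (μ, p.1)) • (p.2 ∘L Fr.dfield i (μ, p.1))) v =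
      (-∑ i, codil (μ ^ 2 / t) μ p.2 (X i (dil μ p.1)) •
        (codil (μ ^ 2 / t) μ p.2).comp (fderiv ℝ (X i) (dil μ p.1))) v
    rw [codil_apply]
    simp only [smul_apply, neg_apply,
      sum_apply, ContinuousLinearMap.comp_apply, smul_eq_mul, e1, mul_neg,
      Finset.mul_sum, codil_apply]
    congr 1
    refine Finset.sum_congr rfl fun i _ => ?_
    have e : fderiv ℝ (X i) (dil μ p.1) v = μ⁻¹ • dil μ (Fr.dfield i (μ, p.1) (dil μ⁻¹ v)) := by
      rw [e2, smul_smul, inv_mul_cancel₀ hμ, one_smul]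
    rw [e, map_smul, map_smul, dil_inv_dil hμ, smul_eq_mul]
    field_simp

theorem eventually_dil_mem_ball (ρ : ℝ) {r : ℝ} (hr : 0 < r) :
    ∀ᶠ μ : ℝ in 𝓝 0, ∀ Y : Model n, ‖Y‖ < ρ → dil μ Y ∈ ball (0 : Model n) r := by
  have hc : Continuous fun μ : ℝ => ‖dil (n := n) μ‖ * |ρ| :=
    (contDiff_dil.continuous.norm).mul continuous_const
  have h0 : dil (n := n) 0 = 0 := ContinuousLinearMap.ext fun Y => by
    rw [dil_apply, zero_smul]; rfl
  have h1 := hc.tendsto 0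
  rw [h0, norm_zero, zero_mul] at h1
  filter_upwards [h1.eventually_lt_const hr] with μ hμ Y hY
  rw [mem_ball_zero_iff]
  calc ‖dil μ Y‖ ≤ ‖dil (n := n) μ‖ * ‖Y‖ := (dil μ).le_opNorm Y
    _ ≤ ‖dil (n := n) μ‖ * |ρ| := by gcongr; exact hY.le.trans (le_abs_self ρ)
    _ < r := hμ

variable {M : Type*} [TopologicalSpace M] [ChartedSpace (Model n) M]
  {S : ContactSubRiemannian n M} {q₀ : M} {φ : OpenPartialHomeomorph M (Model n)}
  {X : Fin (2 * n) → Model n → Model n} {b : Fin n → ℝ}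

/-- The exponential map in the rescaled coordinates. -/
theorem ContactSubRiemannian.IsNormalForm.exists_exponential [T2Space M]
    [IsManifold (𝓡 (2 * n + 1)) ∞ M] (hN : S.IsNormalForm q₀ φ X b) (R : ℝ) :
    ∃ Fr : RescaledFrame n, Fr.b = b ∧ ∃ G : Model n × ℝ → Model n, ContDiff ℝ ∞ G ∧
      (∀ c ∈ closedBall (0 : Model n) R, G (c, 0) = nilY Fr.b c 1) ∧
      (∀ c ∈ closedBall (0 : Model n) R, ∀ k, xc k (fderiv ℝ G (c, 0) (0, 1)) = Fr.firstVar c k) ∧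
      ∃ μ₀ > 0, ∀ μ ∈ Ioo 0 μ₀, ∀ t > 0, ∀ c ∈ closedBall (0 : Model n) R,
        dil μ (G (c, μ)) ∈ φ.target ∧
        chartCovec φ q₀ (codil (μ ^ 2 / t) μ (covOf c)) ∈ S.expDomain q₀ t ∧
        S.srExp q₀ t (chartCovec φ q₀ (codil (μ ^ 2 / t) μ (covOf c))) =
          φ.symm (dil μ (G (c, μ))) := by
  obtain ⟨Fr, hb, r, hr, hsub, hFr⟩ := hN.exists_rescaledFrame
  obtain ⟨μ₁, hμ₁, ρ, G, hG, h⟩ := Fr.exists_exponential R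
  obtain ⟨μ₂, hμ₂, hball⟩ := Metric.eventually_nhds_iff.1 (eventually_dil_mem_ball (n := n) ρ hr)
  refine ⟨Fr, hb, G, hG, fun c hc => (h c hc).1, fun c hc => (h c hc).2.1, min μ₁ μ₂,
    lt_min hμ₁ hμ₂, fun μ hμ t ht c hc => ?_⟩
  have hμa : |μ| = μ := abs_of_pos hμ.1
  obtain ⟨γ, hγ0, hγ1, hγ⟩ := (h c hc).2.2 μ (by rw [hμa]; exact hμ.2.trans_le (min_le_left _ _))
  have hmem : ∀ s ∈ Icc (0 : ℝ) 1, dil μ (γ s).1 ∈ ball (0 : Model n) r := fun s hs =>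
    hball (by rw [Real.dist_eq, sub_zero, hμa]; exact hμ.2.trans_le (min_le_right _ _)) _
      ((norm_fst_le (γ s)).trans_lt (hγ s hs).1)
  have hst : ∀ s ∈ Icc 0 t, s / t ∈ Icc (0 : ℝ) 1 := fun s hs =>
    ⟨div_nonneg hs.1 ht.le, (div_le_one ht).2 hs.2⟩
  have hsol : IsFrameSolution φ X t
      (fun s => (dil μ (γ (s / t)).1, codil (μ ^ 2 / t) μ (γ (s / t)).2)) := fun s hs =>
    ⟨hsub (hmem _ (hst s hs)), (hasDerivWithinAt_rescale isOpen_ball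
      (fun i y hy => ((hN.frame.1 i).contDiffAt
        (φ.open_target.mem_nhds (hsub hy))).differentiableAt (by simp)) hFr hμ.1.ne' ht
      (hmem _ (hst s hs)) (hγ _ (hst s hs)).2).hasDerivWithinAt⟩
  have hexp := hsol.srExp_eq S hN.chart_mem hN.frame ht.le (q := q₀)
    (p := chartCovec φ q₀ (codil (μ ^ 2 / t) μ (covOf c))) (by
      beta_reduce
      rw [zero_div, hγ0]
      dsimp only
      rw [show dil μ (0 : Model n) = 0 from (dil μ).map_zero, chartLift, hN.symm_zero])
  beta_reduce at hexp
  rw [div_self ht.ne', hγ1] at hexp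
  refine ⟨?_, hexp⟩
  rw [← hγ1]
  exact hsub (hmem 1 (by simp))

end Rescaling

/-! ### Critical points of the exponential in rescaled coordinates. -/

section Criticality

open Set Filter Metric Function

variable {n : ℕ}

theorem covOf_bijective : Bijective (covOf (n := n)) := by
  refine ⟨fun c c' h => model_ext (fun k => ?_) ?_, fun ξ =>
    ⟨∑ k, ξ (ex k) • ex k + ξ ez • ez, ContinuousLinearMap.ext fun v => ?_⟩⟩
  · have h1 := congrArg (fun T : Model n →L[ℝ] ℝ => T (ex k)) h
    simpa only [covOf_apply, xc_ex, zc_ex, mul_ite, mul_one, mul_zero, Finset.sum_ite_eq',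
      Finset.mem_univ, if_true, add_zero] using h1
  · have h1 := congrArg (fun T : Model n →L[ℝ] ℝ => T ez) h
    simpa only [covOf_apply, xc_ez, zc_ez, mul_one, mul_zero, Finset.sum_const_zero,
      zero_add] using h1
  · conv_rhs => rw [model_eq_sum v]
    rw [covOf_apply, map_add, map_sum]
    simp only [map_add, map_sum, map_smul, xc_ex, xc_ez, zc_ex, zc_ez, smul_eq_mul, mul_ite,
      mul_one, mul_zero, Finset.sum_ite_eq, Finset.mem_univ, if_true, Finset.sum_const_zero,
      add_zero, zero_add]
    congr 1
    · exact Finset.sum_congr rfl fun _ _ => mul_comm _ _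
    · exact mul_comm _ _

theorem dil_bijective {μ : ℝ} (hμ : μ ≠ 0) : Bijective (dil (n := n) μ) :=
  bijective_iff_has_inverse.2 ⟨dil μ⁻¹, dil_inv_dil hμ, dil_dil_inv hμ⟩

theorem codil_bijective {κ μ : ℝ} (hκ : κ ≠ 0) (hμ : μ ≠ 0) : Bijective (codil (n := n) κ μ) := by
  refine bijective_iff_has_inverse.2 ⟨fun ξ => κ⁻¹ • ξ.comp (dil μ), fun ξ => ?_, fun ξ => ?_⟩
  · refine ContinuousLinearMap.ext fun v => ?_
    change κ⁻¹ * (κ * ξ (dil μ⁻¹ (dil μ v))) = ξ v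
    rw [dil_inv_dil hμ, inv_mul_cancel_left₀ hκ]
  · refine ContinuousLinearMap.ext fun v => ?_
    change κ * (κ⁻¹ * ξ (dil μ (dil μ⁻¹ v))) = ξ v
    rw [dil_dil_inv hμ, mul_inv_cancel_left₀ hκ]

variable {M : Type*} [TopologicalSpace M] [ChartedSpace (Model n) M]
  {φ : OpenPartialHomeomorph M (Model n)}

/-- The identification of the dual of the model space with the cotangent space at `q`. -/
noncomputable def chartCovecCLM (φ : OpenPartialHomeomorph M (Model n)) (q : M) :
    (Model n →L[ℝ] ℝ) →L[ℝ] (Model n →L[ℝ] ℝ) :=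
  (ContinuousLinearMap.compL ℝ (Model n) (Model n) ℝ).flip (chartD φ q)

theorem chartCovecCLM_bijective (hφ : φ ∈ IsManifold.maximalAtlas (𝓡 (2 * n + 1)) ∞ M) {q : M}
    (hq : q ∈ φ.source) : Bijective (chartCovecCLM φ q) := by
  refine ⟨chartCovec_injective hφ hq, fun p => ⟨p.comp (chartSymmD φ (φ q)),
    ContinuousLinearMap.ext fun v => ?_⟩⟩
  change p (chartSymmD φ (φ q) (chartD φ q v)) = p v
  rw [chartSymmD_chartD hφ hq]

theorem chartSymmD_bijective (hφ : φ ∈ IsManifold.maximalAtlas (𝓡 (2 * n + 1)) ∞ M) {y : Model n}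
    (hy : y ∈ φ.target) : Bijective (chartSymmD φ y) :=
  bijective_iff_has_inverse.2 ⟨chartD φ (φ.symm y), chartD_chartSymmD hφ hy, chartSymmD_chartD' hφ hy⟩

/-- Criticality of a map which in coordinates is, up to linear isomorphisms, `G (·, μ)`. -/
theorem surjective_mfderiv_iff (hφ : φ ∈ IsManifold.maximalAtlas (𝓡 (2 * n + 1)) ∞ M)
    {V : Type*} [NormedAddCommGroup V] [NormedSpace ℝ V] [CompleteSpace V]
    {G : Model n × ℝ → Model n} (hG : ContDiff ℝ ∞ G) {μ : ℝ} (hμ : μ ≠ 0)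
    {Ψ : Model n →L[ℝ] V} (hΨ : Bijective Ψ) {F : V → M} {c : Model n}
    (hc : dil μ (G (c, μ)) ∈ φ.target)
    (hF : ∀ᶠ c' in 𝓝 c, F (Ψ c') = φ.symm (dil μ (G (c', μ)))) :
    Surjective (mfderiv 𝓘(ℝ, V) (𝓡 (2 * n + 1)) F (Ψ c)) ↔ Injective (dexp G (c, μ)) := by
  let e : Model n ≃L[ℝ] V := ContinuousLinearEquiv.ofBijective Ψ
    (LinearMap.ker_eq_bot.2 hΨ.1) (LinearMap.range_eq_top.2 hΨ.2)
  have he : ∀ c, e c = Ψ c := fun c => rfl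
  have hes : e.symm (Ψ c) = c := by rw [← he, e.symm_apply_apply]
  have h1 : HasFDerivAt (fun p => dil μ (G (e.symm p, μ)))
      (dil μ ∘L dexp G (c, μ) ∘L (e.symm : V →L[ℝ] Model n)) (Ψ c) := by
    have h2 : HasFDerivAt (fun c' => G (c', μ)) (dexp G (c, μ)) (e.symm (Ψ c)) := by
      rw [hes]; exact RescaledFrame.hasFDerivAt_dexp hG c μ
    exact (dil μ).hasFDerivAt.comp (Ψ c) (h2.comp (Ψ c) e.symm.hasFDerivAt)
  have h2 : HasMFDerivAt 𝓘(ℝ, Model n) (𝓡 (2 * n + 1)) φ.symm (dil μ (G (e.symm (Ψ c), μ)))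
      (chartSymmD φ (dil μ (G (e.symm (Ψ c), μ)))) :=
    ((chart_mdifferentiable hφ).symm.mdifferentiableAt (by rw [hes]; exact hc)).hasMFDerivAt
  have h3 := HasMFDerivAt.comp (Ψ c) h2 h1.hasMFDerivAt
  have h4 : F =ᶠ[𝓝 (Ψ c)] φ.symm ∘ fun p => dil μ (G (e.symm p, μ)) := by
    have ht : Tendsto e.symm (𝓝 (Ψ c)) (𝓝 c) := by
      have := e.symm.continuous.tendsto (Ψ c)
      rwa [hes] at this
    filter_upwards [ht.eventually hF] with p hp
    rw [← he, e.apply_symm_apply] at hp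
    exact hp
  have h5 := (h3.congr_of_eventuallyEq h4).mfderiv
  have h6 : ∀ v : V, mfderiv 𝓘(ℝ, V) (𝓡 (2 * n + 1)) F (Ψ c) v =
      chartSymmD φ (dil μ (G (c, μ))) (dil μ (dexp G (c, μ) (e.symm v))) := fun v => by
    have h7 := congrArg (fun T : V →L[ℝ] Model n => T v) h5
    rw [hes] at h7
    exact h7
  have h8 : Surjective (mfderiv 𝓘(ℝ, V) (𝓡 (2 * n + 1)) F (Ψ c)) ↔
      Surjective ((chartSymmD φ (dil μ (G (c, μ))) ∘ dil μ) ∘ (dexp G (c, μ) ∘ e.symm)) := by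
    rw [show (chartSymmD φ (dil μ (G (c, μ))) ∘ dil μ) ∘ (dexp G (c, μ) ∘ e.symm) =
      (mfderiv 𝓘(ℝ, V) (𝓡 (2 * n + 1)) F (Ψ c) : V → Model n) from funext fun v => (h6 v).symm]
    rfl
  -- Every factor other than `dexp` is an isomorphism, and for an endomorphism in finite dimension
  -- surjectivity and injectivity agree.
  rw [h8, Surjective.of_comp_iff' ((chartSymmD_bijective hφ hc).comp (dil_bijective hμ)),
    Surjective.of_comp_iff _ e.symm.surjective]
  exact (LinearMap.injective_iff_surjective (f := (dexp G (c, μ)).toLinearMap)).symm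

end Criticality

/-! ### Conjugate points of the original structure. -/

section FirstConjugatePoints

open Set Filter Metric Function

variable {n : ℕ} {M : Type*} [TopologicalSpace M] [ChartedSpace (Model n) M]
  {S : ContactSubRiemannian n M} {q₀ : M} {φ : OpenPartialHomeomorph M (Model n)}
  {X : Fin (2 * n) → Model n → Model n} {b : Fin n → ℝ}

theorem covec_eq (q₀ : M) (φ : OpenPartialHomeomorph M (Model n)) (h : Fin (2 * n) → ℝ) (h₀ : ℝ) :
    ContactSubRiemannian.covec q₀ φ h h₀ = chartCovec φ q₀ (covOf (horVert h h₀)) := by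
  have h1 : ∑ i : Fin (2 * n), h i • xc i + h₀ • zc = covOf (horVert h h₀) := by
    refine ContinuousLinearMap.ext fun v => ?_
    rw [covOf_apply]
    simp only [xc_horVert, zc_horVert, add_apply, sum_apply, smul_apply, smul_eq_mul]
  rw [← h1]
  rfl

namespace ContactSubRiemannian.IsNormalForm

theorem ham_covec (hN : S.IsNormalForm q₀ φ X b) (h : Fin (2 * n) → ℝ) (h₀ : ℝ) :
    S.ham q₀ (covec q₀ φ h h₀) = 1 / 2 * ∑ i, h i ^ 2 := by
  have h1 := ham_eq_sum S hN.frame hN.zero_mem_target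
    (chartCovec φ (φ.symm 0) (covOf (horVert h h₀)))
  simp only [chartCovec_chartVec hN.chart_mem hN.zero_mem_target, hN.frame_zero] at h1
  rw [hN.symm_zero] at h1
  rw [covec_eq, h1]
  congr 1
  refine Finset.sum_congr rfl fun i _ => ?_
  rw [covOf_apply]
  simp only [xc_horVert, xc_ex, zc_ex, mul_ite, mul_one, mul_zero, Finset.sum_ite_eq',
    Finset.mem_univ, if_true, add_zero]

/-- The map `F` and its critical points in the rescaled coordinates. -/
theorem exists_rescaledExp [T2Space M] [IsManifold (𝓡 (2 * n + 1)) ∞ M]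
    (hN : S.IsNormalForm q₀ φ X b) (R : ℝ) :
    ∃ Fr : RescaledFrame n, Fr.b = b ∧ ∃ G : Model n × ℝ → Model n, ContDiff ℝ ∞ G ∧
      (∀ c ∈ closedBall (0 : Model n) R, G (c, 0) = nilY Fr.b c 1) ∧
      (∀ c ∈ closedBall (0 : Model n) R, ∀ k, xc k (fderiv ℝ G (c, 0) (0, 1)) = Fr.firstVar c k) ∧
      ∃ μ₀ > 0, ∀ lam > 0, ∀ η > 0, ∀ w > 0, ∀ u : Fin (2 * n) → ℝ, lam * η * w < μ₀ →
        ‖horVert u w‖ < R →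
        (∀ k, φ (S.rescaledExp q₀ φ w (lam • u) η) (Fin.castSucc k) =
          lam * η * w * xc k (G (horVert u w, lam * η * w))) ∧
        S.rescaledExp q₀ φ w (lam • u) η ∈ φ.source ∧
        (S.IsConjugateTime q₀ (covec q₀ φ (lam • u) η⁻¹) (η * w) ↔
          ¬Injective (dexp G (horVert u w, lam * η * w))) := by
  obtain ⟨Fr, hb, G, hG, hnil, hvar, μ₀, hμ₀, hexp⟩ := hN.exists_exponential R
  refine ⟨Fr, hb, G, hG, hnil, hvar, μ₀, hμ₀, fun lam hlam η hη w hw u hμ hc => ?_⟩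
  have hμ0 : 0 < lam * η * w := by positivity
  have ht : 0 < η * w := by positivity
  -- For μ = ληw and t = ηw, the factor (μ²/t) μ⁻¹ on horizontal components is λ, and (μ²/t) μ⁻² w
  -- is η⁻¹.
  have hcov : covec q₀ φ (lam • u) η⁻¹ = chartCovec φ q₀
      (codil ((lam * η * w) ^ 2 / (η * w)) (lam * η * w) (covOf (horVert u w))) := by
    rw [covec_eq, codil_covOf (h := lam • u) (h₀ := η⁻¹) (fun k => ?_) ?_]
    · field_simp
    · field_simp
      rfl
  obtain ⟨htgt, hdom, heq⟩ := hexp _ ⟨hμ0, hμ⟩ _ ht (horVert u w) (mem_closedBall_zero_iff.2 hc.le)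
  have hF : S.rescaledExp q₀ φ w (lam • u) η = φ.symm (dil (lam * η * w) (G (horVert u w, lam * η * w))) := by
    rw [rescaledExp, hcov, heq]
  refine ⟨fun k => ?_, ?_, ?_⟩
  · rw [hF, φ.right_inv htgt]
    exact xc_dil _ k _
  · rw [hF]; exact φ.map_target htgt
  · have hΨ : Bijective ((chartCovecCLM φ q₀).comp
        ((codil ((lam * η * w) ^ 2 / (η * w)) (lam * η * w)).comp (covOf (n := n)))) :=
      (chartCovecCLM_bijective hN.chart_mem hN.mem_source).comp
        ((codil_bijective (by positivity) hμ0.ne').comp covOf_bijective)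
    have hev : ∀ᶠ c' in 𝓝 (horVert u w), c' ∈ closedBall (0 : Model n) R :=
      mem_of_superset (isOpen_ball.mem_nhds (mem_ball_zero_iff.2 hc)) ball_subset_closedBall
    have hs := surjective_mfderiv_iff hN.chart_mem hG hμ0.ne' hΨ
      (F := fun p₁ : Model n →L[ℝ] ℝ => S.srExp q₀ (η * w) p₁) htgt
      (hev.mono fun c' hc' => (hexp _ ⟨hμ0, hμ⟩ _ ht c' hc').2.2)
    rw [← hs, hcov]
    exact ⟨fun h => h.2.2, fun h => ⟨ht, hdom, h⟩⟩

end ContactSubRiemannian.IsNormalForm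

theorem norm_horVert_le (u : Fin (2 * n) → ℝ) {w : ℝ} (hw : 0 ≤ w) :
    ‖horVert u w‖ ≤ ‖hvec u‖ + w := by
  refine (norm_add_le _ _).trans ?_
  rw [norm_smul, norm_ez, mul_one, Real.norm_of_nonneg hw]

/-- Second-order expansion along a line of parameters. -/
theorem exists_expansion {G : Model n × ℝ → Model n} (hG : ContDiff ℝ ∞ G) (c : Model n)
    (k : Fin (2 * n)) : ∃ C > 0, ∃ δ > 0, ∀ μ ∈ Ioo 0 δ,
      |μ * xc k (G (c, μ)) - (μ * xc k (G (c, 0)) + μ ^ 2 * xc k (fderiv ℝ G (c, 0) (0, 1)))| ≤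
        C * μ ^ 3 := by
  obtain ⟨C, hC, δ, hδ, h⟩ := exists_taylor_bound (x₀ := (c, (0 : ℝ)))
    ((contDiff_infty.1 hG 2).contDiffAt)
  refine ⟨C, hC, δ, hδ, fun μ hμ => ?_⟩
  have hsub : ((c, μ) : Model n × ℝ) - (c, 0) = μ • ((0, 1) : Model n × ℝ) := by
    ext <;> simp
  have hnorm : ‖μ • ((0, 1) : Model n × ℝ)‖ = μ := by
    rw [norm_smul, Prod.norm_mk]
    simp [abs_of_pos hμ.1]
  have h1 := h (c, 0) (by rwa [dist_self]) (c, μ) (by rw [dist_eq_norm, hsub, hnorm]; exact hμ.2)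
  rw [hsub, hnorm, map_smul] at h1
  have h2 := (abs_xc_le_norm k _).trans h1
  rw [map_sub, map_sub, map_smul, smul_eq_mul] at h2
  calc |μ * xc k (G (c, μ)) - (μ * xc k (G (c, 0)) + μ ^ 2 * xc k (fderiv ℝ G (c, 0) (0, 1)))|
      = |μ * (xc k (G (c, μ)) - xc k (G (c, 0)) - μ * xc k (fderiv ℝ G (c, 0) (0, 1)))| := by
        congr 1; ring
    _ = μ * |xc k (G (c, μ)) - xc k (G (c, 0)) - μ * xc k (fderiv ℝ G (c, 0) (0, 1))| := by
        rw [abs_mul, abs_of_pos hμ.1]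
    _ ≤ μ * (C * μ ^ 2) := mul_le_mul_of_nonneg_left h2 hμ.1.le
    _ = C * μ ^ 3 := by ring

end FirstConjugatePoints

/-! ### Conclusion. -/

theorem propositionP {n : ℕ} [NeZero n] {M : Type*} [TopologicalSpace M] [T2Space M]
    [ChartedSpace (Model n) M] [IsManifold (𝓡 (2 * n + 1)) ∞ M]
    (S : ContactSubRiemannian n M) (q₀ : M)
    (φ : OpenPartialHomeomorph M (Model n)) (X : Fin (2 * n) → Model n → Model n)
    (b : Fin n → ℝ) (hX : S.IsNormalForm q₀ φ X b) (hb : StrictAnti b) :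
    ∃ (κ : Fin (2 * n) → Fin (2 * n) → Fin (2 * n) → ℝ) (α β : ℝ),
      S.IsKappa q₀ φ b κ ∧
      κ (oddIdx 0) (oddIdx 0) (oddIdx 0) = 3 * α ∧
      κ (evenIdx 0) (evenIdx 0) (oddIdx 0) = α ∧
      κ (oddIdx 0) (evenIdx 0) (evenIdx 0) = 2 * α ∧
      κ (oddIdx 0) (oddIdx 0) (evenIdx 0) = β ∧
      κ (evenIdx 0) (evenIdx 0) (evenIdx 0) = 3 * β ∧
      κ (oddIdx 0) (evenIdx 0) (oddIdx 0) = 2 * β ∧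
      ∀ R > 0, ∀ ε ∈ Set.Ioo (0 : ℝ) 1, ∃ C > 0, ∃ η₀ > 0, ∀ η ∈ Set.Ioo (0 : ℝ) η₀,
        ∀ h : Fin (2 * n) → ℝ,
          let h1 := h (oddIdx 0)
          let h2 := h (evenIdx 0)
          let p₀ := ContactSubRiemannian.covec q₀ φ h η⁻¹
          let γ11 := gammaCoef κ h (oddIdx 0) (oddIdx 0)
          let γ12 := gammaCoef κ h (oddIdx 0) (evenIdx 0)
          let γ21 := gammaCoef κ h (evenIdx 0) (oddIdx 0)
          let γ22 := gammaCoef κ h (evenIdx 0) (evenIdx 0)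
          S.ham q₀ p₀ ∈ Set.Ioo 0 R → ε * S.ham q₀ p₀ ≤ h1 ^ 2 + h2 ^ 2 →
          ∃ τc : ℝ, S.IsFirstConjugateTime q₀ p₀ (η * τc) ∧
            S.rescaledExp q₀ φ τc h η ∈ φ.source ∧
            |φ (S.rescaledExp q₀ φ τc h η) (oddIdx 0).castSucc
              - η ^ 2 / (h1 ^ 2 + h2 ^ 2) *
                ((γ11 - γ22) * h1 ^ 3 + γ12 * h2 ^ 3 + (γ21 + 2 * γ12) * h1 ^ 2 * h2
                  + deltaCoef κ α h (oddIdx 0))| ≤ C * η ^ 3 ∧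
            |φ (S.rescaledExp q₀ φ τc h η) (evenIdx 0).castSucc
              - η ^ 2 / (h1 ^ 2 + h2 ^ 2) *
                (γ12 * h1 ^ 3 - (γ11 - γ22) * h2 ^ 3 + (γ12 + 2 * γ21) * h1 * h2 ^ 2
                  + deltaCoef κ β h (evenIdx 0))| ≤ C * η ^ 3 := by
  obtain ⟨w₁, hw₁⟩ : ∃ w₁, w₁ * b 0 = 2 * Real.pi := ⟨_, div_mul_cancel₀ _ (hX.b_pos 0).ne'⟩
  -- The ball must contain all covectors with unit horizontal part and vertical part below `w₁ + 1`,
  -- with room to spare.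
  obtain ⟨Fr, rfl, G, hG, hnil, hvar, μ₀, hμ₀, hexp⟩ := hX.exists_rescaledExp (w₁ + 3)
  have hpos := Fr.pos_of_mul_eq_two_pi hw₁
  obtain ⟨hk1, hk2, hk3, hk4⟩ := Fr.quadCoef_relations hw₁
  refine ⟨Fr.quadCoef w₁, Fr.quadCoef w₁ (evenIdx 0) (evenIdx 0) (oddIdx 0),
    Fr.quadCoef w₁ (oddIdx 0) (oddIdx 0) (evenIdx 0), fun h k => ?_, hk1, rfl, hk2, rfl, hk3, hk4,
    fun R hR ε hε => ?_⟩
  · have hw : 2 * Real.pi / Fr.b 0 = w₁ := (eq_div_of_mul_eq (hX.b_pos 0).ne' hw₁).symm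
    rw [hw]
    -- Here `h` is arbitrary, possibly zero, so it is divided by 1 + ‖h‖ rather than normalized.
    obtain ⟨lam, hlam, u, rfl, hu⟩ : ∃ lam > (0 : ℝ), ∃ u, lam • u = h ∧ ‖hvec u‖ ≤ 1 := by
      have hl : 0 < 1 + ‖hvec h‖ := by positivity
      refine ⟨1 + ‖hvec h‖, hl, (1 + ‖hvec h‖)⁻¹ • h, smul_inv_smul₀ hl.ne' h, ?_⟩
      rw [RescaledFrame.hvec_smul, norm_smul, norm_inv, Real.norm_of_nonneg hl.le,
        inv_mul_le_one₀ hl]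
      linarith
    have hc : ‖horVert u w₁‖ < w₁ + 3 := by
      have := norm_horVert_le u hpos.le
      linarith
    obtain ⟨C, hC, δ, hδ, hexpand⟩ := exists_expansion hG (horVert u w₁) k
    refine ⟨lam * w₁ * xc k (G (horVert u w₁, 0)), Asymptotics.IsBigO.of_bound (C * (lam * w₁) ^ 3) ?_⟩
    have hlw : 0 < lam * w₁ := by positivity
    filter_upwards [Ioo_mem_nhdsGT (show 0 < min μ₀ δ / (lam * w₁) by positivity)] with η hη
    have hη0 : 0 < η := hη.1
    have hμ : lam * η * w₁ < min μ₀ δ := by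
      have := (lt_div_iff₀ hlw).1 hη.2
      linarith [show lam * η * w₁ = η * (lam * w₁) by ring]
    have h1 := (hexp lam hlam η hη0 w₁ hpos u (hμ.trans_le (min_le_left _ _)) hc).1 k
    have h2 := hexpand (lam * η * w₁) ⟨by positivity, hμ.trans_le (min_le_right _ _)⟩
    have h3 : xc k (fderiv ℝ G (horVert u w₁, 0) (0, 1)) =
        Fr.varForm w₁ k (hvec u) (hvec u) := by
      rw [hvar _ (mem_closedBall_zero_iff.2 hc.le), Fr.firstVar_eq_varForm, zc_horVert,
        (Fr.varForm_horVert w₁ k u w₁ _).1, (Fr.varForm_horVert w₁ k u w₁ _).2]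
    rw [h3] at h2
    rw [h1, Fr.sum_quadCoef, RescaledFrame.hvec_smul, map_smul, map_smul, LinearMap.smul_apply,
      Real.norm_eq_abs, Real.norm_of_nonneg (by positivity : 0 ≤ η ^ 3), smul_eq_mul, smul_eq_mul]
    refine (le_of_eq ?_).trans (h2.trans (le_of_eq ?_))
    · congr 1; ring
    · ring
  · have hlt : ∀ j : Fin n, j ≠ 0 → Fr.b j < Fr.b 0 := fun j hj => hb (Fin.pos_iff_ne_zero.2 hj)
    -- Since H = |h|²/2, the cone condition with ε becomes u₁² + u₂² ≥ ε/2 for the unit covector.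
    obtain ⟨C, hC, η₁, hη₁, hsing⟩ := Fr.exists_first_singular hG hnil hvar hw₁
      (by linarith : w₁ + 2 < w₁ + 3) hlt (half_pos hε.1)
    have hL : 0 < Real.sqrt (2 * R) + 1 := by positivity
    -- The estimates hold for λη in place of η, and λ = |h| < √(2R) + 1 because H < R; `μ₀ / (w₁ +
    -- 1)` keeps μ = ληw below `μ₀`.
    refine ⟨C * (Real.sqrt (2 * R) + 1) ^ 3, by positivity,
      min η₁ (μ₀ / (w₁ + 1)) / (Real.sqrt (2 * R) + 1), by positivity, fun η hη h => ?_⟩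
    intro h1 h2 p₀ γ11 γ12 γ21 γ22 hham hcone
    have hη0 : 0 < η := hη.1
    rw [hX.ham_covec] at hham hcone
    have hsum : 0 < ∑ i, h i ^ 2 := by linarith [hham.1]
    obtain ⟨lam, hlam, hlsq⟩ : ∃ lam > (0 : ℝ), lam ^ 2 = ∑ i, h i ^ 2 :=
      ⟨Real.sqrt (∑ i, h i ^ 2), Real.sqrt_pos.2 hsum, Real.sq_sqrt hsum.le⟩
    have hlL : lam < Real.sqrt (2 * R) + 1 := by
      have : lam ≤ Real.sqrt (2 * R) := Real.le_sqrt_of_sq_le (by linarith [hham.2])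
      linarith
    obtain ⟨u, rfl⟩ : ∃ u, lam • u = h := ⟨lam⁻¹ • h, smul_inv_smul₀ hlam.ne' h⟩
    simp only [Pi.smul_apply, smul_eq_mul, mul_pow, ← Finset.mul_sum] at hlsq
    have hu1 : ∑ i, u i ^ 2 = 1 := mul_left_cancel₀ (pow_pos hlam 2).ne' (by rw [← hlsq, mul_one])
    have hr : lam ^ 2 * (u (oddIdx 0) ^ 2 + u (evenIdx 0) ^ 2) = h1 ^ 2 + h2 ^ 2 := by
      simp only [h1, h2, Pi.smul_apply, smul_eq_mul]; ring
    simp only [Pi.smul_apply, smul_eq_mul, mul_pow, ← Finset.mul_sum, hu1] at hcone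
    have hu : u ∈ unitCovectors (0 : Fin n) (ε / 2) := by
      refine ⟨hu1, le_of_mul_le_mul_left ?_ (pow_pos hlam 2)⟩
      rw [hr]
      linarith
    have hle : lam * η < min η₁ (μ₀ / (w₁ + 1)) := by
      have := (lt_div_iff₀ hL).1 hη.2
      nlinarith
    obtain ⟨w, hw, hnot, hinj, hpt⟩ := hsing (lam * η)
      ⟨by positivity, hle.trans_le (min_le_left _ _)⟩ u hu
    have hsmall : ∀ w' ≤ w, lam * η * w' < μ₀ := fun w' hw' => by
      have e1 := (lt_div_iff₀ (by linarith : 0 < w₁ + 1)).1 (hle.trans_le (min_le_right _ _))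
      have e2 : lam * η * w' ≤ lam * η * (w₁ + 1) :=
        mul_le_mul_of_nonneg_left (hw'.trans hw.2.le) (by positivity)
      linarith
    have hnorm : ∀ w' > 0, w' ≤ w → ‖horVert u w'‖ < w₁ + 3 := fun w' hw0 hw' =>
      norm_horVert_lt hu hw0.le (by linarith [hw.2])
    obtain ⟨hco, hsrc, hconj⟩ := hexp lam hlam η hη0 w hw.1 u (hsmall w le_rfl) (hnorm w hw.1 le_rfl)
    have hbound : ∀ k, k = oddIdx 0 ∨ k = evenIdx 0 →
        |φ (S.rescaledExp q₀ φ w (lam • u) η) (Fin.castSucc k) -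
          η ^ 2 * Fr.pointCoef w₁ 0 (lam • u) k| ≤ C * (Real.sqrt (2 * R) + 1) ^ 3 * η ^ 3 := fun k hk => by
      have e1 := hpt k hk
      rw [hco k, Fr.pointCoef_smul w₁ lam hlam.ne']
      refine (le_of_eq ?_).trans (e1.trans ?_)
      · congr 1; ring
      · rw [mul_pow, ← mul_assoc]
        gcongr
    have hr0 : h1 ^ 2 + h2 ^ 2 ≠ 0 := by
      rw [← hr]
      have := hu.2
      have := hε.1
      have : 0 < u (oddIdx 0) ^ 2 + u (evenIdx 0) ^ 2 := by linarith
      positivity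
    obtain ⟨hp1, hp2⟩ := Fr.pointCoef_eq hw₁ (lam • u) hr0
    refine ⟨w, ⟨hconj.2 hnot, fun t₁ ht₁ => ?_⟩, hsrc, ?_, ?_⟩
    -- An earlier conjugate time `t₁` would make the rescaled derivative singular at the parameter
    -- `t₁ / η < w`.
    · by_contra hlt'
      have hlt₁ : t₁ < η * w := not_le.1 hlt'
      have ht0 : 0 < t₁ := ht₁.1
      have hw' : 0 < t₁ / η := by positivity
      have hww : t₁ / η < w := (div_lt_iff₀' hη0).2 hlt₁
      have e1 := (hexp lam hlam η hη0 (t₁ / η) hw' u (hsmall _ hww.le) (hnorm _ hw' hww.le)).2.2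
      rw [mul_div_cancel₀ _ hη0.ne'] at e1
      exact e1.1 ht₁ (hinj _ ⟨hw'.le, hww⟩)
    · have e1 := hbound _ (Or.inl rfl)
      rw [hp1] at e1
      refine (le_of_eq ?_).trans e1
      simp only [h1, h2, γ11, γ12, γ21, γ22]
      congr 1
      ring
    · have e1 := hbound _ (Or.inr rfl)
      rw [hp2] at e1
      refine (le_of_eq ?_).trans e1
      simp only [h1, h2, γ11, γ12, γ21, γ22]
      congr 1
      ring
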